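/- \textbf{Setting.} Let $m\ge 1$, $d\ge 0$, let $\mu$ be a primitive $m$-th root of unity, $\tau\in\mathbb C\setminus\{0\}$, $k=(k_0,\dots,k_{m-1})\in\mathbb C^m$, $I=\mathbb Z/m\mathbb Z$ and $\lambda_i=m(k_{i-1}-k_i)-\tau$ for $i\in I$. The cyclic group $\Gamma=\{s^r\}$ of order $m$ acts on $\mathbb C(x)$ by $s(f)(x)=f(\mu^{-1}x)$; $\mathbb C(x)*\Gamma$ is the crossed product and $\epsilon_i=\frac1m\sum_{r=0}^{m-1}\mu^{-ir}s^r$. Put $\theta(fs^r)=\mu^r fs^r$ and $D(f)=\tau\,\partial(f)-x^{-1}\big[\sum_i mk_i\epsilon_i,f\big]$ for $f\in\mathbb C(x)*\Gamma$, where $\partial=d/dx$ acts on coefficients. Let $\mathcal P$ be the ring of formal series $\sum_{j\ge0}f_jy^{N-j}$, $N\in\mathbb Z$, $f_j\in\mathbb C(x)*\Gamma$, with multiplication determined by $yf=\theta^{-1}(f)y+D(f)$ (so $y$ is the Dunkl operator $\tau\partial-x^{-1}\sum_i mk_i\epsilon_i$). For $S\in\mathcal P$, or $S\in\mathrm{Mat}(d,\mathbb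 C)\otimes\mathcal P$ entrywise, $S_+$ is the part of $S$ with nonnegative powers of $y$. $E_\beta$ is the diagonal matrix unit, $1\le\beta\le d$. \textbf{The hierarchy.} It concerns pairs $(L,(R_\alpha)_{\alpha=1}^d)$ in $\mathrm{Mat}(d,\mathbb C)\otimes\mathcal P$ with $L=y+\sum_{l\ge0}f_ly^{-l}$, $R_\alpha=E_\alpha+\sum_{l\ge1}r_{l\alpha}y^{-l}$, $[L,R_\alpha]=0$, $R_\alpha R_\beta=\delta_{\alpha\beta}R_\alpha$, $\sum_\alpha R_\alpha=1$, and such that the diagonal entries of $f_0$ have zero coefficient at the identity of $\Gamma$. For times $t_{k\beta}$ ($k\ge0$, $1\le\beta\le d$; finitely many nonzero, complex) the equations are $$\frac{\partial L}{\partial t_{k\beta}}=[(L^kR_\beta)_+,L],\qquad \frac{\partial R_\alpha}{\partial t_{k\beta}}=[(L^kR_\beta)_+,R_\alpha],$$ derivatives being taken coefficientwise. \textbf{The spaces.} Let $\alpha\in\mathbb N_0^m$, $V_i=\mathbb C^{\alpha_i}$, $V=\bigoplus_{i\in I}V_i$, with projections $e_i$ onto $V_i$. Consider the vector space of data $X_i:V_i\to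 V_{i+1}$, $Y_i:V_{i+1}\to V_i$, $v_i:\mathbb C^d\to V_i$, $w_i:V_i\to\mathbb C^d$ ($i\in I$), i.e. representations for the cyclic quiver with $d$ framing arrows from each vertex, with the Poisson bracket whose only nonzero brackets of coordinates are $\{(X_i)_{ab},(Y_j)_{cd}\}=\delta_{ij}\delta_{ad}\delta_{bc}$, $\{(v_{i,\beta})_a,(w_{j,\gamma})_b\}=\delta_{ij}\delta_{ab}\delta_{\beta\gamma}$. Put $X=\sum X_i$, $Y=\sum Y_i\in\mathrm{End}\,V$. Let $\mathcal C_{\alpha,\lambda}$ be the set of $\mathrm{GL}(\alpha)=\prod_i\mathrm{GL}(\alpha_i,\mathbb C)$-orbits of data satisfying $Y_iX_i-X_{i-1}Y_{i-1}-v_iw_i=\lambda_i1_{V_i}$ for all $i\in I$. (For regular $\lambda$ all orbits are closed and this is the Calogero--Moser space; regularity is not needed for the statement.) A Hamiltonian flow line on $\mathcal C_{\alpha,\lambda}$ of an invariant function $H$ is a curve which is locally the image of an integral curve, consisting of such data, of the Hamiltonian vector field $\dot\xi=\{\xi,H\}$. Time is complex. Let $$H_{k,\beta}=-\sum_{i\in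 I}\mathrm{tr}\,(E_\beta w_iY^kv_{i+k}),\qquad k\ge0,\ 1\le\beta\le d,$$ $$M=1-\sum_{i,j\in I}\epsilon_iw_i(X-x1_V)^{-1}(Y-y1_V)^{-1}v_j\epsilon_j\in\mathrm{Mat}(d,\mathbb C)\otimes\mathcal P,\qquad (Y-y1_V)^{-1}=-\sum_{k\ge0}Y^ky^{-k-1}.$$ \textbf{Theorem.} (1) The Hamiltonian vector field of $H_{k,\beta}$ on the space of data is $$\dot X=-\sum_{l\in I}\sum_{a=0}^{k-1}Y^av_lE_\beta w_{l-k}Y^{k-a-1},\quad \dot Y=0,\quad \dot v_j=-Y^kv_{j+k}E_\beta,\quad \dot w_i=E_\beta w_{i-k}Y^k.$$ The functions $H_{k,\beta}$ are $\mathrm{GL}(\alpha)$-invariant and Poisson commute. (2) $M$ is invertible, and $(X,Y,v_i,w_i)\mapsto(L,(R_\alpha))$, $L=MyM^{-1}$, $R_\alpha=ME_\alpha M^{-1}$, induces a well-defined map $\Phi$ from $\mathcal C_{\alpha,\lambda}$ to the set of pairs described above. (3) $\Phi$ sends the Hamiltonian flows to the flows of the hierarchy: along every flow line of $H_{k,\beta}$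 on $\mathcal C_{\alpha,\lambda}$, with time $t$, one has $\frac{dL}{dt}=[(L^kR_\beta)_+,L]$ and $\frac{dR_\alpha}{dt}=[(L^kR_\beta)_+,R_\alpha]$ for all $\alpha$. (4) The Hamiltonian flows of all $H_{k,\beta}$ are complete and commute: there is an action $z\mapsto t\cdot z$ on $\mathcal C_{\alpha,\lambda}$ of the additive group of times $t=(t_{k\beta})$ whose restriction to each coordinate direction consists of flow lines of $H_{k,\beta}$. For every initial point $z\in\mathcal C_{\alpha,\lambda}$, the family $t\mapsto\Phi(t\cdot z)$ is a solution of the whole hierarchy. -/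

import Mathlib

open Polynomial Filter Topology

noncomputable section

/-- A ring automorphism `σ` of `A` and a `σ`-derivation `δ`. -/
structure SkewDerivation (A : Type) [Ring A] where
  σ : A ≃+* A
  δ : A →+ A
  leibniz : ∀ a b : A, δ (a * b) = σ a * δ b + δ a * b

/-- Families `(f n)` indexed by `ℤ` vanishing for all large `n`. -/
def boundedAboveSeries (A : Type) [Ring A] : AddSubgroup (ℤ → A) where
  carrier := {f | ∃ N : ℤ, ∀ n : ℤ, N < n → f n = 0}
  zero_mem' := ⟨0, fun _ _ => rfl⟩
  add_mem' := by
    rintro f g ⟨N, hN⟩ ⟨K, hK⟩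
    refine ⟨max N K, fun n hn => ?_⟩
    simp [hN n (lt_of_le_of_lt (le_max_left _ _) hn), hK n (lt_of_le_of_lt (le_max_right _ _) hn)]
  neg_mem' := by
    rintro f ⟨N, hN⟩
    exact ⟨N, fun n hn => by simp [hN n hn]⟩

/-- The set of formal series `∑ fₙ yⁿ`, `fₙ ∈ A`, with powers of `y` bounded above. It is made into a
ring below, with the multiplication determined by `y f = σ(f) y + δ(f)`. -/
def SkewLaurent {A : Type} [Ring A] (_S : SkewDerivation A) : Type := boundedAboveSeries A

namespace SkewLaurent

variable {A : Type} [Ring A] {S : SkewDerivation A}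

instance : AddCommGroup (SkewLaurent S) := inferInstanceAs (AddCommGroup (boundedAboveSeries A))

/-- The coefficient of `yⁿ` (coefficients on the left). -/
def coeff (u : SkewLaurent S) (n : ℤ) : A := u.1 n

/-- The series with given coefficients. -/
def mk (f : ℤ → A) (hf : ∃ N : ℤ, ∀ n : ℤ, N < n → f n = 0) : SkewLaurent S := ⟨f, hf⟩

@[simp] theorem coeff_mk (f : ℤ → A) (hf) (n : ℤ) : (mk f hf : SkewLaurent S).coeff n = f n := rfl

@[ext] theorem ext {u w : SkewLaurent S} (h : ∀ n, u.coeff n = w.coeff n) : u = w :=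
  Subtype.ext (funext h)

@[simp] theorem coeff_add (u w : SkewLaurent S) (n : ℤ) :
    (u + w).coeff n = u.coeff n + w.coeff n := rfl
@[simp] theorem coeff_zero (n : ℤ) : (0 : SkewLaurent S).coeff n = 0 := rfl
@[simp] theorem coeff_neg (u : SkewLaurent S) (n : ℤ) : (-u).coeff n = -u.coeff n := rfl

theorem bdd (u : SkewLaurent S) : ∃ N : ℤ, ∀ n : ℤ, N < n → u.coeff n = 0 := u.2

/-- All powers of `y` in `u` are at most `N`. -/
def BddBy (u : SkewLaurent S) (N : ℤ) : Prop := ∀ n : ℤ, N < n → u.coeff n = 0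

/-- Left multiplication by `y`: `y · ∑ fₙ yⁿ = ∑ (σ(fₙ₋₁) + δ(fₙ)) yⁿ`. -/
def lmulY : AddMonoid.End (SkewLaurent S) where
  toFun u := mk (fun n => S.σ (u.coeff (n - 1)) + S.δ (u.coeff n)) (by
    obtain ⟨N, hN⟩ := u.bdd
    exact ⟨N + 1, fun n hn => by simp [hN n (by omega), hN (n - 1) (by omega)]⟩)
  map_zero' := by ext n; simp
  map_add' u w := by ext n; simp; abel

theorem coeff_lmulY (u : SkewLaurent S) (n : ℤ) :
    (lmulY u).coeff n = S.σ (u.coeff (n - 1)) + S.δ (u.coeff n) := rfl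

/-- With `θ = σ⁻¹`, the operator `(-1)^p (θ δ)^p θ` occurring in
`y⁻¹ f = ∑_{p ≥ 0} (-1)^p (θ δ)^p θ(f) y^{-1-p}`. -/
def invTerm (S : SkewDerivation A) : ℕ → (A →+ A)
  | 0 => (S.σ.symm : A ≃+* A).toAddMonoidHom
  | p + 1 => -((S.σ.symm : A ≃+* A).toAddMonoidHom.comp (S.δ.comp (invTerm S p)))

theorem invTerm_zero (a : A) : invTerm S 0 a = S.σ.symm a := rfl

theorem invTerm_succ (p : ℕ) (a : A) :
    invTerm S (p + 1) a = - S.σ.symm (S.δ (invTerm S p a)) := rfl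

theorem invTerm_succ_right (p : ℕ) (a : A) :
    invTerm S (p + 1) a = - invTerm S p (S.δ (S.σ.symm a)) := by
  induction p with
  | zero => rfl
  | succ p ih => rw [invTerm_succ, ih, invTerm_succ]; simp

theorem invSupport {u : SkewLaurent S} {N : ℤ} (hN : u.BddBy N) (n : ℤ) :
    (Function.support fun p : ℕ => invTerm S p (u.coeff (n + 1 + p))) ⊆
      (Finset.range (N - n).toNat : Finset ℕ) := by
  intro p hp
  by_contra h
  refine hp ?_
  simp only [Finset.coe_range, Set.mem_Iio, not_lt] at h
  simp [hN (n + 1 + p) (by omega)]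

/-- Left multiplication by `y⁻¹`, given by `y⁻¹ f = ∑_{p ≥ 0} (-1)^p (θ δ)^p θ(f) y^{-1-p}`. -/
def lmulYInv : AddMonoid.End (SkewLaurent S) where
  toFun u := mk (fun n => ∑ᶠ p : ℕ, invTerm S p (u.coeff (n + 1 + p))) (by
    obtain ⟨N, hN⟩ := u.bdd
    refine ⟨N - 1, fun n hn => ?_⟩
    apply finsum_eq_zero_of_forall_eq_zero
    intro p
    simp [hN (n + 1 + p) (by omega)])
  map_zero' := by ext n; simp
  map_add' u w := by
    obtain ⟨N, hN⟩ := u.bdd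
    obtain ⟨K, hK⟩ := w.bdd
    ext n
    simp only [coeff_mk, coeff_add, map_add]
    exact finsum_add_distrib ((Finset.finite_toSet _).subset (invSupport hN n))
      ((Finset.finite_toSet _).subset (invSupport hK n))

theorem coeff_lmulYInv_eq {u : SkewLaurent S} {N : ℤ} (hN : u.BddBy N) (n : ℤ) {B : ℕ}
    (hB : (N - n).toNat ≤ B) :
    (lmulYInv u).coeff n = ∑ p ∈ Finset.range B, invTerm S p (u.coeff (n + 1 + p)) := by
  refine finsum_eq_sum_of_support_subset _ ((invSupport hN n).trans ?_)
  simpa using hB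

theorem BddBy.lmulY {u : SkewLaurent S} {N : ℤ} (hN : u.BddBy N) : (lmulY u).BddBy (N + 1) :=
  fun n hn => by simp [coeff_lmulY, hN n (by omega), hN (n - 1) (by omega)]

theorem BddBy.lmulYInv {u : SkewLaurent S} {N : ℤ} (hN : u.BddBy N) :
    (lmulYInv u).BddBy (N - 1) := fun n hn => by
  rw [coeff_lmulYInv_eq hN n le_rfl]
  rw [show (N - n).toNat = 0 by omega]; simp

theorem lmulY_lmulYInv (u : SkewLaurent S) : lmulY (lmulYInv u) = u := by
  obtain ⟨N, hN⟩ := u.bdd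
  ext n
  rw [coeff_lmulY, coeff_lmulYInv_eq hN n le_rfl,
    coeff_lmulYInv_eq hN (n - 1) (B := (N - n).toNat + 1) (by omega), Finset.sum_range_succ',
    map_add, map_sum, map_sum]
  have : ∀ p : ℕ, S.σ (invTerm S (p + 1) (u.coeff (n - 1 + 1 + (p + 1 : ℕ)))) =
      - S.δ (invTerm S p (u.coeff (n + 1 + p))) := by
    intro p
    rw [invTerm_succ, map_neg, RingEquiv.apply_symm_apply]
    have h : n - 1 + 1 + ((p + 1 : ℕ) : ℤ) = n + 1 + p := by push_cast; ring
    rw [h]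
  rw [Finset.sum_congr rfl fun p _ => this p]
  simp [invTerm_zero]

theorem lmulYInv_lmulY (u : SkewLaurent S) : lmulYInv (lmulY u) = u := by
  obtain ⟨N, hN⟩ := u.bdd
  ext n
  set B := (N + 1 - n).toNat with hB
  rw [coeff_lmulYInv_eq (BddBy.lmulY hN) n (B := B) le_rfl]
  have key : ∀ p : ℕ, invTerm S p ((lmulY u).coeff (n + 1 + p)) =
      invTerm S p (S.σ (u.coeff (n + p))) -
        invTerm S (p + 1) (S.σ (u.coeff (n + (p + 1 : ℕ)))) := by
    intro p
    have h1 : n + 1 + (p : ℤ) - 1 = n + p := by ring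
    have h2 : n + ((p + 1 : ℕ) : ℤ) = n + 1 + p := by push_cast; ring
    rw [coeff_lmulY, map_add, invTerm_succ_right, RingEquiv.symm_apply_apply,
      sub_neg_eq_add, h1, h2]
  rw [Finset.sum_congr rfl fun p _ => key p,
    Finset.sum_range_sub' (fun p => invTerm S p (S.σ (u.coeff (n + p))))]
  rw [hN (n + B) (by omega)]
  simp [invTerm_zero]

/-- Left multiplication by `y` is invertible. -/
def lmulYUnit (S : SkewDerivation A) : (AddMonoid.End (SkewLaurent S))ˣ where
  val := lmulY
  inv := lmulYInv
  val_inv := by ext1 u; exact lmulY_lmulYInv u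
  inv_val := by ext1 u; exact lmulYInv_lmulY u

/-- Left multiplication by `y^j`, `j ∈ ℤ`. -/
def lmulYPow (j : ℤ) : AddMonoid.End (SkewLaurent S) := ((lmulYUnit S ^ j : (AddMonoid.End (SkewLaurent S))ˣ))

theorem lmulYPow_zero : (lmulYPow 0 : AddMonoid.End (SkewLaurent S)) = 1 := by simp [lmulYPow]

theorem lmulYPow_add_one (j : ℤ) (u : SkewLaurent S) :
    lmulYPow (j + 1) u = lmulY (lmulYPow j u) := by
  simp only [lmulYPow, add_comm j 1, zpow_add, zpow_one, Units.val_mul]; rfl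

theorem lmulYPow_sub_one (j : ℤ) (u : SkewLaurent S) :
    lmulYPow (j - 1) u = lmulYInv (lmulYPow j u) := by
  simp only [lmulYPow, sub_eq_add_neg, add_comm j (-1), zpow_add, zpow_neg_one, Units.val_mul]; rfl

theorem BddBy.lmulYPow {u : SkewLaurent S} {N : ℤ} (hN : u.BddBy N) (j : ℤ) :
    (lmulYPow j u).BddBy (N + j) := by
  induction j using Int.induction_on with
  | zero => simpa [lmulYPow_zero] using hN
  | succ i ih =>
    rw [lmulYPow_add_one, ← add_assoc]; exact ih.lmulY
  | pred i ih =>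
    rw [lmulYPow_sub_one, add_sub_assoc']; exact ih.lmulYInv

theorem mulSupport {u w : SkewLaurent S} {N K : ℤ} (hN : u.BddBy N) (hK : w.BddBy K) (n : ℤ) :
    (Function.support fun j : ℤ => u.coeff j * (lmulYPow j w).coeff n) ⊆
      (Finset.Icc (n - K) N : Finset ℤ) := by
  intro j hj
  by_contra h
  refine hj ?_
  simp only [Finset.coe_Icc, Set.mem_Icc, not_and_or, not_le] at h
  rcases h with h | h
  · simp [hK.lmulYPow j n (by omega)]
  · simp [hN j h]

/-- The product `(∑ fⱼ y^j) w = ∑ fⱼ (y^j w)`; each coefficient is a finite sum. -/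
instance : Mul (SkewLaurent S) where
  mul u w := mk (fun n => ∑ᶠ j : ℤ, u.coeff j * (lmulYPow j w).coeff n) (by
    obtain ⟨N, hN⟩ := u.bdd
    obtain ⟨K, hK⟩ := w.bdd
    refine ⟨N + K, fun n hn => ?_⟩
    rw [finsum_eq_sum_of_support_subset _ (mulSupport hN hK n), Finset.Icc_eq_empty (by omega)]
    simp)

theorem coeff_mul (u w : SkewLaurent S) (n : ℤ) :
    (u * w).coeff n = ∑ᶠ j : ℤ, u.coeff j * (lmulYPow j w).coeff n := rfl

theorem coeff_mul_eq {u w : SkewLaurent S} {N K : ℤ} (hN : u.BddBy N) (hK : w.BddBy K) (n : ℤ)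
    {a b : ℤ} (ha : a ≤ n - K) (hb : N ≤ b) :
    (u * w).coeff n = ∑ j ∈ Finset.Icc a b, u.coeff j * (lmulYPow j w).coeff n := by
  refine finsum_eq_sum_of_support_subset _ ((mulSupport hN hK n).trans ?_)
  simpa using Set.Icc_subset_Icc ha hb

theorem BddBy.add {u w : SkewLaurent S} {N : ℤ} (hN : u.BddBy N) (hK : w.BddBy N) :
    (u + w).BddBy N := fun n hn => by simp [hN n hn, hK n hn]

theorem BddBy.mono {u : SkewLaurent S} {N K : ℤ} (hN : u.BddBy N) (h : N ≤ K) : u.BddBy K :=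
  fun n hn => hN n (lt_of_le_of_lt h hn)

theorem BddBy.mul {u w : SkewLaurent S} {N K : ℤ} (hN : u.BddBy N) (hK : w.BddBy K) :
    (u * w).BddBy (N + K) := fun n hn => by
  rw [coeff_mul_eq hN hK n le_rfl le_rfl, Finset.Icc_eq_empty (by omega)]; simp

theorem right_distrib' (u w z : SkewLaurent S) : (u + w) * z = u * z + w * z := by
  obtain ⟨N, hN⟩ := u.bdd
  obtain ⟨K, hK⟩ := w.bdd
  obtain ⟨T, hT⟩ := z.bdd
  have hN' : u.BddBy (max N K) := BddBy.mono hN (le_max_left _ _)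
  have hK' : w.BddBy (max N K) := BddBy.mono hK (le_max_right _ _)
  ext n
  rw [coeff_mul_eq (hN'.add hK') hT n le_rfl le_rfl, coeff_add, coeff_mul_eq hN' hT n le_rfl le_rfl,
    coeff_mul_eq hK' hT n le_rfl le_rfl, ← Finset.sum_add_distrib]
  simp [add_mul]

theorem left_distrib' (z u w : SkewLaurent S) : z * (u + w) = z * u + z * w := by
  obtain ⟨N, hN⟩ := u.bdd
  obtain ⟨K, hK⟩ := w.bdd
  obtain ⟨T, hT⟩ := z.bdd
  have hN' : u.BddBy (max N K) := BddBy.mono hN (le_max_left _ _)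
  have hK' : w.BddBy (max N K) := BddBy.mono hK (le_max_right _ _)
  ext n
  rw [coeff_mul_eq hT (hN'.add hK') n le_rfl le_rfl, coeff_add, coeff_mul_eq hT hN' n le_rfl le_rfl,
    coeff_mul_eq hT hK' n le_rfl le_rfl, ← Finset.sum_add_distrib]
  simp [mul_add]

/-- Right multiplication by `w`. -/
def rmul (w : SkewLaurent S) : AddMonoid.End (SkewLaurent S) where
  toFun u := u * w
  map_zero' := by ext n; simp [coeff_mul]
  map_add' u z := right_distrib' u z w

theorem lmulY_mul (u w : SkewLaurent S) : lmulY u * w = lmulY (u * w) := by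
  obtain ⟨N, hN⟩ := u.bdd
  obtain ⟨K, hK⟩ := w.bdd
  ext n
  rw [coeff_lmulY, coeff_mul_eq (BddBy.lmulY hN) hK n (a := n - 1 - K) (by omega) le_rfl,
    coeff_mul_eq hN hK n (a := n - 1 - K) (b := N + 1) (by omega) (by omega),
    coeff_mul_eq hN hK (n - 1) (a := n - 1 - K) (b := N + 1) (by omega) (by omega)]
  rw [map_sum, map_sum, ← Finset.sum_add_distrib]
  have h1 : ∀ j : ℤ, S.σ (u.coeff j * (lmulYPow j w).coeff (n - 1)) +
      S.δ (u.coeff j * (lmulYPow j w).coeff n) =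
      S.σ (u.coeff j) * (lmulYPow (j + 1) w).coeff n + S.δ (u.coeff j) * (lmulYPow j w).coeff n := by
    intro j
    rw [lmulYPow_add_one, coeff_lmulY, S.leibniz, map_mul, mul_add]
    abel
  have h2 : ∀ j : ℤ, (lmulY u).coeff j * (lmulYPow j w).coeff n =
      S.σ (u.coeff (j - 1)) * (lmulYPow j w).coeff n + S.δ (u.coeff j) * (lmulYPow j w).coeff n := by
    intro j
    rw [coeff_lmulY, add_mul]
  simp only [h1, h2, Finset.sum_add_distrib]
  congr 1
  rw [← finsum_eq_sum_of_support_subset (s := Finset.Icc (n - 1 - K) (N + 1))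
      (fun j => S.σ (u.coeff (j - 1)) * (lmulYPow j w).coeff n),
    ← finsum_eq_sum_of_support_subset (s := Finset.Icc (n - 1 - K) (N + 1))
      (fun j => S.σ (u.coeff j) * (lmulYPow (j + 1) w).coeff n)]
  · rw [← finsum_comp_equiv (Equiv.addRight (1 : ℤ))]
    simp
  · intro j hj
    by_contra h
    refine hj ?_
    simp only [Finset.coe_Icc, Set.mem_Icc, not_and_or, not_le] at h
    rcases h with h | h
    · simp [BddBy.lmulYPow hK (j + 1) n (by omega)]
    · simp [hN j (by omega)]
  · intro j hj
    by_contra h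
    refine hj ?_
    simp only [Finset.coe_Icc, Set.mem_Icc, not_and_or, not_le] at h
    rcases h with h | h
    · simp [BddBy.lmulYPow hK j n (by omega)]
    · simp [hN (j - 1) (by omega)]

theorem lmulYPow_mul (j : ℤ) (u w : SkewLaurent S) : lmulYPow j u * w = lmulYPow j (u * w) := by
  have h : Commute (rmul w) ((lmulYUnit S : (AddMonoid.End (SkewLaurent S))ˣ) :
      AddMonoid.End (SkewLaurent S)) := by
    ext1 u
    exact lmulY_mul u w
  have h2 := h.units_zpow_right j
  exact DFunLike.congr_fun h2 u

theorem mul_assoc' (u w z : SkewLaurent S) : u * w * z = u * (w * z) := by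
  obtain ⟨N, hN⟩ := u.bdd
  obtain ⟨K, hK⟩ := w.bdd
  obtain ⟨T, hT⟩ := z.bdd
  ext n
  rw [coeff_mul_eq (BddBy.mul hN hK) hT n (a := n - T) (b := N + K) le_rfl le_rfl,
    coeff_mul_eq hN (BddBy.mul hK hT) n (a := n - (K + T)) (b := N) le_rfl le_rfl]
  have h1 : ∀ l ∈ Finset.Icc (n - T) (N + K), (u * w).coeff l * (lmulYPow l z).coeff n =
      ∑ j ∈ Finset.Icc (n - (K + T)) N,
        u.coeff j * ((lmulYPow j w).coeff l * (lmulYPow l z).coeff n) := by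
    intro l hl
    rw [Finset.mem_Icc] at hl
    rw [coeff_mul_eq hN hK l (a := n - (K + T)) (b := N) (by omega) le_rfl, Finset.sum_mul]
    simp only [mul_assoc]
  have h2 : ∀ j ∈ Finset.Icc (n - (K + T)) N, u.coeff j * (lmulYPow j (w * z)).coeff n =
      ∑ l ∈ Finset.Icc (n - T) (N + K),
        u.coeff j * ((lmulYPow j w).coeff l * (lmulYPow l z).coeff n) := by
    intro j hj
    rw [Finset.mem_Icc] at hj
    rw [← lmulYPow_mul, coeff_mul_eq (BddBy.lmulYPow hK j) hT n (a := n - T) (b := N + K) le_rfl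
      (by omega), Finset.mul_sum]
  rw [Finset.sum_congr rfl h1, Finset.sum_congr rfl h2, Finset.sum_comm]

/-- The element `a yⁿ`. -/
def monomial (a : A) (n : ℤ) : SkewLaurent S :=
  mk (Pi.single n a) ⟨n, fun l hl => by simp [hl.ne']⟩

theorem coeff_monomial (a : A) (n l : ℤ) :
    (monomial a n : SkewLaurent S).coeff l = if l = n then a else 0 := by
  simp [monomial, Pi.single_apply]

instance : One (SkewLaurent S) := ⟨monomial 1 0⟩

theorem one_def' : (1 : SkewLaurent S) = monomial 1 0 := rfl

theorem monomial_mul (a : A) (n : ℤ) (w : SkewLaurent S) (l : ℤ) :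
    (monomial a n * w).coeff l = a * (lmulYPow n w).coeff l := by
  rw [coeff_mul, finsum_eq_single _ n]
  · simp [coeff_monomial]
  · intro j hj
    simp [coeff_monomial, hj]

theorem lmulY_monomial_one (n : ℤ) : lmulY (monomial 1 n : SkewLaurent S) = monomial 1 (n + 1) := by
  have h1 : S.δ 1 = 0 := by
    have := S.leibniz 1 1
    simpa using this
  ext l
  simp only [coeff_lmulY, coeff_monomial]
  by_cases h : l = n <;> by_cases h' : l = n + 1 <;> simp [h, h', h1]; omega

theorem lmulYPow_one (j : ℤ) : lmulYPow j (1 : SkewLaurent S) = monomial 1 j := by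
  induction j using Int.induction_on with
  | zero => simp [lmulYPow_zero, one_def']
  | succ i ih => rw [lmulYPow_add_one, ih, lmulY_monomial_one]
  | pred i ih =>
    rw [lmulYPow_sub_one, ih]
    have := lmulYInv_lmulY (monomial 1 (-(i : ℤ) - 1) : SkewLaurent S)
    rwa [lmulY_monomial_one, sub_add_cancel] at this

instance : Ring (SkewLaurent S) :=
  { (inferInstance : AddCommGroup (SkewLaurent S)) with
    mul_assoc := mul_assoc'
    left_distrib := left_distrib'
    right_distrib := right_distrib'
    one_mul := fun u => by
      ext n
      rw [one_def', monomial_mul]; simp [lmulYPow_zero]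
    mul_one := fun u => by
      ext n
      rw [coeff_mul, finsum_eq_single _ n]
      · simp [lmulYPow_one, coeff_monomial]
      · intro j hj
        simp [lmulYPow_one, coeff_monomial, hj.symm]
    zero_mul := fun u => by ext n; simp [coeff_mul]
    mul_zero := fun u => by ext n; simp [coeff_mul] }

/-- The embedding of the coefficient ring `A`. -/
def ofCoeff : A →+* SkewLaurent S where
  toFun a := monomial a 0
  map_zero' := by ext n; simp [coeff_monomial]
  map_one' := rfl
  map_add' a b := by ext n; simp [coeff_monomial]; split_ifs <;> simp
  map_mul' a b := by
    ext n
    rw [monomial_mul]; simp [lmulYPow_zero, coeff_monomial]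

/-- The part `S₊` of `S`: the terms with nonnegative powers of `y`. -/
def posPart (u : SkewLaurent S) : SkewLaurent S :=
  mk (fun n => if 0 ≤ n then u.coeff n else 0) (by
    obtain ⟨N, hN⟩ := u.bdd
    exact ⟨N, fun n hn => by simp [hN n hn]⟩)

/-- The defining commutation rule `y a = σ(a) y + δ(a)`. -/
theorem y_mul_ofCoeff (a : A) :
    (monomial 1 1 : SkewLaurent S) * ofCoeff a =
      ofCoeff (S.σ a) * monomial 1 1 + ofCoeff (S.δ a) := by
  ext n
  simp only [ofCoeff, RingHom.coe_mk, MonoidHom.coe_mk, OneHom.coe_mk, coeff_add, monomial_mul]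
  have := lmulYPow_add_one (S := S) 0 (monomial a 0)
  simp only [zero_add] at this
  rw [this]
  simp only [lmulYPow_zero, AddMonoid.End.coe_one, id_eq, coeff_lmulY, coeff_monomial]
  by_cases h : n = 0
  · simp [h]
  · by_cases h' : n = 1
    · simp [h']
    · have : ¬ n - 1 = 0 := by omega
      simp [h, h', this]

end SkewLaurent

/-- The derivative `d/dx` of a rational function, by the quotient rule. -/
def ratDerivFun (f : RatFunc ℂ) : RatFunc ℂ :=
  algebraMap ℂ[X] (RatFunc ℂ) (derivative f.num * f.denom - f.num * derivative f.denom) /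
    algebraMap ℂ[X] (RatFunc ℂ) (f.denom ^ 2)

theorem polynomial_quotient_rule {a b p q : ℂ[X]} (h1 : a * q = p * b) :
    (derivative a * b - a * derivative b) * q ^ 2 =
      (derivative p * q - p * derivative q) * b ^ 2 := by
  have h2 := congrArg (fun r => derivative r) h1
  simp only [derivative_mul] at h2
  linear_combination (q * b) * h2 - (derivative q * b + derivative b * q) * h1

theorem ratDerivFun_div (p : ℂ[X]) {q : ℂ[X]} (hq : q ≠ 0) :
    ratDerivFun (algebraMap ℂ[X] (RatFunc ℂ) p / algebraMap ℂ[X] (RatFunc ℂ) q) =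
      algebraMap ℂ[X] (RatFunc ℂ) (derivative p * q - p * derivative q) /
        algebraMap ℂ[X] (RatFunc ℂ) (q ^ 2) := by
  unfold ratDerivFun
  generalize hf : algebraMap ℂ[X] (RatFunc ℂ) p / algebraMap ℂ[X] (RatFunc ℂ) q = f
  have hd : f.denom ≠ 0 := RatFunc.denom_ne_zero f
  rw [div_eq_div_iff (RatFunc.algebraMap_ne_zero (pow_ne_zero 2 hd))
    (RatFunc.algebraMap_ne_zero (pow_ne_zero 2 hq)), ← map_mul, ← map_mul]
  exact congrArg _ (polynomial_quotient_rule ((RatFunc.num_mul_eq_mul_denom_iff hq).2 hf.symm))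

/-- The derivation `d/dx` of `ℂ(x)`. -/
def ratDeriv : Derivation ℂ (RatFunc ℂ) (RatFunc ℂ) := by
  refine Derivation.mk' (R := ℂ) (A := RatFunc ℂ) (M := RatFunc ℂ)
    { toFun := ratDerivFun, map_add' := ?_, map_smul' := ?_ } ?_
  · intro f g
    rw [← RatFunc.num_div_denom f, ← RatFunc.num_div_denom g]
    have hf := RatFunc.denom_ne_zero f
    have hg := RatFunc.denom_ne_zero g
    have hf' := RatFunc.algebraMap_ne_zero hf
    have hg' := RatFunc.algebraMap_ne_zero hg
    rw [div_add_div _ _ hf' hg', ← map_mul, ← map_mul, ← map_mul, ← map_add,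
      ratDerivFun_div _ (mul_ne_zero hf hg), ratDerivFun_div _ hf, ratDerivFun_div _ hg]
    simp only [map_mul, map_sub, map_add, map_pow, derivative_mul]
    field_simp
    ring
  · intro c f
    rw [← RatFunc.num_div_denom f]
    have hf := RatFunc.denom_ne_zero f
    have h : ∀ (c : ℂ) (p q : ℂ[X]), c • (algebraMap ℂ[X] (RatFunc ℂ) p / algebraMap ℂ[X] (RatFunc ℂ) q) =
      algebraMap ℂ[X] (RatFunc ℂ) (C c * p) / algebraMap ℂ[X] (RatFunc ℂ) q := by
      intro c p q
      rw [← smul_eq_C_mul, RatFunc.div_smul]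
    rw [RingHom.id_apply, h, ratDerivFun_div _ hf, ratDerivFun_div _ hf, h]
    congr 2
    simp only [derivative_C_mul]; ring
  · intro f g
    change ratDerivFun (f * g) = f * ratDerivFun g + g * ratDerivFun f
    rw [← RatFunc.num_div_denom f, ← RatFunc.num_div_denom g]
    have hf := RatFunc.denom_ne_zero f
    have hg := RatFunc.denom_ne_zero g
    have hf' := RatFunc.algebraMap_ne_zero hf
    have hg' := RatFunc.algebraMap_ne_zero hg
    rw [div_mul_div_comm, ← map_mul, ← map_mul,
      ratDerivFun_div _ (mul_ne_zero hf hg), ratDerivFun_div _ hf, ratDerivFun_div _ hg]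
    simp only [map_mul, map_sub, map_add, map_pow, derivative_mul]
    field_simp
    ring

theorem ratScale_le (a : ℂˣ) : nonZeroDivisors ℂ[X] ≤
    (nonZeroDivisors ℂ[X]).comap (Polynomial.compRingHom (C (a : ℂ) * X)) := by
  intro p hp
  rw [Submonoid.mem_comap, mem_nonZeroDivisors_iff_ne_zero, Polynomial.coe_compRingHom_apply]
  intro h
  exact nonZeroDivisors.ne_zero hp ((Polynomial.comp_C_mul_X_eq_zero_iff
    (mem_nonZeroDivisors_of_ne_zero a.ne_zero)).1 h)

/-- The substitution `f(x) ↦ f(a x)` on `ℂ(x)`. -/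
def ratScale (a : ℂˣ) : RatFunc ℂ →+* RatFunc ℂ :=
  RatFunc.mapRingHom (Polynomial.compRingHom (C (a : ℂ) * X)) (ratScale_le a)

theorem ratScale_div (a : ℂˣ) (p q : ℂ[X]) :
    ratScale a (algebraMap ℂ[X] (RatFunc ℂ) p / algebraMap ℂ[X] (RatFunc ℂ) q) =
      algebraMap ℂ[X] (RatFunc ℂ) (p.comp (C (a : ℂ) * X)) /
        algebraMap ℂ[X] (RatFunc ℂ) (q.comp (C (a : ℂ) * X)) :=
  RatFunc.map_apply_div (Polynomial.compRingHom (C (a : ℂ) * X)) (ratScale_le a) p q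

theorem ratScale_one (f : RatFunc ℂ) : ratScale 1 f = f := by
  conv_rhs => rw [← RatFunc.num_div_denom f]
  conv_lhs => rw [← RatFunc.num_div_denom f]
  rw [ratScale_div]; simp

theorem ratScale_mul (a b : ℂˣ) (f : RatFunc ℂ) : ratScale (a * b) f = ratScale a (ratScale b f) := by
  rw [← RatFunc.num_div_denom f, ratScale_div, ratScale_div, ratScale_div]
  have : ∀ p : ℂ[X], p.comp (C ((a * b : ℂˣ) : ℂ) * X) = (p.comp (C (b : ℂ) * X)).comp (C (a : ℂ) * X) := by
    intro p
    rw [Polynomial.comp_assoc]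
    simp [mul_left_comm, mul_assoc]
  rw [this, this]

theorem ratScale_deriv (a : ℂˣ) (f : RatFunc ℂ) :
    ratDeriv (ratScale a f) = RatFunc.C (a : ℂ) * ratScale a (ratDeriv f) := by
  change ratDerivFun _ = _ * ratScale a (ratDerivFun f)
  rw [← RatFunc.num_div_denom f]
  have hf := RatFunc.denom_ne_zero f
  have hf2 : f.denom.comp (C (a : ℂ) * X) ≠ 0 := fun h => hf ((Polynomial.comp_C_mul_X_eq_zero_iff
      (mem_nonZeroDivisors_of_ne_zero a.ne_zero)).1 h)
  rw [ratDerivFun_div _ hf, ratScale_div, ratScale_div, ratDerivFun_div _ hf2, ← RatFunc.algebraMap_C,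
    ← mul_div_assoc, ← map_mul]
  congr 2
  · simp [derivative_comp]; ring
  · simp

theorem ratScale_C (a : ℂˣ) (z : ℂ) : ratScale a (RatFunc.C z) = RatFunc.C z := by
  have := ratScale_div a (C z) 1
  simpa using this

theorem ratScale_X (a : ℂˣ) : ratScale a RatFunc.X = RatFunc.C (a : ℂ) * RatFunc.X := by
  have := ratScale_div a X 1
  simpa using this

/-- The cyclic group `Γ` of `m`-th roots of unity. -/
def CyclicGroup (m : ℕ) : Type := rootsOfUnity m ℂ

namespace CyclicGroup
variable {m : ℕ}

instance : CommGroup (CyclicGroup m) := inferInstanceAs (CommGroup (rootsOfUnity m ℂ))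

/-- The inclusion `Γ ⊆ ℂˣ`. -/
def toCUnits : CyclicGroup m →* ℂˣ := (rootsOfUnity m ℂ).subtype

/-- The action `(γ f)(x) = f(γ⁻¹ x)` on `ℂ(x)`. -/
instance : MulSemiringAction (CyclicGroup m) (RatFunc ℂ) where
  smul g f := ratScale (toCUnits g)⁻¹ f
  one_smul f := by change ratScale _ f = f; rw [map_one, inv_one, ratScale_one]
  mul_smul g h f := by
    change ratScale _ f = ratScale _ (ratScale _ f)
    rw [map_mul, mul_inv, ratScale_mul]
  smul_zero g := map_zero (ratScale _)
  smul_add g := map_add (ratScale _)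
  smul_one g := map_one (ratScale _)
  smul_mul g := map_mul (ratScale _)

theorem smul_def (g : CyclicGroup m) (f : RatFunc ℂ) : g • f = ratScale (toCUnits g)⁻¹ f := rfl
end CyclicGroup

/-- The crossed product `ℂ(x) * Γ`: combinations of `f γ`, with `(f γ)(g δ) = f γ(g) γδ`. -/
abbrev CrossedProduct (m : ℕ) : Type := SkewMonoidAlgebra (RatFunc ℂ) (CyclicGroup m)

namespace CrossedProduct
variable {m : ℕ}
open CyclicGroup SkewMonoidAlgebra

/-- The `n`-th power of the automorphism `θ(f γ) = f · γ · γ` (the first `γ` being a complex number). -/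
def theta (n : ℤ) : CrossedProduct m →+* CrossedProduct m :=
  liftNCRingHom singleOneRingHom
    { toFun := fun g => single g (RatFunc.C (((toCUnits g) ^ n : ℂˣ) : ℂ))
      map_one' := by rw [map_one, one_zpow, Units.val_one, map_one]; rfl
      map_mul' := fun g h => by
        rw [single_mul_single, smul_def, ratScale_C, ← map_mul, map_mul, mul_zpow, Units.val_mul] }
    (by
      intro f g
      simp [singleOneRingHom, single_mul_single, mul_comm])

theorem theta_single (n : ℤ) (g : CyclicGroup m) (f : RatFunc ℂ) :
    theta n (single g f) = single g (RatFunc.C (((toCUnits g) ^ n : ℂˣ) : ℂ) * f) := by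
  simp [theta, liftNCRingHom, singleOneRingHom, single_mul_single, liftNC, mul_comm]

theorem theta_comp (n l : ℤ) (hnl : n + l = 0) (u : CrossedProduct m) :
    theta n (theta l u) = u := by
  induction u using SkewMonoidAlgebra.induction_on with
  | zero => simp
  | single g f =>
    rw [theta_single, theta_single, ← mul_assoc, ← map_mul, ← Units.val_mul, ← zpow_add, hnl]
    simp
  | add u w hu hw => rw [map_add, map_add, hu, hw]

/-- The automorphism `θ⁻¹` of `ℂ(x) * Γ`; it sends `f s` to `μ⁻¹ f s`. -/
def thetaInv : CrossedProduct m ≃+* CrossedProduct m where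
  toFun := theta (-1)
  invFun := theta 1
  left_inv := theta_comp 1 (-1) (by norm_num)
  right_inv := theta_comp (-1) 1 (by norm_num)
  map_mul' := map_mul _
  map_add' := map_add _

/-- The operation `∂(∑ f_γ γ) = ∑ (df_γ/dx) γ`. -/
def partialX : CrossedProduct m →+ CrossedProduct m where
  toFun u := ⟨u.coeff.mapRange ratDeriv (map_zero _)⟩
  map_zero' := by ext g; simp
  map_add' u w := by ext g; simp

theorem partialX_single (g : CyclicGroup m) (f : RatFunc ℂ) :
    partialX (single g f) = single g (ratDeriv f) := by
  apply SkewMonoidAlgebra.coeff_injective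
  exact Finsupp.mapRange_single (hf := map_zero _)

theorem thetaInv_single (g : CyclicGroup m) (f : RatFunc ℂ) :
    thetaInv (single g f) = single g (RatFunc.C (((toCUnits g)⁻¹ : ℂˣ) : ℂ) * f) := by
  have := theta_single (-1) g f
  rwa [zpow_neg_one] at this

theorem partialX_mul (u w : CrossedProduct m) :
    partialX (u * w) = thetaInv u * partialX w + partialX u * w := by
  induction u using SkewMonoidAlgebra.induction_on with
  | zero => simp
  | add u₁ u₂ h₁ h₂ => rw [add_mul, map_add, h₁, h₂, map_add, map_add]; noncomm_ring
  | single g f =>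
    induction w using SkewMonoidAlgebra.induction_on with
    | zero => simp
    | add w₁ w₂ h₁ h₂ => rw [mul_add, map_add, h₁, h₂, map_add]; noncomm_ring
    | single h k =>
      rw [single_mul_single, partialX_single, partialX_single, partialX_single, thetaInv_single,
        single_mul_single, single_mul_single, ← single_add, Derivation.leibniz, smul_def, smul_def,
        ratScale_deriv]
      congr 1
      simp only [smul_eq_mul]
      ring

/-- The inclusion `ℂ(x) ⊆ ℂ(x) * Γ`. -/
def coeffX : RatFunc ℂ →+* CrossedProduct m := singleOneRingHom

theorem coeffX_apply (f : RatFunc ℂ) : (coeffX f : CrossedProduct m) = single 1 f := rfl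

theorem thetaInv_mul_invX (u : CrossedProduct m) :
    thetaInv u * coeffX (RatFunc.X⁻¹) = coeffX (RatFunc.X⁻¹) * u := by
  induction u using SkewMonoidAlgebra.induction_on with
  | zero => simp
  | add u₁ u₂ h₁ h₂ => rw [map_add, add_mul, h₁, h₂, mul_add]
  | single g f =>
    rw [thetaInv_single]
    rw [coeffX_apply, single_mul_single, single_mul_single, smul_def, map_inv₀, ratScale_X, mul_one, one_mul,
      one_smul, mul_inv, ← map_inv₀]
    congr 1
    simp only [Units.val_inv_eq_inv_val, inv_inv, map_inv₀]
    have : RatFunc.C ((toCUnits g : ℂˣ) : ℂ) ≠ 0 := by simp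
    field_simp

theorem coeffX_C_comm (z : ℂ) (u : CrossedProduct m) :
    coeffX (RatFunc.C z) * u = u * coeffX (RatFunc.C z) := by
  induction u using SkewMonoidAlgebra.induction_on with
  | zero => simp
  | add u₁ u₂ h₁ h₂ => rw [mul_add, h₁, h₂, add_mul]
  | single g f =>
    rw [coeffX_apply, single_mul_single, single_mul_single, one_smul, smul_def, ratScale_C, mul_one, one_mul,
      mul_comm]

end CrossedProduct

/-- Parameters: a primitive `m`-th root of unity `μ`, `τ ≠ 0` and `k = (k₀, …, k_{m-1}) ∈ ℂ^m`. -/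
structure CherednikParameters (m : ℕ) where
  μ : ℂ
  primitive : IsPrimitiveRoot μ m
  τ : ℂ
  τ_ne_zero : τ ≠ 0
  k : ZMod m → ℂ

namespace CherednikParameters
variable {m : ℕ} [NeZero m] (c : CherednikParameters m)
open CyclicGroup SkewMonoidAlgebra CrossedProduct

/-- The generator `s` of `Γ`, acting on `ℂ` as multiplication by `μ`. -/
def s : CyclicGroup m := c.primitive.toRootsOfUnity

/-- The idempotents `ε_i = (1/m) ∑_r μ^{-ir} s^r`. -/
def ε (i : ZMod m) : CrossedProduct m :=
  ∑ r ∈ Finset.range m, single (c.s ^ r) (RatFunc.C ((1 / (m : ℂ)) * c.μ ^ (-((i.val : ℤ) * r))))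

/-- The element `∑ m k_i ε_i`, so that the Dunkl operator is `y = τ ∂ - x⁻¹ ∑ m k_i ε_i`. -/
def dunklTail : CrossedProduct m := ∑ i : ZMod m, coeffX (RatFunc.C ((m : ℂ) * c.k i)) * c.ε i

/-- The parameters `λ_i = m (k_{i-1} - k_i) - τ`, for which `x y - y x = ∑ λ_i ε_i`. -/
def lam (i : ZMod m) : ℂ := m * (c.k (i - 1) - c.k i) - c.τ

/-- `D(f) = τ ∂(f) - x⁻¹ [∑ m k_i ε_i, f]`. If `∑ m k_i ε_i = ∑ c_γ γ`, this is
`τ ∂(f) - ∑_{γ ≠ e} c_γ x⁻¹ [γ, f]`; the Dunkl operator satisfies `y f = θ⁻¹(f) y + D(f)`. -/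
def dunklD : CrossedProduct m →+ CrossedProduct m where
  toFun f := coeffX (RatFunc.C c.τ) * partialX f -
    coeffX (RatFunc.X⁻¹) * (c.dunklTail * f - f * c.dunklTail)
  map_zero' := by simp
  map_add' f g := by simp only [map_add, mul_add, add_mul, mul_sub]; abel

theorem dunklD_mul (f g : CrossedProduct m) :
    c.dunklD (f * g) = thetaInv f * c.dunklD g + c.dunklD f * g := by
  have h1 := coeffX_C_comm c.τ (thetaInv f)
  have h2 := thetaInv_mul_invX f
  simp only [dunklD, AddMonoidHom.coe_mk, ZeroHom.coe_mk]
  rw [partialX_mul, mul_sub (thetaInv f), ← mul_assoc (thetaInv f), ← mul_assoc (thetaInv f), ← h1,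
    h2]
  simp only [mul_add, mul_sub, sub_mul, mul_assoc]
  abel

/-- The pair `(θ⁻¹, D)` on `ℂ(x) * Γ`. -/
def skew : SkewDerivation (CrossedProduct m) where
  σ := thetaInv
  δ := c.dunklD
  leibniz := c.dunklD_mul

/-- The ring `𝒫` of series `∑_{j ≥ 0} f_j y^{N-j}`, `f_j ∈ ℂ(x) * Γ`, where `y` is the Dunkl
operator. -/
abbrev PRing : Type := SkewLaurent c.skew

/-- The Dunkl operator `y` as an element of `𝒫`. -/
def y : c.PRing := SkewLaurent.monomial 1 1

/-- The inclusion `ℂ(x) * Γ ⊆ 𝒫`. -/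
def ofCP : CrossedProduct m →+* c.PRing := SkewLaurent.ofCoeff

/-- The inclusion `ℂ(x) ⊆ 𝒫`. -/
def ofRat : RatFunc ℂ →+* c.PRing := c.ofCP.comp coeffX

/-- The inclusion `ℂ ⊆ 𝒫`. -/
def ofC : ℂ →+* c.PRing := c.ofRat.comp RatFunc.C

end CherednikParameters

/-! ### The matrix hierarchy -/

/-- `f : ℂ → ℂ(x)` is differentiable at `t` with derivative `f'`: near `t` one has
`f s = p s / q s` with polynomials in `x` of bounded degree whose coefficients are differentiable
at `t`, with `q t ≠ 0`, and `f'` is obtained by the quotient rule. -/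
def RatHasDerivAt (f : ℂ → RatFunc ℂ) (f' : RatFunc ℂ) (t : ℂ) : Prop :=
  ∃ (N : ℕ) (p q : ℂ → ℂ[X]) (p' q' : ℂ[X]),
    q t ≠ 0 ∧
    (∀ᶠ s in 𝓝 t, (p s).natDegree ≤ N ∧ (q s).natDegree ≤ N ∧
      f s = algebraMap ℂ[X] (RatFunc ℂ) (p s) / algebraMap ℂ[X] (RatFunc ℂ) (q s)) ∧
    (∀ j : ℕ, HasDerivAt (fun s => (p s).coeff j) (p'.coeff j) t ∧
      HasDerivAt (fun s => (q s).coeff j) (q'.coeff j) t) ∧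
    f' = algebraMap ℂ[X] (RatFunc ℂ) (p' * q t - p t * q') /
      algebraMap ℂ[X] (RatFunc ℂ) (q t ^ 2)

section Hierarchy

variable {m : ℕ} [NeZero m] (c : CherednikParameters m) (d : ℕ)

/-- The ring `Mat(d, ℂ) ⊗ 𝒫` of `d × d` matrices over `𝒫`. -/
abbrev PMat : Type := Matrix (Fin d) (Fin d) c.PRing

variable {c d}

/-- The derivative with respect to a parameter of a curve in `Mat(d, ℂ) ⊗ 𝒫`: every coefficient
(of `γ yⁿ` in every matrix entry) is differentiated as a family of rational functions of `x`. -/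
def PMatHasDerivAt (S : ℂ → PMat c d) (S' : PMat c d) (t : ℂ) : Prop :=
  ∀ (a b : Fin d) (n : ℤ) (γ : CyclicGroup m),
    RatHasDerivAt (fun s => ((S s a b).coeff n).coeff γ) (((S' a b).coeff n).coeff γ) t

/-- The entrywise operation `(·)₊` on `Mat(d, ℂ) ⊗ 𝒫`. -/
def PMat.posPart (S : PMat c d) : PMat c d := S.map SkewLaurent.posPart

/-- The diagonal matrix unit `E_β` in `Mat(d, ℂ) ⊗ 𝒫`. -/
def PMat.E (β : Fin d) : PMat c d := Matrix.single β β 1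

/-- The pairs `(L, (R_α))` on which the hierarchy lives:
`L = y + ∑_{l ≥ 0} f_l y^{-l}`, `R_α = E_α + ∑_{l ≥ 1} r_{lα} y^{-l}`,
`[L, R_α] = 0`, `R_α R_β = δ_{αβ} R_α`, `∑ R_α = 1`, and the coefficient of the identity element of
`Γ` in every diagonal entry of `f_0` vanishes. -/
structure IsHierarchyPoint (P : PMat c d × (Fin d → PMat c d)) : Prop where
  L_top : ∀ (a b : Fin d) (n : ℤ), 0 < n →
    (P.1 a b).coeff n = if n = 1 ∧ a = b then 1 else 0
  R_top : ∀ (α a b : Fin d) (n : ℤ), 0 ≤ n →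
    (P.2 α a b).coeff n = if n = 0 ∧ a = α ∧ b = α then 1 else 0
  comm : ∀ α : Fin d, P.1 * P.2 α = P.2 α * P.1
  mul_self : ∀ α : Fin d, P.2 α * P.2 α = P.2 α
  mul_of_ne : ∀ α β : Fin d, α ≠ β → P.2 α * P.2 β = 0
  sum_eq_one : ∑ α : Fin d, P.2 α = 1
  normalised : ∀ a : Fin d, ((P.1 a a).coeff 0).coeff 1 = 0

/-- The equations of the `(k, β)`-th flow of the matrix hierarchy at time `t`, for a curve of pairs
`(L, (R_α))`: `∂L = [(L^k R_β)₊, L]` and `∂R_α = [(L^k R_β)₊, R_α]`. -/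
def HierarchyEquationsAt (k : ℕ) (β : Fin d) (P : ℂ → PMat c d × (Fin d → PMat c d)) (t : ℂ) :
    Prop :=
  PMatHasDerivAt (fun s => (P s).1)
    (PMat.posPart ((P t).1 ^ k * (P t).2 β) * (P t).1 - (P t).1 * PMat.posPart ((P t).1 ^ k * (P t).2 β)) t ∧
  ∀ α : Fin d, PMatHasDerivAt (fun s => (P s).2 α)
    (PMat.posPart ((P t).1 ^ k * (P t).2 β) * (P t).2 α - (P t).2 α * PMat.posPart ((P t).1 ^ k * (P t).2 β)) t

/-- The times `(t_{kβ})`, `k = 0, 1, …`, `β = 1, …, d`: families with finitely many nonzero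
members. -/
abbrev Times (d : ℕ) : Type := ℕ × Fin d →₀ ℂ

/-- A solution of the matrix hierarchy: a family of pairs `(L, (R_α))` depending on all times, of the
required form and satisfying the equations for all `∂/∂t_{kβ}`. -/
def IsHierarchySolution (P : Times d → PMat c d × (Fin d → PMat c d)) : Prop :=
  (∀ t, IsHierarchyPoint (P t)) ∧
  ∀ (t : Times d) (k : ℕ) (β : Fin d),
    HierarchyEquationsAt k β (fun s => P (t + Finsupp.single (k, β) s)) 0

end Hierarchy

/-! ### Calogero--Moser spaces -/

/-- An index set for a basis of `V = ⨁ V_i`, `V_i = ℂ^{α_i}`. -/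
abbrev VIndex {m : ℕ} (α : ZMod m → ℕ) : Type := Σ i : ZMod m, Fin (α i)

/-- Data `X, Y ∈ End V`, `v : ℂ^d → V`, `w : V → ℂ^d`. -/
@[ext]
structure FramedData {m : ℕ} (α : ZMod m → ℕ) (d : ℕ) where
  X : Matrix (VIndex α) (VIndex α) ℂ
  Y : Matrix (VIndex α) (VIndex α) ℂ
  v : Matrix (VIndex α) (Fin d) ℂ
  w : Matrix (Fin d) (VIndex α) ℂ

namespace FramedData

variable {m : ℕ} [NeZero m] {α : ZMod m → ℕ} {d : ℕ}

/-- The projection `e_i` of `V` onto `V_i`. -/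
def e (α : ZMod m → ℕ) (i : ZMod m) : Matrix (VIndex α) (VIndex α) ℂ :=
  Matrix.diagonal fun a => if a.1 = i then 1 else 0

/-- The component `v_i : ℂ^d → V_i`. -/
def vAt (p : FramedData α d) (i : ZMod m) : Matrix (VIndex α) (Fin d) ℂ := e α i * p.v

/-- The component `w_i : V_i → ℂ^d`. -/
def wAt (p : FramedData α d) (i : ZMod m) : Matrix (Fin d) (VIndex α) ℂ := p.w * e α i

/-- `X` is a sum of maps `X_i : V_i → V_{i+1}` and `Y` is a sum of maps `Y_i : V_{i+1} → V_i`, that is,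
`(X, Y, v, w)` is a representation of the opposite double quiver of the cyclic quiver with `d`
framing arrows at each vertex, of dimension `(1, α)`. -/
def IsRep (p : FramedData α d) : Prop :=
  ∀ i : ZMod m, e α (i + 1) * p.X = p.X * e α i ∧ e α i * p.Y = p.Y * e α (i + 1)

/-- The relations `Y_i X_i - X_{i-1} Y_{i-1} - v_i w_i = λ_i 1` for all `i`. -/
def MomentRelation (c : CherednikParameters m) (p : FramedData α d) : Prop :=
  p.Y * p.X - p.X * p.Y - ∑ i : ZMod m, p.vAt i * p.wAt i = ∑ i : ZMod m, c.lam i • e α i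

/-- `GL(α) = ∏ GL(α_i, ℂ)` as block diagonal matrices acting on `V`. -/
def block (g : ∀ i : ZMod m, GL (Fin (α i)) ℂ) : Matrix (VIndex α) (VIndex α) ℂ :=
  Matrix.blockDiagonal' fun i => (g i : Matrix (Fin (α i)) (Fin (α i)) ℂ)

theorem block_one : block (1 : ∀ i : ZMod m, GL (Fin (α i)) ℂ) = 1 := by
  have : (fun i => (((1 : ∀ i : ZMod m, GL (Fin (α i)) ℂ) i : GL (Fin (α i)) ℂ) :
      Matrix (Fin (α i)) (Fin (α i)) ℂ)) = 1 := by
    ext1 i; simp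
  rw [block, this, Matrix.blockDiagonal'_one]

theorem block_mul (g h : ∀ i : ZMod m, GL (Fin (α i)) ℂ) : block (g * h) = block g * block h := by
  rw [block, block, block, ← Matrix.blockDiagonal'_mul]
  rfl

/-- The action `g · (X, Y, v, w) = (g X g⁻¹, g Y g⁻¹, g v, w g⁻¹)` of `GL(α)`. -/
def act (g : ∀ i : ZMod m, GL (Fin (α i)) ℂ) (p : FramedData α d) : FramedData α d :=
  ⟨block g * p.X * block g⁻¹, block g * p.Y * block g⁻¹, block g * p.v, p.w * block g⁻¹⟩

instance : MulAction (∀ i : ZMod m, GL (Fin (α i)) ℂ) (FramedData α d) where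
  smul := act
  one_smul p := by
    change act 1 p = p
    ext1 <;> simp [act, block_one]
  mul_smul g h p := by
    change act (g * h) p = act g (act h p)
    ext1 <;> simp only [act, block_mul, mul_inv_rev, Matrix.mul_assoc]

/-- The partial derivative in the coordinate `X_{ab}`. -/
def dX (a b : VIndex α) (F : FramedData α d → ℂ) (p : FramedData α d) : ℂ :=
  deriv (fun s : ℂ => F { p with X := p.X + s • Matrix.single a b 1 }) 0

/-- The partial derivative in the coordinate `Y_{ab}`. -/
def dY (a b : VIndex α) (F : FramedData α d → ℂ) (p : FramedData α d) : ℂ :=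
  deriv (fun s : ℂ => F { p with Y := p.Y + s • Matrix.single a b 1 }) 0

/-- The partial derivative in the coordinate `v_{aβ}`. -/
def dv (a : VIndex α) (β : Fin d) (F : FramedData α d → ℂ) (p : FramedData α d) : ℂ :=
  deriv (fun s : ℂ => F { p with v := p.v + s • Matrix.single a β 1 }) 0

/-- The partial derivative in the coordinate `w_{βa}`. -/
def dw (β : Fin d) (a : VIndex α) (F : FramedData α d → ℂ) (p : FramedData α d) : ℂ :=
  deriv (fun s : ℂ => F { p with w := p.w + s • Matrix.single β a 1 }) 0

/-- The Poisson bracket on the space of representations, whose only nonzero brackets of coordinates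
are `{(X_i)_{ab}, (Y_i)_{ba}} = 1` and `{(v_{i,β})_a, (w_{i,β})_a} = 1`. The pairs `(a, b)` with
`a.1 = b.1 + 1` are those for which `X_{ab}` and `Y_{ba}` are coordinates. -/
def poisson (F G : FramedData α d → ℂ) (p : FramedData α d) : ℂ :=
  (∑ a : VIndex α, ∑ b : VIndex α,
    if a.1 = b.1 + 1 then dX a b F p * dY b a G p - dY b a F p * dX a b G p else 0) +
  ∑ a : VIndex α, ∑ β : Fin d, (dv a β F p * dw β a G p - dw β a F p * dv a β G p)

/-- The Hamiltonian vector field of `H`: the coordinate `ξ` evolves by `dξ/dt = {ξ, H}`. -/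
def hamVec (H : FramedData α d → ℂ) (p : FramedData α d) : FramedData α d where
  X := Matrix.of fun a b => poisson (fun q => q.X a b) H p
  Y := Matrix.of fun a b => poisson (fun q => q.Y a b) H p
  v := Matrix.of fun a β => poisson (fun q => q.v a β) H p
  w := Matrix.of fun β a => poisson (fun q => q.w β a) H p

/-- The Hamiltonians `H_{k,β} = -∑_i tr(E_β w_i Y^k v_{i+k})`. -/
def ham (k : ℕ) (β : Fin d) (p : FramedData α d) : ℂ :=
  -∑ i : ZMod m, Matrix.trace
    (Matrix.single β β (1 : ℂ) * p.wAt i * p.Y ^ k * p.vAt (i + (k : ZMod m)))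

/-- The vector field
`Ẋ = -∑_l ∑_{a<k} Y^a v_l E_β w_{l-k} Y^{k-a-1}`, `Ẏ = 0`, `v̇_j = -Y^k v_{j+k} E_β`,
`ẇ_i = E_β w_{i-k} Y^k`. -/
def flowField (k : ℕ) (β : Fin d) (p : FramedData α d) : FramedData α d where
  X := -∑ l : ZMod m, ∑ a ∈ Finset.range k,
    p.Y ^ a * p.vAt l * Matrix.single β β (1 : ℂ) * p.wAt (l - (k : ZMod m)) * p.Y ^ (k - a - 1)
  Y := 0
  v := ∑ j : ZMod m, -(p.Y ^ k * p.vAt (j + (k : ZMod m)) * Matrix.single β β (1 : ℂ))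
  w := ∑ i : ZMod m, Matrix.single β β (1 : ℂ) * p.wAt (i - (k : ZMod m)) * p.Y ^ k

/-- Velocity of a curve of data, entry by entry. -/
def HasVelocityAt (p : ℂ → FramedData α d) (p' : FramedData α d) (t : ℂ) : Prop :=
  (∀ a b, HasDerivAt (fun s => (p s).X a b) (p'.X a b) t) ∧
  (∀ a b, HasDerivAt (fun s => (p s).Y a b) (p'.Y a b) t) ∧
  (∀ a β, HasDerivAt (fun s => (p s).v a β) (p'.v a β) t) ∧
  (∀ β a, HasDerivAt (fun s => (p s).w β a) (p'.w β a) t)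

section Dressing

variable (c : CherednikParameters m)

/-- `(X - x 1_V)⁻¹`, computed over `ℂ(x)` and regarded as a matrix over `𝒫`. -/
def resX (p : FramedData α d) : Matrix (VIndex α) (VIndex α) c.PRing :=
  ((p.X.map RatFunc.C - Matrix.scalar (VIndex α) RatFunc.X)⁻¹).map c.ofRat

/-- `(Y - y 1_V)⁻¹ = -∑_{k ≥ 0} Y^k y^{-k-1}` as a matrix over `𝒫`. -/
def resY (p : FramedData α d) : Matrix (VIndex α) (VIndex α) c.PRing :=
  Matrix.of fun a b => SkewLaurent.mk
    (fun n => if n < 0 then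
      -CrossedProduct.coeffX (RatFunc.C ((p.Y ^ (-n - 1).toNat) a b)) else 0)
    ⟨0, fun _ hn => if_neg (not_lt.2 hn.le)⟩

/-- The dressing `M = 1 - ∑_{i,j} ε_i w_i (X - x 1_V)⁻¹ (Y - y 1_V)⁻¹ v_j ε_j`. -/
def dressing (p : FramedData α d) : PMat c d :=
  1 - ∑ i : ZMod m, ∑ j : ZMod m,
    Matrix.scalar (Fin d) (c.ofCP (c.ε i)) *
      ((p.wAt i).map c.ofC * p.resX c * p.resY c * (p.vAt j).map c.ofC) *
      Matrix.scalar (Fin d) (c.ofCP (c.ε j))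

/-- The pair `L = M y M⁻¹`, `R_α = M E_α M⁻¹`. -/
def laxPair (p : FramedData α d) : PMat c d × (Fin d → PMat c d) :=
  (p.dressing c * Matrix.scalar (Fin d) c.y * Ring.inverse (p.dressing c),
    fun β => p.dressing c * PMat.E β * Ring.inverse (p.dressing c))

end Dressing

end FramedData

section CalogeroMoser

variable {m : ℕ} [NeZero m] (c : CherednikParameters m) (α : ZMod m → ℕ) (d : ℕ)

/-- The representations of the opposite deformed preprojective algebra of dimension `(1, α)`. -/
abbrev CMRep : Type := {p : FramedData α d // p.IsRep ∧ p.MomentRelation c}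

/-- Equivalence under the action of `GL(α)`. -/
instance cmSetoid : Setoid (CMRep c α d) :=
  (MulAction.orbitRel (∀ i : ZMod m, GL (Fin (α i)) ℂ) (FramedData α d)).comap Subtype.val

/-- The Calogero--Moser space `𝒞_{α,λ}`: equivalence classes of the data under `GL(α)`. -/
def CMSpace : Type := Quotient (cmSetoid c α d)

variable {c α d}

/-- The point of `𝒞_{α,λ}` represented by given data. -/
def CMSpace.of (p : CMRep c α d) : CMSpace c α d := Quotient.mk _ p

/-- The curve `z` in `𝒞_{α,λ}` follows the Hamiltonian flow of the `GL(α)`-invariant function `H`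
near the time `t₀`: near `t₀` it is the image of an integral curve, inside the space of solutions of
the relations, of the Hamiltonian vector field of `H`. -/
def IsHamiltonianFlowAt (H : FramedData α d → ℂ) (z : ℂ → CMSpace c α d) (t₀ : ℂ) : Prop :=
  ∃ p : ℂ → CMRep c α d, ∀ᶠ t in 𝓝 t₀, CMSpace.of (p t) = z t ∧
    FramedData.HasVelocityAt (fun s => (p s).1) (FramedData.hamVec H (p t).1) t

end CalogeroMoser

end

/-!
# Calogero--Moser spaces and a matrix hierarchy for the cyclic quiver

Over `𝒫` put `A = X - x` and `B = Y - y`. Compressed by the idempotent `∑ e_i ⊗ ε_i`, which matches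
the grading of `V` with the grading of `ℂ(x) * Γ`, the moment relation and
`x y - y x = ∑ λ_i ε_i` combine into `B A - A B = V W` with `V = ∑ v_j ε_j` and `W = ∑ ε_i w_i`
(`FramedData.gr_mul_commutator`). This relation of rank `d` is the source of everything.

* It gives `B⁻¹ A⁻¹ V W A⁻¹ B⁻¹ V = B⁻¹ A⁻¹ V - A⁻¹ B⁻¹ V`, hence the dressing `M = 1 - W A⁻¹ B⁻¹ V`
  has the inverse `M⁻¹ = 1 + W B⁻¹ A⁻¹ V` (`FramedData.dressing_mul_dressingInv`). As `M - 1` has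
  only negative powers of `y`, the pair `L = M y M⁻¹`, `R_α = M E_α M⁻¹` has the required form. The
  coefficient of `y⁰` in `L` is `θ⁻¹(u) - u`, where `u` is the coefficient of `y⁻¹` in `M⁻¹`, and `θ`
  does not change coefficients at the identity of `Γ`; this is the normalisation of `L`
  (`FramedData.isHierarchyPoint_laxPair`).

* The Hamiltonian vector field of `H_{k,β}` keeps `Y` fixed. Differentiating
  `M = 1 - W A⁻¹ B⁻¹ V` along it and using the relation once more gives
  `Ṁ M⁻¹ = -(M y^k E_β M⁻¹)₋` (`FramedData.posPart_lax_pow_mul`): the powers of `Y` occurring in the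
  vector field are traded for powers of `y` by `Y^k = y^k + (Y - y) ∑_a Y^a y^{k-1-a}`, and the terms
  that are produced are seen to be either nonnegative or negative in `y`. The Lax equations follow by
  differentiating `M y M⁻¹` and `M E_α M⁻¹` (`FramedData.hierarchyEquationsAt_laxPair`). All
  derivatives are coefficientwise, and the entries of `A⁻¹` are rational functions of `x` whose
  denominators vary with `X`, so this needs a calculus for curves in `ℂ(x)` (`RatHasDerivAt`) and
  for curves in `𝒫` of bounded order (`PHasDerivAt`).

* Since `Y` is constant, the equations for `v` and `w` are linear and are solved by the exponentials
  `E_β(t) = exp (∑_k t_{kβ} Y^k)`, after which `X` is obtained by one integration. The integral is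
  `∑_β E_β(t)⁻¹ D_β(t)`, where `D_β(t)` is the derivative of `E_β(t)` as a function of `Y` in the
  direction `v E_β w`; it is the upper right block of the same exponential for the block matrix
  `(Y u; 0 Y)` with `u = v E_β w` (`timeExpDeriv`). All the properties of the flow, namely the group
  law, the conservation of the moment relation, the equivariance and the velocity, are read off from
  this block matrix.
-/

set_option linter.unusedSectionVars false

noncomputable section

/-! ### Relations in the ring `𝒫` -/

namespace CherednikParameters
variable {m : ℕ} [NeZero m] (c : CherednikParameters m)
open CyclicGroup SkewMonoidAlgebra CrossedProduct

theorem μ_ne_zero : c.μ ≠ 0 := c.primitive.ne_zero (NeZero.ne m)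

/-- The character `i ↦ μ^i` of `ℤ/m`. -/
def χ (i : ZMod m) : ℂ := c.μ ^ i.val

theorem χ_ne_zero (i : ZMod m) : c.χ i ≠ 0 := pow_ne_zero _ c.μ_ne_zero

theorem χ_natCast (n : ℕ) : c.χ (n : ZMod m) = c.μ ^ n := by
  rw [χ, ZMod.val_natCast, ← pow_mod_orderOf c.μ n, ← c.primitive.eq_orderOf]

theorem χ_add (i j : ZMod m) : c.χ (i + j) = c.χ i * c.χ j := by
  conv_lhs => rw [← ZMod.natCast_zmod_val i, ← ZMod.natCast_zmod_val j, ← Nat.cast_add, χ_natCast]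
  rw [pow_add]; rfl

theorem χ_one : c.χ 1 = c.μ := by
  simpa using c.χ_natCast 1

theorem χ_pow_card (i : ZMod m) : c.χ i ^ m = 1 := by
  rw [χ, ← pow_mul, mul_comm, pow_mul, c.primitive.pow_eq_one, one_pow]

theorem χ_injective : Function.Injective c.χ := by
  intro i j h
  exact ZMod.val_injective m (c.primitive.pow_inj (ZMod.val_lt i) (ZMod.val_lt j) h)

theorem toCUnits_s : ((toCUnits c.s : ℂˣ) : ℂ) = c.μ :=
  c.primitive.val_toRootsOfUnity_coe

theorem s_pow_card : c.s ^ m = 1 := (mem_rootsOfUnity m _).1 c.s.2 |> Subtype.ext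

theorem ε_eq (i : ZMod m) : c.ε i =
    ∑ r ∈ Finset.range m, single (c.s ^ r) (RatFunc.C ((1 / (m : ℂ)) * (c.χ i)⁻¹ ^ r)) := by
  refine Finset.sum_congr rfl fun r _ => ?_
  congr 3
  rw [zpow_neg, zpow_mul, zpow_natCast, zpow_natCast, inv_pow]; rfl

theorem single_C_mul (g h : CyclicGroup m) (a b : ℂ) :
    (single g (RatFunc.C a) * single h (RatFunc.C b) : CrossedProduct m) =
      single (g * h) (RatFunc.C (a * b)) := by
  rw [single_mul_single, smul_def, ratScale_C, map_mul]

/-- The element `ε_i` spans the eigenspace of `s` in `ℂΓ` for the eigenvalue `μ^i`. -/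
theorem s_mul_ε (i : ZMod m) :
    single c.s (RatFunc.C 1) * c.ε i = coeffX (RatFunc.C (c.χ i)) * c.ε i := by
  have hχ := c.χ_ne_zero i
  rw [ε_eq, Finset.mul_sum, Finset.mul_sum, coeffX_apply]
  simp only [single_C_mul, one_mul]
  -- multiplication by `s` permutes the terms of the sum cyclically
  set F : ℕ → CrossedProduct m := fun r =>
    single (c.s ^ r) (RatFunc.C (c.χ i * ((1 / (m : ℂ)) * (c.χ i)⁻¹ ^ r))) with hF
  have h1 : ∀ r, single (c.s * c.s ^ r) (RatFunc.C ((1 / (m : ℂ)) * (c.χ i)⁻¹ ^ r)) = F (r + 1) := by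
    intro r
    simp only [hF, pow_succ']
    congr 2
    field_simp
  have h2 : F m = F 0 := by
    simp only [hF, s_pow_card, inv_pow, χ_pow_card, pow_zero, inv_one]
  simp only [h1]
  have h3 := Finset.sum_range_succ F m
  rw [Finset.sum_range_succ', h2] at h3
  exact add_right_cancel h3

theorem s_pow_mul_ε (i : ZMod m) (r : ℕ) :
    single (c.s ^ r) (RatFunc.C 1) * c.ε i = coeffX (RatFunc.C (c.χ i ^ r)) * c.ε i := by
  induction r with
  | zero => rfl
  | succ r ih =>
    have : (single (c.s ^ (r + 1)) (RatFunc.C 1) : CrossedProduct m) =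
        single c.s (RatFunc.C 1) * single (c.s ^ r) (RatFunc.C 1) := by
      rw [single_C_mul, pow_succ', one_mul]
    rw [this, mul_assoc, ih, ← mul_assoc, ← coeffX_C_comm, mul_assoc, s_mul_ε, ← mul_assoc,
      ← map_mul, ← map_mul, pow_succ]

theorem ε_mul_ε (i j : ZMod m) : c.ε i * c.ε j = if i = j then c.ε i else 0 := by
  have h : c.ε i * c.ε j =
      coeffX (RatFunc.C (∑ r ∈ Finset.range m, (1 / (m : ℂ)) * (c.χ j / c.χ i) ^ r)) * c.ε j := by
    conv_lhs => rw [ε_eq c i]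
    rw [_root_.map_sum, _root_.map_sum, Finset.sum_mul, Finset.sum_mul]
    refine Finset.sum_congr rfl fun r _ => ?_
    have : (single (c.s ^ r) (RatFunc.C ((1 / (m : ℂ)) * (c.χ i)⁻¹ ^ r)) : CrossedProduct m) =
        coeffX (RatFunc.C ((1 / (m : ℂ)) * (c.χ i)⁻¹ ^ r)) * single (c.s ^ r) (RatFunc.C 1) := by
      rw [coeffX_apply, single_C_mul, one_mul, mul_one]
    rw [this, mul_assoc, s_pow_mul_ε, ← mul_assoc, ← map_mul, ← map_mul]
    congr 3
    rw [div_pow, inv_pow, div_eq_mul_inv]; ring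
  rw [h, ← Finset.mul_sum]
  have hm : (m : ℂ) ≠ 0 := Nat.cast_ne_zero.2 (NeZero.ne m)
  split_ifs with hij
  · subst hij
    simp [div_self (c.χ_ne_zero i), hm]
  · have h1 : c.χ j / c.χ i ≠ 1 := fun h => hij (c.χ_injective ((div_eq_one_iff_eq (c.χ_ne_zero i)).1 h)).symm
    have h2 : (c.χ j / c.χ i) ^ m = 1 := by rw [div_pow, χ_pow_card, χ_pow_card, div_one]
    rw [geom_sum_eq h1, h2]
    simp

theorem sum_ε : ∑ i : ZMod m, c.ε i = 1 := by
  have hm : (m : ℂ) ≠ 0 := Nat.cast_ne_zero.2 (NeZero.ne m)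
  simp only [ε_eq]
  rw [Finset.sum_comm]
  have h : ∀ r : ℕ, ∑ i : ZMod m, (single (c.s ^ r) (RatFunc.C ((1 / (m : ℂ)) * (c.χ i)⁻¹ ^ r)) :
      CrossedProduct m) = single (c.s ^ r) (RatFunc.C ((1 / (m : ℂ)) * ∑ i : ZMod m, (c.χ i)⁻¹ ^ r)) := by
    intro r
    rw [Finset.mul_sum, _root_.map_sum]
    exact (_root_.map_sum (AddMonoidHom.mk' (fun z : RatFunc ℂ => (single (c.s ^ r) z : CrossedProduct m))
      (single_add _)) _ _).symm
  rw [Finset.sum_congr rfl fun r _ => h r, Finset.sum_eq_single 0]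
  · simp only [pow_zero, Finset.sum_const, Finset.card_univ, ZMod.card, nsmul_eq_mul, mul_one,
      one_div, inv_mul_cancel₀ hm, map_one]
    rfl
  · intro r hr hr0
    have h1 : c.μ⁻¹ ^ r ≠ 1 := by
      rw [inv_pow]
      intro h
      exact c.primitive.pow_ne_one_of_pos_of_lt hr0 (Finset.mem_range.1 hr) (inv_eq_one.1 h)
    -- the sum is an eigenvector of the shift of `ℤ/m` with an eigenvalue other than `1`
    have h2 : c.μ⁻¹ ^ r * ∑ i : ZMod m, (c.χ i)⁻¹ ^ r = ∑ i : ZMod m, (c.χ i)⁻¹ ^ r := by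
      conv_rhs => rw [← Equiv.sum_comp (Equiv.addRight (1 : ZMod m))]
      rw [Finset.mul_sum]
      refine Finset.sum_congr rfl fun i _ => ?_
      rw [Equiv.coe_addRight, χ_add, χ_one, mul_inv, mul_pow, mul_comm]
    have h3 : ∑ i : ZMod m, (c.χ i)⁻¹ ^ r = 0 := by
      by_contra h3
      exact h1 (mul_right_cancel₀ h3 (h2.trans (one_mul _).symm))
    rw [h3, mul_zero, map_zero, single_zero]
  · intro h; exact absurd (Finset.mem_range.2 (Nat.pos_of_ne_zero (NeZero.ne m))) h

theorem x_mul_ε (i : ZMod m) :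
    coeffX RatFunc.X * c.ε i = c.ε (i - 1) * coeffX RatFunc.X := by
  rw [ε_eq, ε_eq, Finset.mul_sum, Finset.sum_mul]
  refine Finset.sum_congr rfl fun r _ => ?_
  rw [coeffX_apply, single_mul_single, single_mul_single, smul_def, smul_def, ratScale_C, ratScale_X,
    one_mul, mul_one, ← mul_assoc, ← map_mul, mul_comm]
  congr 3
  have h : c.χ i = c.χ (i - 1) * c.μ := by rw [← χ_one, ← χ_add, sub_add_cancel]
  rw [h, map_pow, Units.val_inv_eq_inv_val, Units.val_pow_eq_pow_val, toCUnits_s, mul_inv, mul_pow, inv_pow c.μ]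
  ring

theorem thetaInv_ε (i : ZMod m) : thetaInv (c.ε i) = c.ε (i + 1) := by
  rw [ε_eq, ε_eq, _root_.map_sum]
  refine Finset.sum_congr rfl fun r _ => ?_
  rw [thetaInv_single, ← map_mul, map_pow, Units.val_inv_eq_inv_val, Units.val_pow_eq_pow_val,
    toCUnits_s, χ_add, χ_one, mul_inv, mul_pow, inv_pow c.μ]
  congr 2
  ring

theorem partialX_single_C (g : CyclicGroup m) (a : ℂ) :
    partialX (single g (RatFunc.C a) : CrossedProduct m) = 0 := by
  rw [partialX_single]
  have : ratDeriv (RatFunc.C a) = 0 := by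
    rw [← RatFunc.algebraMap_eq_C]; exact ratDeriv.map_algebraMap a
  rw [this, single_zero]

theorem dunklD_eq_zero {f : CrossedProduct m} (h : partialX f = 0)
    (h' : c.dunklTail * f = f * c.dunklTail) : c.dunklD f = 0 := by
  simp [dunklD, h, h']

theorem dunklD_ε (i : ZMod m) : c.dunklD (c.ε i) = 0 := by
  apply dunklD_eq_zero
  · rw [ε, _root_.map_sum]
    exact Finset.sum_eq_zero fun r _ => partialX_single_C _ _
  · simp only [dunklTail, Finset.sum_mul, Finset.mul_sum]
    refine Finset.sum_congr rfl fun j _ => ?_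
    rw [mul_assoc, ← mul_assoc (c.ε i), ← coeffX_C_comm, mul_assoc, ε_mul_ε, ε_mul_ε]
    by_cases h : j = i
    · subst h; rfl
    · simp [h, Ne.symm h]

theorem dunklD_C (z : ℂ) : c.dunklD (coeffX (RatFunc.C z)) = 0 :=
  c.dunklD_eq_zero (partialX_single_C _ _) (coeffX_C_comm _ _).symm

theorem thetaInv_coeffX (f : RatFunc ℂ) : thetaInv (coeffX f : CrossedProduct m) = coeffX f := by
  rw [coeffX_apply, thetaInv_single]; simp

theorem y_mul_ofCP (a : CrossedProduct m) :
    c.y * c.ofCP a = c.ofCP (thetaInv a) * c.y + c.ofCP (c.dunklD a) :=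
  SkewLaurent.y_mul_ofCoeff (S := c.skew) a

theorem y_mul_ε (i : ZMod m) : c.y * c.ofCP (c.ε i) = c.ofCP (c.ε (i + 1)) * c.y := by
  rw [y_mul_ofCP, thetaInv_ε, dunklD_ε, map_zero, add_zero]

theorem y_commute_ofC (z : ℂ) : Commute c.y (c.ofC z) := by
  have := c.y_mul_ofCP (coeffX (RatFunc.C z))
  rw [thetaInv_coeffX, dunklD_C, map_zero, add_zero] at this
  exact this

theorem lmulY_eq (u : c.PRing) : SkewLaurent.lmulY u = c.y * u := by
  have := SkewLaurent.lmulY_mul 1 u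
  rw [one_mul] at this
  rw [← this, SkewLaurent.one_def', SkewLaurent.lmulY_monomial_one]; rfl

theorem dunklD_x : c.dunklD (coeffX RatFunc.X) =
    -∑ i : ZMod m, coeffX (RatFunc.C (c.lam i)) * c.ε i := by
  have h1 : (partialX (coeffX RatFunc.X) : CrossedProduct m) = 1 := by
    rw [coeffX_apply, partialX_single]
    have : ratDeriv RatFunc.X = 1 := by
      have := ratDerivFun_div X (q := 1) one_ne_zero
      simp only [derivative_X, derivative_one, map_one, div_one, mul_one, mul_zero, sub_zero, one_pow,
        RatFunc.algebraMap_X] at this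
      exact this
    rw [this]; rfl
  have h2 : c.dunklTail * coeffX RatFunc.X =
      coeffX RatFunc.X * ∑ i : ZMod m, coeffX (RatFunc.C ((m : ℂ) * c.k (i - 1))) * c.ε i := by
    rw [dunklTail, Finset.sum_mul, Finset.mul_sum, ← Equiv.sum_comp (Equiv.subRight (1 : ZMod m))]
    refine Finset.sum_congr rfl fun i _ => ?_
    rw [Equiv.subRight_apply, ← mul_assoc, ← coeffX_C_comm _ (coeffX RatFunc.X), mul_assoc, mul_assoc, x_mul_ε]
  have h3 : (coeffX RatFunc.X⁻¹ * coeffX RatFunc.X : CrossedProduct m) = 1 := by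
    rw [← map_mul, inv_mul_cancel₀ RatFunc.X_ne_zero, map_one]
  have h4 : (coeffX (RatFunc.C c.τ) : CrossedProduct m) =
      ∑ i : ZMod m, coeffX (RatFunc.C c.τ) * c.ε i := by
    rw [← Finset.mul_sum, sum_ε, mul_one]
  simp only [dunklD, AddMonoidHom.coe_mk, ZeroHom.coe_mk]
  rw [h1, h2, mul_one, ← mul_sub, ← mul_assoc, h3, one_mul, h4, dunklTail, ← Finset.sum_sub_distrib,
    ← Finset.sum_sub_distrib, ← Finset.sum_neg_distrib]
  refine Finset.sum_congr rfl fun i _ => ?_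
  rw [← sub_mul, ← sub_mul, ← map_sub, ← map_sub, ← map_sub, ← map_sub]
  have h5 : c.τ - (m * c.k (i - 1) - m * c.k i) = -c.lam i := by rw [lam]; ring
  rw [h5, map_neg, map_neg]
  exact neg_mul _ _

/-- The commutation relation `x y - y x = ∑ λ_i ε_i` of the rational Cherednik algebra. -/
theorem y_mul_x : c.y * c.ofRat RatFunc.X =
    c.ofRat RatFunc.X * c.y - ∑ i : ZMod m, c.ofC (c.lam i) * c.ofCP (c.ε i) := by
  change c.y * c.ofCP (coeffX RatFunc.X) = c.ofCP (coeffX RatFunc.X) * c.y - _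
  rw [y_mul_ofCP, thetaInv_coeffX, dunklD_x, map_neg, _root_.map_sum, sub_eq_add_neg]
  simp only [map_mul]
  rfl

theorem ofCP_C_commute (z : ℂ) (a : CrossedProduct m) : Commute (c.ofC z) (c.ofCP a) := by
  change c.ofCP (coeffX (RatFunc.C z)) * c.ofCP a = c.ofCP a * c.ofCP (coeffX (RatFunc.C z))
  rw [← map_mul, ← map_mul, coeffX_C_comm]

theorem coeff_ofCP_mul (a : CrossedProduct m) (u : c.PRing) (n : ℤ) :
    (c.ofCP a * u).coeff n = a * u.coeff n := by
  have := SkewLaurent.monomial_mul a 0 u n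
  rw [SkewLaurent.lmulYPow_zero] at this
  exact this

/-- The constants `ℂ` are central in `𝒫`. -/
theorem ofC_commute (z : ℂ) (u : c.PRing) : Commute (c.ofC z) u := by
  -- constants commute with every power of `y`, also with the negative ones
  have h : ∀ (j : ℤ), SkewLaurent.lmulYPow j (c.ofC z) = c.ofC z * SkewLaurent.monomial 1 j := by
    intro j
    induction j using Int.induction_on with
    | zero => rw [SkewLaurent.lmulYPow_zero]; exact (mul_one _).symm
    | succ i ih =>
      rw [SkewLaurent.lmulYPow_add_one, ih, lmulY_eq, ← mul_assoc, (c.y_commute_ofC z).eq, mul_assoc,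
        ← lmulY_eq, SkewLaurent.lmulY_monomial_one]
    | pred i ih =>
      rw [SkewLaurent.lmulYPow_sub_one, ih]
      apply (Function.LeftInverse.injective (g := SkewLaurent.lmulYInv) SkewLaurent.lmulYInv_lmulY)
      rw [SkewLaurent.lmulY_lmulYInv, lmulY_eq, ← mul_assoc, (c.y_commute_ofC z).eq, mul_assoc,
        ← lmulY_eq, SkewLaurent.lmulY_monomial_one, sub_add_cancel]
  refine SkewLaurent.ext fun n => ?_
  change (c.ofCP (coeffX (RatFunc.C z)) * u).coeff n = _
  rw [coeff_ofCP_mul, SkewLaurent.coeff_mul, finsum_eq_single _ n]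
  · rw [h]
    change _ = _ * (c.ofCP (coeffX (RatFunc.C z)) * _).coeff n
    rw [coeff_ofCP_mul, SkewLaurent.coeff_monomial, if_pos rfl, mul_one, coeffX_C_comm]
  · intro j hj
    rw [h]
    change _ * (c.ofCP (coeffX (RatFunc.C z)) * _).coeff n = 0
    rw [coeff_ofCP_mul, SkewLaurent.coeff_monomial, if_neg hj.symm, mul_zero, mul_zero]

end CherednikParameters

namespace SkewLaurent
variable {A : Type} [Ring A] {S : SkewDerivation A}

theorem lmulYPow_add (i j : ℤ) (u : SkewLaurent S) :
    lmulYPow (i + j) u = lmulYPow i (lmulYPow j u) := by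
  simp only [lmulYPow, zpow_add, Units.val_mul]; rfl

@[simp] theorem coeff_sub (u w : SkewLaurent S) (n : ℤ) :
    (u - w).coeff n = u.coeff n - w.coeff n := rfl

/-- Taking the coefficient of `yⁿ`, as an additive map. -/
def coeffHom (n : ℤ) : SkewLaurent S →+ A where
  toFun u := u.coeff n
  map_zero' := rfl
  map_add' _ _ := rfl

theorem coeff_sum {ι : Type*} (s : Finset ι) (f : ι → SkewLaurent S) (n : ℤ) :
    (∑ i ∈ s, f i).coeff n = ∑ i ∈ s, (f i).coeff n := map_sum (coeffHom n) f s

theorem coeff_mul_y (u : SkewLaurent S) (n : ℤ) :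
    (u * monomial 1 1).coeff n = u.coeff (n - 1) := by
  have h : ∀ j : ℤ, lmulYPow j (monomial 1 1 : SkewLaurent S) = monomial 1 (j + 1) := by
    intro j
    rw [← lmulYPow_one 1, ← lmulYPow_add, lmulYPow_one]
  rw [coeff_mul, finsum_eq_single _ (n - 1)]
  · rw [h, coeff_monomial, if_pos (by ring), mul_one]
  · intro j hj
    rw [h, coeff_monomial, if_neg (by omega), mul_zero]

theorem coeff_y_mul (u : SkewLaurent S) (n : ℤ) :
    (monomial 1 1 * u).coeff n = S.σ (u.coeff (n - 1)) + S.δ (u.coeff n) := by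
  have := lmulYPow_add_one 0 u
  rw [lmulYPow_zero, zero_add] at this
  rw [monomial_mul, this, one_mul]
  rfl

end SkewLaurent

namespace CherednikParameters
variable {m : ℕ} [NeZero m] (c : CherednikParameters m)

theorem scalar_mul_map {p q : Type*} [Fintype p] [Fintype q] [DecidableEq p] [DecidableEq q]
    (u : c.PRing) (N : Matrix p q ℂ) :
    Matrix.scalar p u * N.map c.ofC = N.map c.ofC * Matrix.scalar q u := by
  ext1 a b
  simp only [Matrix.scalar_apply, Matrix.diagonal_mul, Matrix.mul_diagonal, Matrix.map_apply]
  exact ((c.ofC_commute _ _).eq).symm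

end CherednikParameters

namespace FramedData
variable {m : ℕ} [NeZero m] {α : ZMod m → ℕ} {d : ℕ}

/-! ### Grading by `ℤ/m` -/

/-- Matrices on `V` that map `V_i` to `V_{i+r}` for all `i`. -/
def IsHomog (r : ZMod m) (N : Matrix (VIndex α) (VIndex α) ℂ) : Prop :=
  ∀ a b : VIndex α, a.1 ≠ b.1 + r → N a b = 0

/-- The component of degree `r` of a matrix on `V`. -/
def hpart (r : ZMod m) : Matrix (VIndex α) (VIndex α) ℂ →ₗ[ℂ] Matrix (VIndex α) (VIndex α) ℂ where
  toFun N := Matrix.of fun a b => if a.1 = b.1 + r then N a b else 0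
  map_add' N P := by ext a b; simp only [Matrix.of_apply, Matrix.add_apply]; split_ifs <;> simp
  map_smul' z N := by ext a b; simp

theorem hpart_apply (r : ZMod m) (N : Matrix (VIndex α) (VIndex α) ℂ) (a b : VIndex α) :
    hpart r N a b = if a.1 = b.1 + r then N a b else 0 := rfl

theorem isHomog_hpart (r : ZMod m) (N : Matrix (VIndex α) (VIndex α) ℂ) : IsHomog r (hpart r N) :=
  fun _ _ h => if_neg h

theorem IsHomog.mul {r s : ZMod m} {N P : Matrix (VIndex α) (VIndex α) ℂ}
    (hN : IsHomog r N) (hP : IsHomog s P) : IsHomog (r + s) (N * P) := by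
  intro a b h
  rw [Matrix.mul_apply]
  refine Finset.sum_eq_zero fun x _ => ?_
  by_cases h1 : a.1 = x.1 + r
  · rw [hP x b (fun h2 => h (by rw [h1, h2]; ring)), mul_zero]
  · rw [hN a x h1, zero_mul]

theorem isHomog_one : IsHomog 0 (1 : Matrix (VIndex α) (VIndex α) ℂ) := by
  intro a b h
  exact Matrix.one_apply_ne fun h' => h (by rw [h', add_zero])

theorem IsHomog.pow {r : ZMod m} {N : Matrix (VIndex α) (VIndex α) ℂ} (hN : IsHomog r N) (k : ℕ) :
    IsHomog ((k : ZMod m) * r) (N ^ k) := by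
  induction k with
  | zero => simpa using isHomog_one
  | succ k ih =>
    rw [pow_succ]
    convert ih.mul hN using 1
    push_cast; ring

theorem IsHomog.add {r : ZMod m} {N P : Matrix (VIndex α) (VIndex α) ℂ}
    (hN : IsHomog r N) (hP : IsHomog r P) : IsHomog r (N + P) := fun a b h => by
  rw [Matrix.add_apply, hN a b h, hP a b h, add_zero]

theorem IsHomog.sub {r : ZMod m} {N P : Matrix (VIndex α) (VIndex α) ℂ}
    (hN : IsHomog r N) (hP : IsHomog r P) : IsHomog r (N - P) := fun a b h => by
  rw [Matrix.sub_apply, hN a b h, hP a b h, sub_zero]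

theorem IsHomog.mul_hpart {r : ZMod m} {N : Matrix (VIndex α) (VIndex α) ℂ} (hN : IsHomog r N)
    (s : ZMod m) (P : Matrix (VIndex α) (VIndex α) ℂ) :
    N * hpart s P = hpart (r + s) (N * P) := by
  ext a b
  rw [hpart_apply, Matrix.mul_apply, Matrix.mul_apply]
  split_ifs with h
  · refine Finset.sum_congr rfl fun x _ => ?_
    rw [hpart_apply]
    split_ifs with h1
    · rfl
    · rw [hN a x (fun h2 => h1 ?_), zero_mul, zero_mul]
      rw [h2, add_comm r s, ← add_assoc] at h
      exact add_right_cancel h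
  · refine Finset.sum_eq_zero fun x _ => ?_
    rw [hpart_apply]
    split_ifs with h1
    · rw [hN a x (fun h2 => h ?_), zero_mul]
      rw [h2, h1]; ring
    · rw [mul_zero]

theorem IsHomog.hpart_mul {r : ZMod m} {N : Matrix (VIndex α) (VIndex α) ℂ} (hN : IsHomog r N)
    (s : ZMod m) (P : Matrix (VIndex α) (VIndex α) ℂ) :
    hpart s P * N = hpart (s + r) (P * N) := by
  ext a b
  rw [hpart_apply, Matrix.mul_apply, Matrix.mul_apply]
  split_ifs with h
  · refine Finset.sum_congr rfl fun x _ => ?_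
    rw [hpart_apply]
    split_ifs with h1
    · rfl
    · rw [hN x b (fun h2 => h1 ?_), mul_zero, mul_zero]
      rw [h, h2]; ring
  · refine Finset.sum_eq_zero fun x _ => ?_
    rw [hpart_apply]
    split_ifs with h1
    · rw [hN x b (fun h2 => h ?_), mul_zero]
      rw [h1, h2]; ring
    · rw [zero_mul]

theorem e_mul_apply {q : Type*} (i : ZMod m) (N : Matrix (VIndex α) q ℂ) (a : VIndex α) (b : q) :
    (e α i * N) a b = if a.1 = i then N a b else 0 := by
  rw [e, Matrix.diagonal_mul]; simp

theorem mul_e_apply {q : Type*} (i : ZMod m) (N : Matrix q (VIndex α) ℂ) (a : q) (b : VIndex α) :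
    (N * e α i) a b = if b.1 = i then N a b else 0 := by
  rw [e, Matrix.mul_diagonal]; simp

theorem isRep_iff (p : FramedData α d) : p.IsRep ↔ IsHomog 1 p.X ∧ IsHomog (-1) p.Y := by
  constructor
  · refine fun h => ⟨fun a b hab => ?_, fun a b hab => ?_⟩
    · have := congrFun (congrFun (h b.1).1 a) b
      rw [e_mul_apply, mul_e_apply, if_neg hab, if_pos rfl] at this
      exact this.symm
    · have := congrFun (congrFun (h a.1).2 a) b
      rw [e_mul_apply, mul_e_apply, if_pos rfl, if_neg (fun h' => hab (by rw [h']; ring))] at this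
      exact this
  · rintro ⟨hX, hY⟩ i
    refine ⟨Matrix.ext fun a b => ?_, Matrix.ext fun a b => ?_⟩
    · rw [e_mul_apply, mul_e_apply]
      by_cases h : a.1 = b.1 + 1
      · simp [h]
      · rw [hX a b h, ite_self, ite_self]
    · rw [e_mul_apply, mul_e_apply]
      by_cases h : a.1 = b.1 + -1
      · have : (a.1 = i) = (b.1 = i + 1) := propext ⟨fun h' => by rw [← h', h]; ring, fun h' => by rw [h, h']; ring⟩
        simp only [this]
      · rw [hY a b h, ite_self, ite_self]

theorem sum_vAt_mul_wAt (p : FramedData α d) : ∑ i : ZMod m, p.vAt i * p.wAt i = hpart 0 (p.v * p.w) := by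
  ext a b
  rw [Matrix.sum_apply, hpart_apply, add_zero]
  have : ∀ i, (p.vAt i * p.wAt i) a b = if a.1 = i then (if b.1 = i then (p.v * p.w) a b else 0) else 0 := by
    intro i
    rw [vAt, wAt, Matrix.mul_assoc, e_mul_apply, ← Matrix.mul_assoc, mul_e_apply]
  simp only [this, Finset.sum_ite_eq, Finset.mem_univ, if_true]
  simp only [eq_comm]

theorem sum_smul_e (f : ZMod m → ℂ) :
    ∑ i : ZMod m, f i • e α i = Matrix.diagonal fun a : VIndex α => f a.1 := by
  ext a b
  rw [Matrix.sum_apply]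
  by_cases h : a = b
  · subst h; simp [e]
  · simp [e, h]

theorem momentRelation_iff (c : CherednikParameters m) (p : FramedData α d) :
    p.MomentRelation c ↔ p.Y * p.X - p.X * p.Y - hpart 0 (p.v * p.w) =
      Matrix.diagonal fun a : VIndex α => c.lam a.1 := by
  rw [MomentRelation, sum_vAt_mul_wAt, sum_smul_e]

section Graded
variable (c : CherednikParameters m)

/-- The matrix `∑_i e_{i-r} ⊗ ε_i` over `𝒫`. For `r = 0` it is the idempotent that matches the grading
of `V` with the action of `Γ`. -/
def gr (α : ZMod m → ℕ) (r : ZMod m) : Matrix (VIndex α) (VIndex α) c.PRing :=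
  Matrix.diagonal fun a => c.ofCP (c.ε (a.1 + r))

/-- The idempotent `∑_i e_i ⊗ ε_i` commutes with maps that preserve the grading of `V`; maps of degree `r`
shift it. -/
theorem IsHomog.map_mul_gr {r : ZMod m} {N : Matrix (VIndex α) (VIndex α) ℂ} (hN : IsHomog r N)
    (s : ZMod m) : N.map c.ofC * gr c α s = gr c α (s - r) * N.map c.ofC := by
  ext1 a b
  rw [gr, gr, Matrix.mul_diagonal, Matrix.diagonal_mul, Matrix.map_apply]
  by_cases h : a.1 = b.1 + r
  · rw [h, (c.ofCP_C_commute _ _).eq]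
    congr 3
    ring_nf
  · rw [hN a b h, map_zero, zero_mul, mul_zero]

theorem gr_mul_self : gr c α 0 * gr c α 0 = gr c α 0 := by
  rw [gr, Matrix.diagonal_mul_diagonal]
  congr 1
  funext a
  rw [← map_mul, c.ε_mul_ε, if_pos rfl]

theorem scalar_x_mul_gr (r : ZMod m) :
    Matrix.scalar (VIndex α) (c.ofRat RatFunc.X) * gr c α r =
      gr c α (r - 1) * Matrix.scalar (VIndex α) (c.ofRat RatFunc.X) := by
  rw [gr, gr, Matrix.scalar_apply, Matrix.diagonal_mul_diagonal, Matrix.diagonal_mul_diagonal]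
  congr 1
  funext a
  change c.ofCP (CrossedProduct.coeffX RatFunc.X) * _ = _ * c.ofCP (CrossedProduct.coeffX RatFunc.X)
  rw [← map_mul, c.x_mul_ε, map_mul, add_sub_assoc]

theorem scalar_y_mul_gr (r : ZMod m) :
    Matrix.scalar (VIndex α) c.y * gr c α r = gr c α (r + 1) * Matrix.scalar (VIndex α) c.y := by
  rw [gr, gr, Matrix.scalar_apply, Matrix.diagonal_mul_diagonal, Matrix.diagonal_mul_diagonal]
  congr 1
  funext a
  rw [c.y_mul_ε, add_assoc]

theorem scalar_y_pow_mul_gr (r : ZMod m) (k : ℕ) :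
    Matrix.scalar (VIndex α) c.y ^ k * gr c α r =
      gr c α (r + k) * Matrix.scalar (VIndex α) c.y ^ k := by
  induction k with
  | zero => simp
  | succ k ih =>
    rw [pow_succ', Matrix.mul_assoc, ih, ← Matrix.mul_assoc, scalar_y_mul_gr, Matrix.mul_assoc]
    congr 2
    push_cast; ring

/-- `X - x`, over `𝒫`. -/
def opX (p : FramedData α d) : Matrix (VIndex α) (VIndex α) c.PRing :=
  p.X.map c.ofC - Matrix.scalar (VIndex α) (c.ofRat RatFunc.X)

/-- `Y - y`, over `𝒫`. -/
def opY (p : FramedData α d) : Matrix (VIndex α) (VIndex α) c.PRing :=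
  p.Y.map c.ofC - Matrix.scalar (VIndex α) c.y

/-- `∑_j v_j ε_j`. -/
def colV (p : FramedData α d) : Matrix (VIndex α) (Fin d) c.PRing := gr c α 0 * p.v.map c.ofC

/-- `∑_i ε_i w_i`. -/
def rowW (p : FramedData α d) : Matrix (Fin d) (VIndex α) c.PRing := p.w.map c.ofC * gr c α 0

theorem sum_scalar_mul_w (w : Matrix (Fin d) (VIndex α) ℂ) :
    ∑ i : ZMod m, Matrix.scalar (Fin d) (c.ofCP (c.ε i)) * (w * e α i).map c.ofC =
      w.map c.ofC * gr c α 0 := by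
  ext1 β a
  rw [Matrix.sum_apply, gr, Matrix.mul_diagonal, add_zero, Finset.sum_eq_single a.1]
  · rw [Matrix.scalar_apply, Matrix.diagonal_mul, Matrix.map_apply, Matrix.map_apply, mul_e_apply,
      if_pos rfl, (c.ofCP_C_commute _ _).eq]
  · intro i _ hi
    rw [Matrix.scalar_apply, Matrix.diagonal_mul, Matrix.map_apply, mul_e_apply, if_neg hi.symm,
      map_zero, mul_zero]
  · intro h; exact absurd (Finset.mem_univ _) h

theorem sum_v_mul_scalar (v : Matrix (VIndex α) (Fin d) ℂ) :
    ∑ i : ZMod m, (e α i * v).map c.ofC * Matrix.scalar (Fin d) (c.ofCP (c.ε i)) =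
      gr c α 0 * v.map c.ofC := by
  ext1 a β
  rw [Matrix.sum_apply, gr, Matrix.diagonal_mul, add_zero, Finset.sum_eq_single a.1]
  · rw [Matrix.scalar_apply, Matrix.mul_diagonal, Matrix.map_apply, Matrix.map_apply, e_mul_apply,
      if_pos rfl, (c.ofCP_C_commute _ _).eq]
  · intro i _ hi
    rw [Matrix.scalar_apply, Matrix.mul_diagonal, Matrix.map_apply, e_mul_apply, if_neg hi.symm,
      map_zero, zero_mul]
  · intro h; exact absurd (Finset.mem_univ _) h

theorem dressing_eq (p : FramedData α d) :
    p.dressing c = 1 - p.rowW c * p.resX c * p.resY c * p.colV c := by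
  rw [dressing, rowW, colV, ← sum_scalar_mul_w, ← sum_v_mul_scalar, Matrix.sum_mul, Matrix.sum_mul,
    Matrix.sum_mul]
  congr 1
  refine Finset.sum_congr rfl fun i _ => ?_
  rw [Matrix.mul_sum]
  refine Finset.sum_congr rfl fun j _ => ?_
  simp only [Matrix.mul_assoc, wAt, vAt]

theorem opX_mul_gr {p : FramedData α d} (hp : p.IsRep) (r : ZMod m) :
    p.opX c * gr c α r = gr c α (r - 1) * p.opX c := by
  rw [opX, sub_mul, mul_sub, scalar_x_mul_gr, ((isRep_iff p).1 hp).1.map_mul_gr]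

theorem opY_mul_gr {p : FramedData α d} (hp : p.IsRep) (r : ZMod m) :
    p.opY c * gr c α r = gr c α (r + 1) * p.opY c := by
  rw [opY, sub_mul, mul_sub, scalar_y_mul_gr, ((isRep_iff p).1 hp).2.map_mul_gr, sub_neg_eq_add]

theorem map_ofRat_sub_scalar_X (p : FramedData α d) :
    (p.X.map RatFunc.C - Matrix.scalar (VIndex α) RatFunc.X).map c.ofRat = p.opX c := by
  ext1 a b
  by_cases h : a = b
  · subst h; simp [opX, CherednikParameters.ofC]
  · simp [opX, CherednikParameters.ofC, h]

/-- Up to sign, the determinant of `N - x` is the characteristic polynomial of `N`, which is monic. -/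
theorem isUnit_det_sub_scalar_X {n : Type*} [Fintype n] [DecidableEq n] (N : Matrix n n ℂ) :
    IsUnit (N.map RatFunc.C - Matrix.scalar n RatFunc.X).det := by
  have h : N.map RatFunc.C - Matrix.scalar n RatFunc.X =
      -(algebraMap ℂ[X] (RatFunc ℂ)).mapMatrix N.charmatrix := by
    ext a b
    by_cases h : a = b
    · subst h; simp [Matrix.charmatrix]
    · simp [Matrix.charmatrix, h]
  rw [h, Matrix.det_neg, ← RingHom.map_det, isUnit_iff_ne_zero]
  refine mul_ne_zero (pow_ne_zero _ (neg_ne_zero.2 one_ne_zero)) (RatFunc.algebraMap_ne_zero ?_)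
  exact N.charpoly_monic.ne_zero

theorem opX_mul_resX (p : FramedData α d) : p.opX c * p.resX c = 1 := by
  rw [← map_ofRat_sub_scalar_X, resX, ← Matrix.map_mul, Matrix.mul_nonsing_inv _ (isUnit_det_sub_scalar_X _),
    Matrix.map_one _ (map_zero _) (map_one _)]

theorem resX_mul_opX (p : FramedData α d) : p.resX c * p.opX c = 1 := by
  rw [← map_ofRat_sub_scalar_X, resX, ← Matrix.map_mul, Matrix.nonsing_inv_mul _ (isUnit_det_sub_scalar_X _),
    Matrix.map_one _ (map_zero _) (map_one _)]

theorem coeff_ofC_mul (z : ℂ) (u : c.PRing) (n : ℤ) :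
    (c.ofC z * u).coeff n = CrossedProduct.coeffX (RatFunc.C z) * u.coeff n :=
  c.coeff_ofCP_mul _ u n

theorem coeff_resY (p : FramedData α d) (a b : VIndex α) (n : ℤ) :
    (p.resY c a b).coeff n = if n < 0 then
      CrossedProduct.coeffX (RatFunc.C (-(p.Y ^ (-n - 1).toNat) a b)) else 0 := by
  rw [map_neg, map_neg]; rfl

theorem y_mul_resY (p : FramedData α d) (a b : VIndex α) :
    c.y * p.resY c a b = p.resY c a b * c.y := by
  have h : ∀ n, ∃ z : ℂ, (p.resY c a b).coeff n = CrossedProduct.coeffX (RatFunc.C z) := by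
    intro n
    rw [coeff_resY]
    split_ifs
    · exact ⟨_, rfl⟩
    · exact ⟨0, by rw [map_zero, map_zero]⟩
  refine SkewLaurent.ext fun n => ?_
  rw [CherednikParameters.y, SkewLaurent.coeff_mul_y, SkewLaurent.coeff_y_mul]
  obtain ⟨z, hz⟩ := h (n - 1)
  obtain ⟨z', hz'⟩ := h n
  rw [hz, hz']
  have h1 : c.skew.σ (CrossedProduct.coeffX (RatFunc.C z)) = CrossedProduct.coeffX (RatFunc.C z) :=
    CherednikParameters.thetaInv_coeffX _
  have h2 : c.skew.δ (CrossedProduct.coeffX (RatFunc.C z')) = 0 := c.dunklD_C _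
  rw [h1, h2, add_zero]

theorem resY_mul_opY (p : FramedData α d) : p.resY c * p.opY c = 1 := by
  ext1 a b
  refine SkewLaurent.ext fun n => ?_
  -- the coefficients of `-(∑ Y^k y^{-k-1}) (Y - y)` telescope
  have h1 : (p.resY c * p.opY c) a b =
      ∑ x, p.resY c a x * c.ofC (p.Y x b) - p.resY c a b * c.y := by
    rw [opY, mul_sub, Matrix.sub_apply, Matrix.mul_apply, Matrix.scalar_apply, Matrix.mul_diagonal]
    rfl
  have h2 : ∀ x, (p.resY c a x * c.ofC (p.Y x b)).coeff n = if n < 0 then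
      CrossedProduct.coeffX (RatFunc.C (-((p.Y ^ (-n - 1).toNat) a x * p.Y x b))) else 0 := by
    intro x
    rw [← (c.ofC_commute _ _).eq, coeff_ofC_mul, coeff_resY]
    split_ifs
    · rw [← map_mul, ← map_mul, mul_neg, mul_comm]
    · rw [mul_zero]
  have h3 : ((1 : Matrix (VIndex α) (VIndex α) c.PRing) a b).coeff n =
      if n = 0 then CrossedProduct.coeffX (RatFunc.C ((1 : Matrix (VIndex α) (VIndex α) ℂ) a b))
        else 0 := by
    rw [Matrix.one_apply, Matrix.one_apply]
    split_ifs with hab hn hn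
    · rw [SkewLaurent.one_def', SkewLaurent.coeff_monomial, if_pos hn, map_one, map_one]
    · rw [SkewLaurent.one_def', SkewLaurent.coeff_monomial, if_neg hn]
    · rw [map_zero, map_zero]; rfl
    · rfl
  rw [h1, h3, SkewLaurent.coeff_sub, SkewLaurent.coeff_sum, CherednikParameters.y,
    SkewLaurent.coeff_mul_y, coeff_resY, Finset.sum_congr rfl fun x _ => h2 x]
  rcases lt_trichotomy n 0 with hn | hn | hn
  · have h4 : (-(n - 1) - 1).toNat = (-n - 1).toNat + 1 := by omega
    simp only [if_pos hn, if_pos (show n - 1 < 0 by omega), if_neg hn.ne, h4, pow_succ (p.Y),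
      Matrix.mul_apply, ← map_sum, Finset.sum_neg_distrib, sub_self]
  · subst hn
    simp
  · simp only [if_neg (show ¬ n < 0 by omega), if_neg (show ¬ n - 1 < 0 by omega), if_neg hn.ne',
      Finset.sum_const_zero, sub_zero]

/-- The coefficients of `(Y - y)⁻¹` are constants and powers of `Y`, so it commutes with `y` and with `Y`:
the left inverse is a right inverse. -/
theorem opY_mul_resY (p : FramedData α d) : p.opY c * p.resY c = 1 := by
  rw [← resY_mul_opY c p]
  have h1 : Matrix.scalar (VIndex α) c.y * p.resY c = p.resY c * Matrix.scalar (VIndex α) c.y := by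
    ext1 a b
    rw [Matrix.scalar_apply, Matrix.mul_diagonal, Matrix.diagonal_mul, y_mul_resY]
  have h2 : p.Y.map c.ofC * p.resY c = p.resY c * p.Y.map c.ofC := by
    -- both sides have the coefficients of `-∑ Y^{k+1} y^{-k-1}`
    ext1 a b
    refine SkewLaurent.ext fun n => ?_
    rw [Matrix.mul_apply, Matrix.mul_apply, SkewLaurent.coeff_sum, SkewLaurent.coeff_sum]
    simp only [Matrix.map_apply, ← (c.ofC_commute _ (p.resY c _ _)).eq, coeff_ofC_mul, coeff_resY]
    split_ifs
    · simp only [← map_mul, ← map_sum]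
      congr 2
      simp only [mul_neg, Finset.sum_neg_distrib]
      rw [← Matrix.mul_apply, ← pow_succ']
      simp only [mul_comm (p.Y _ b)]
      rw [← Matrix.mul_apply, pow_succ]
    · simp
  rw [opY, sub_mul, mul_sub, h1, h2]

/-- The moment relation together with `x y - y x = ∑ λ_i ε_i`: the commutator of `Y - y` and `X - x`
is of rank `d` on the image of the idempotent `∑ e_i ⊗ ε_i`. -/
theorem gr_mul_commutator {p : FramedData α d} (hp : p.MomentRelation c) :
    gr c α 0 * (p.opY c * p.opX c - p.opX c * p.opY c) = p.colV c * p.rowW c := by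
  rw [momentRelation_iff] at hp
  have h1 : p.opY c * p.opX c - p.opX c * p.opY c =
      (p.Y * p.X - p.X * p.Y).map c.ofC -
        Matrix.scalar (VIndex α) (∑ i : ZMod m, c.ofC (c.lam i) * c.ofCP (c.ε i)) := by
    have h2 : (p.Y * p.X - p.X * p.Y).map c.ofC =
        p.Y.map c.ofC * p.X.map c.ofC - p.X.map c.ofC * p.Y.map c.ofC := by
      rw [Matrix.map_sub _ (map_sub _), Matrix.map_mul, Matrix.map_mul]
    have h3 : ∑ i : ZMod m, c.ofC (c.lam i) * c.ofCP (c.ε i) =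
        c.ofRat RatFunc.X * c.y - c.y * c.ofRat RatFunc.X := by rw [c.y_mul_x]; abel
    rw [h2, h3, map_sub, map_mul, map_mul, opX, opY]
    simp only [sub_mul, mul_sub, c.scalar_mul_map]
    abel
  have h4 : p.Y * p.X - p.X * p.Y = hpart 0 (p.v * p.w) + Matrix.diagonal fun a => c.lam a.1 := by
    rw [← hp]; abel
  -- on the image of the idempotent, `∑ λ_i ε_i` acts as `∑ λ_i e_i`, and only the part of degree `0` of
  -- `v w` survives between two copies of it
  have h5 : gr c α 0 * (Matrix.diagonal fun a : VIndex α => c.lam a.1).map c.ofC =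
      gr c α 0 * Matrix.scalar (VIndex α) (∑ i : ZMod m, c.ofC (c.lam i) * c.ofCP (c.ε i)) := by
    rw [gr, Matrix.diagonal_map (map_zero _), Matrix.scalar_apply, Matrix.diagonal_mul_diagonal,
      Matrix.diagonal_mul_diagonal]
    congr 1
    funext a
    rw [Finset.mul_sum, Finset.sum_eq_single a.1]
    · rw [(c.ofCP_C_commute _ _).eq, add_zero, ← mul_assoc, ← map_mul, c.ε_mul_ε, if_pos rfl]
    · intro i _ hi
      rw [(c.ofCP_C_commute _ _).eq, add_zero, ← mul_assoc, ← map_mul, c.ε_mul_ε, if_neg hi.symm,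
        map_zero, zero_mul]
    · intro h; exact absurd (Finset.mem_univ _) h
  have h6 : gr c α 0 * (hpart 0 (p.v * p.w)).map c.ofC = p.colV c * p.rowW c := by
    rw [colV, rowW, Matrix.mul_assoc, ← Matrix.mul_assoc (p.v.map c.ofC), ← Matrix.map_mul]
    ext1 a b
    rw [gr, Matrix.diagonal_mul, Matrix.diagonal_mul, Matrix.mul_diagonal, Matrix.map_apply,
      Matrix.map_apply, hpart_apply, (c.ofCP_C_commute _ (c.ε (b.1 + 0))).eq, ← mul_assoc,
      ← map_mul, c.ε_mul_ε]
    simp only [add_zero]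
    by_cases h : a.1 = b.1
    · rw [if_pos h, if_pos h]
    · rw [if_neg h, if_neg h, map_zero, mul_zero, map_zero, zero_mul]
  rw [h1, mul_sub, ← h5, ← h6, h4, Matrix.map_add _ (map_add _), mul_add, add_sub_cancel_right]

end Graded
end FramedData

/-! ### The inverse of the dressing -/

theorem mul_commutator_mul_of_inverse {R : Type*} [Ring R] {a a' b b' : R} (h1 : a * a' = 1)
    (h2 : a' * a = 1) (h3 : b * b' = 1) (h4 : b' * b = 1) :
    b' * a' * (b * a - a * b) * (a' * b') = b' * a' - a' * b' := by
  have h5 : b * a * (a' * b') = 1 := by rw [mul_assoc, ← mul_assoc a, h1, one_mul, h3]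
  have h6 : b' * a' * (a * b) = 1 := by rw [mul_assoc, ← mul_assoc a', h2, one_mul, h4]
  rw [mul_sub, sub_mul, mul_assoc (b' * a') (b * a), h5, h6, mul_one, one_mul]

namespace FramedData
variable {m : ℕ} [NeZero m] {α : ZMod m → ℕ} {d : ℕ} (c : CherednikParameters m)

theorem gr_mul_resX {p : FramedData α d} (hp : p.IsRep) (r : ZMod m) :
    gr c α r * p.resX c = p.resX c * gr c α (r - 1) := by
  have h := congrArg (fun Z => p.resX c * Z * p.resX c) (opX_mul_gr c hp r)
  simp only [← Matrix.mul_assoc, resX_mul_opX, Matrix.one_mul] at h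
  rw [h, Matrix.mul_assoc, opX_mul_resX, Matrix.mul_one]

theorem gr_mul_resY {p : FramedData α d} (hp : p.IsRep) (r : ZMod m) :
    gr c α r * p.resY c = p.resY c * gr c α (r + 1) := by
  have h := congrArg (fun Z => p.resY c * Z * p.resY c) (opY_mul_gr c hp r)
  simp only [← Matrix.mul_assoc, resY_mul_opY, Matrix.one_mul] at h
  rw [h, Matrix.mul_assoc, opY_mul_resY, Matrix.mul_one]

theorem gr_mul_resX_mul_resY {p : FramedData α d} (hp : p.IsRep) :
    gr c α 0 * (p.resX c * p.resY c) = p.resX c * p.resY c * gr c α 0 := by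
  rw [← Matrix.mul_assoc, gr_mul_resX c hp, Matrix.mul_assoc, gr_mul_resY c hp, sub_add_cancel,
    Matrix.mul_assoc]

theorem gr_mul_resY_mul_resX {p : FramedData α d} (hp : p.IsRep) :
    gr c α 0 * (p.resY c * p.resX c) = p.resY c * p.resX c * gr c α 0 := by
  rw [← Matrix.mul_assoc, gr_mul_resY c hp, Matrix.mul_assoc, gr_mul_resX c hp, add_sub_cancel_right,
    Matrix.mul_assoc]

theorem gr_mul_colV (p : FramedData α d) : gr c α 0 * p.colV c = p.colV c := by
  rw [colV, ← Matrix.mul_assoc, gr_mul_self]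

theorem rowW_mul_gr (p : FramedData α d) : p.rowW c * gr c α 0 = p.rowW c := by
  rw [rowW, Matrix.mul_assoc, gr_mul_self]

/-- `B⁻¹ A⁻¹ V W A⁻¹ B⁻¹ V = B⁻¹ A⁻¹ V - A⁻¹ B⁻¹ V` for `A = X - x`, `B = Y - y`. -/
theorem resY_resX_colV_rowW {p : FramedData α d} (hp : p.IsRep) (hm : p.MomentRelation c) :
    p.resY c * p.resX c * p.colV c * p.rowW c * (p.resX c * p.resY c) * p.colV c =
      p.resY c * p.resX c * p.colV c - p.resX c * p.resY c * p.colV c := by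
  have h := mul_commutator_mul_of_inverse (opX_mul_resX c p) (resX_mul_opX c p) (opY_mul_resY c p)
    (resY_mul_opY c p)
  rw [Matrix.mul_assoc _ (p.colV c) (p.rowW c), ← gr_mul_commutator c hm, ← Matrix.mul_assoc _ (gr c α 0),
    ← gr_mul_resY_mul_resX c hp, Matrix.mul_assoc (gr c α 0), Matrix.mul_assoc (gr c α 0), h, mul_sub,
    gr_mul_resY_mul_resX c hp, gr_mul_resX_mul_resY c hp, ← sub_mul, Matrix.mul_assoc, gr_mul_colV,
    Matrix.sub_mul]

theorem resX_resY_colV_rowW {p : FramedData α d} (hp : p.IsRep) (hm : p.MomentRelation c) :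
    p.resX c * p.resY c * p.colV c * p.rowW c * (p.resY c * p.resX c) * p.colV c =
      p.resY c * p.resX c * p.colV c - p.resX c * p.resY c * p.colV c := by
  have h := mul_commutator_mul_of_inverse (opY_mul_resY c p) (resY_mul_opY c p) (opX_mul_resX c p)
    (resX_mul_opX c p)
  have h' : p.resX c * p.resY c * (p.opY c * p.opX c - p.opX c * p.opY c) * (p.resY c * p.resX c) =
      p.resY c * p.resX c - p.resX c * p.resY c := by
    rw [← neg_sub (p.opX c * p.opY c), mul_neg, neg_mul, h, neg_sub]
  rw [Matrix.mul_assoc _ (p.colV c) (p.rowW c), ← gr_mul_commutator c hm, ← Matrix.mul_assoc _ (gr c α 0),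
    ← gr_mul_resX_mul_resY c hp, Matrix.mul_assoc (gr c α 0), Matrix.mul_assoc (gr c α 0), h', mul_sub,
    gr_mul_resY_mul_resX c hp, gr_mul_resX_mul_resY c hp, ← sub_mul, Matrix.mul_assoc, gr_mul_colV,
    Matrix.sub_mul]

/-- The inverse `1 + ∑ ε_i w_i (Y - y)⁻¹ (X - x)⁻¹ v_j ε_j` of the dressing. -/
def dressingInv (p : FramedData α d) : PMat c d :=
  1 + p.rowW c * p.resY c * p.resX c * p.colV c

theorem dressing_mul_dressingInv {p : FramedData α d} (hp : p.IsRep) (hm : p.MomentRelation c) :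
    p.dressing c * p.dressingInv c = 1 := by
  have h := congrArg (fun Z => p.rowW c * Z) (resX_resY_colV_rowW c hp hm)
  simp only [Matrix.mul_sub, ← Matrix.mul_assoc] at h
  rw [dressing_eq, dressingInv]
  simp only [sub_mul, mul_add, mul_one, one_mul, ← Matrix.mul_assoc]
  rw [h]
  abel

theorem dressingInv_mul_dressing {p : FramedData α d} (hp : p.IsRep) (hm : p.MomentRelation c) :
    p.dressingInv c * p.dressing c = 1 := by
  have h := congrArg (fun Z => p.rowW c * Z) (resY_resX_colV_rowW c hp hm)
  simp only [Matrix.mul_sub, ← Matrix.mul_assoc] at h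
  rw [dressing_eq, dressingInv]
  simp only [mul_sub, add_mul, mul_one, one_mul, ← Matrix.mul_assoc]
  rw [h]
  abel

theorem isUnit_dressing {p : FramedData α d} (hp : p.IsRep) (hm : p.MomentRelation c) :
    IsUnit (p.dressing c) :=
  ⟨⟨p.dressing c, p.dressingInv c, dressing_mul_dressingInv c hp hm, dressingInv_mul_dressing c hp hm⟩, rfl⟩

theorem inverse_dressing {p : FramedData α d} (hp : p.IsRep) (hm : p.MomentRelation c) :
    Ring.inverse (p.dressing c) = p.dressingInv c :=
  Ring.inverse_unit
    ⟨p.dressing c, p.dressingInv c, dressing_mul_dressingInv c hp hm, dressingInv_mul_dressing c hp hm⟩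

theorem laxPair_eq {p : FramedData α d} (hp : p.IsRep) (hm : p.MomentRelation c) :
    p.laxPair c = (p.dressing c * Matrix.scalar (Fin d) c.y * p.dressingInv c,
      fun β => p.dressing c * PMat.E β * p.dressingInv c) := by
  rw [laxPair, inverse_dressing c hp hm]

end FramedData

/-! ### Order of a matrix over `𝒫` -/

/-- All powers of `y` in the entries of `N` are at most `l`. -/
def MatBdd {m : ℕ} [NeZero m] {c : CherednikParameters m} {p q : Type*} (l : ℤ)
    (N : Matrix p q c.PRing) : Prop := ∀ i j, SkewLaurent.BddBy (N i j) l

/-- No negative powers of `y` occur in the entries of `N`. -/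
def MatNonneg {m : ℕ} [NeZero m] {c : CherednikParameters m} {p q : Type*}
    (N : Matrix p q c.PRing) : Prop := ∀ i j, ∀ n : ℤ, n < 0 → (N i j).coeff n = 0

section Order
variable {m : ℕ} [NeZero m] {c : CherednikParameters m} {p q r : Type*} {l k : ℤ}

theorem SkewLaurent.BddBy.sum {A : Type} [Ring A] {S : SkewDerivation A} {ι : Type*} {s : Finset ι}
    {f : ι → SkewLaurent S} (h : ∀ i ∈ s, (f i).BddBy l) : (∑ i ∈ s, f i).BddBy l := fun n hn => by
  rw [SkewLaurent.coeff_sum]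
  exact Finset.sum_eq_zero fun i hi => h i hi n hn

theorem MatBdd.add {N P : Matrix p q c.PRing} (hN : MatBdd l N) (hP : MatBdd l P) :
    MatBdd l (N + P) := fun i j => (hN i j).add (hP i j)

theorem MatBdd.neg {N : Matrix p q c.PRing} (hN : MatBdd l N) : MatBdd l (-N) :=
  fun i j n hn => by
    rw [Matrix.neg_apply, SkewLaurent.coeff_neg, hN i j n hn, neg_zero]

theorem MatBdd.sub {N P : Matrix p q c.PRing} (hN : MatBdd l N) (hP : MatBdd l P) :
    MatBdd l (N - P) := by
  rw [sub_eq_add_neg]; exact hN.add hP.neg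

theorem MatBdd.mono {N : Matrix p q c.PRing} (hN : MatBdd l N) (h : l ≤ k) : MatBdd k N :=
  fun i j => (hN i j).mono h

theorem MatBdd.mul [Fintype q] {N : Matrix p q c.PRing} {P : Matrix q r c.PRing} (hN : MatBdd l N)
    (hP : MatBdd k P) : MatBdd (l + k) (N * P) := fun i j => by
  rw [Matrix.mul_apply]
  exact SkewLaurent.BddBy.sum fun x _ => (hN i x).mul (hP x j)

theorem bddBy_ofCP (a : CrossedProduct m) : SkewLaurent.BddBy (c.ofCP a) 0 := fun n hn => by
  exact (SkewLaurent.coeff_monomial a 0 n).trans (if_neg hn.ne')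

theorem matBdd_map_ofC (N : Matrix p q ℂ) : MatBdd 0 (N.map c.ofC) := fun _ _ => bddBy_ofCP _

theorem matBdd_map_ofRat (N : Matrix p q (RatFunc ℂ)) : MatBdd 0 (N.map c.ofRat) :=
  fun _ _ => bddBy_ofCP _

theorem matBdd_diagonal [DecidableEq p] {f : p → c.PRing} (h : ∀ i, (f i).BddBy l) :
    MatBdd l (Matrix.diagonal f) := fun i j => by
  by_cases hij : i = j
  · subst hij; rw [Matrix.diagonal_apply_eq]; exact h i
  · rw [Matrix.diagonal_apply_ne _ hij]; exact fun _ _ => rfl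

theorem matBdd_gr (α : ZMod m → ℕ) (r : ZMod m) : MatBdd 0 (FramedData.gr c α r) :=
  matBdd_diagonal fun _ => bddBy_ofCP _

theorem matBdd_one [DecidableEq p] : MatBdd 0 (1 : Matrix p p c.PRing) :=
  matBdd_diagonal fun _ => bddBy_ofCP 1

theorem matBdd_scalar_y [DecidableEq p] [Fintype p] : MatBdd 1 (Matrix.scalar p c.y) :=
  matBdd_diagonal fun _ n hn => (SkewLaurent.coeff_monomial 1 1 n).trans (if_neg hn.ne')

theorem MatNonneg.add {N P : Matrix p q c.PRing} (hN : MatNonneg N) (hP : MatNonneg P) :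
    MatNonneg (N + P) := fun i j n hn => by
  rw [Matrix.add_apply, SkewLaurent.coeff_add, hN i j n hn, hP i j n hn, add_zero]

theorem MatNonneg.sub {N P : Matrix p q c.PRing} (hN : MatNonneg N) (hP : MatNonneg P) :
    MatNonneg (N - P) := fun i j n hn => by
  rw [Matrix.sub_apply, SkewLaurent.coeff_sub, hN i j n hn, hP i j n hn, sub_zero]

theorem MatNonneg.sum {ι : Type*} {s : Finset ι} {f : ι → Matrix p q c.PRing}
    (h : ∀ i ∈ s, MatNonneg (f i)) : MatNonneg (∑ i ∈ s, f i) := fun i j n hn => by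
  rw [Matrix.sum_apply, SkewLaurent.coeff_sum]
  exact Finset.sum_eq_zero fun x hx => h x hx i j n hn

theorem coeff_lmulYPow_nonneg {u : c.PRing} (hu : ∀ n : ℤ, n < 0 → u.coeff n = 0) (j : ℕ) (n : ℤ)
    (hn : n < 0) : (SkewLaurent.lmulYPow (j : ℤ) u).coeff n = 0 := by
  induction j generalizing n with
  | zero => rw [Nat.cast_zero, SkewLaurent.lmulYPow_zero]; exact hu n hn
  | succ j ih =>
    rw [Nat.cast_succ, SkewLaurent.lmulYPow_add_one, SkewLaurent.coeff_lmulY, ih n hn,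
      ih (n - 1) (by omega), map_zero, map_zero, add_zero]

theorem MatNonneg.mul [Fintype q] {N : Matrix p q c.PRing} {P : Matrix q r c.PRing}
    (hN : MatNonneg N) (hP : MatNonneg P) : MatNonneg (N * P) := fun i j n hn => by
  rw [Matrix.mul_apply, SkewLaurent.coeff_sum]
  refine Finset.sum_eq_zero fun x _ => ?_
  rw [SkewLaurent.coeff_mul]
  refine finsum_eq_zero_of_forall_eq_zero fun b => ?_
  rcases lt_or_ge b 0 with hb | hb
  · rw [hN i x b hb, zero_mul]
  · lift b to ℕ using hb
    rw [coeff_lmulYPow_nonneg (hP x j) b n hn, mul_zero]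

theorem coeff_ofCP_neg (a : CrossedProduct m) (n : ℤ) (hn : n < 0) : (c.ofCP a).coeff n = 0 :=
  (SkewLaurent.coeff_monomial a 0 n).trans (if_neg hn.ne)

theorem matNonneg_map_ofC (N : Matrix p q ℂ) : MatNonneg (N.map c.ofC) :=
  fun _ _ => coeff_ofCP_neg _

theorem matNonneg_map_ofRat (N : Matrix p q (RatFunc ℂ)) : MatNonneg (N.map c.ofRat) :=
  fun _ _ => coeff_ofCP_neg _

theorem matNonneg_diagonal [DecidableEq p] {f : p → c.PRing}
    (h : ∀ i, ∀ n : ℤ, n < 0 → (f i).coeff n = 0) : MatNonneg (Matrix.diagonal f) := fun i j => by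
  by_cases hij : i = j
  · subst hij; rw [Matrix.diagonal_apply_eq]; exact h i
  · rw [Matrix.diagonal_apply_ne _ hij]; exact fun _ _ => rfl

theorem matNonneg_gr (α : ZMod m → ℕ) (r : ZMod m) : MatNonneg (FramedData.gr c α r) :=
  matNonneg_diagonal fun _ => coeff_ofCP_neg _

theorem MatNonneg.pow [DecidableEq p] [Fintype p] {N : Matrix p p c.PRing} (hN : MatNonneg N) (k : ℕ) :
    MatNonneg (N ^ k) := by
  induction k with
  | zero => rw [pow_zero]; exact matNonneg_diagonal fun _ => coeff_ofCP_neg 1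
  | succ k ih => rw [pow_succ]; exact ih.mul hN

theorem matNonneg_scalar_y [DecidableEq p] [Fintype p] : MatNonneg (Matrix.scalar p c.y) :=
  matNonneg_diagonal fun _ n hn => (SkewLaurent.coeff_monomial 1 1 n).trans (if_neg (by omega))

theorem posPart_eq_of_add {d : ℕ} {S P N : PMat c d} (h : S = P + N) (hP : MatNonneg P)
    (hN : MatBdd (-1) N) : PMat.posPart S = P := by
  subst h
  ext1 i j
  refine SkewLaurent.ext fun n => ?_
  change (if 0 ≤ n then (P i j).coeff n + (N i j).coeff n else 0) = _
  split_ifs with hn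
  · rw [hN i j n (by omega), add_zero]
  · rw [hP i j n (by omega)]

end Order

/-! ### The Lax pair is a point of the hierarchy -/

theorem CrossedProduct.coeff_theta {m : ℕ} (n : ℤ) (u : CrossedProduct m) (g : CyclicGroup m) :
    (CrossedProduct.theta n u).coeff g =
      RatFunc.C (((CyclicGroup.toCUnits g) ^ n : ℂˣ) : ℂ) * u.coeff g := by
  classical
  induction u using SkewMonoidAlgebra.induction_on with
  | zero => simp
  | single h f =>
    rw [CrossedProduct.theta_single, SkewMonoidAlgebra.coeff_single_apply,
      SkewMonoidAlgebra.coeff_single_apply]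
    split_ifs with hg
    · rw [hg]
    · rw [mul_zero]
  | add u w hu hw =>
    rw [map_add, SkewMonoidAlgebra.coeff_add, SkewMonoidAlgebra.coeff_add, Finsupp.add_apply,
      Finsupp.add_apply, hu, hw, mul_add]

namespace FramedData
variable {m : ℕ} [NeZero m] {α : ZMod m → ℕ} {d : ℕ} (c : CherednikParameters m)

theorem matBdd_resX (p : FramedData α d) : MatBdd 0 (p.resX c) := matBdd_map_ofRat _

theorem matBdd_resY (p : FramedData α d) : MatBdd (-1) (p.resY c) := fun a b n hn => by
  rw [coeff_resY, if_neg (by omega)]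

theorem matBdd_colV (p : FramedData α d) : MatBdd 0 (p.colV c) :=
  (matBdd_gr α 0).mul (matBdd_map_ofC _)

theorem matBdd_rowW (p : FramedData α d) : MatBdd 0 (p.rowW c) :=
  (matBdd_map_ofC _).mul (matBdd_gr α 0)

theorem matBdd_dressing_sub_one (p : FramedData α d) : MatBdd (-1) (p.dressing c - 1) := by
  rw [dressing_eq, sub_sub_cancel_left]
  exact ((((matBdd_rowW c p).mul (matBdd_resX c p)).mul (matBdd_resY c p)).mul (matBdd_colV c p)).neg

theorem matBdd_dressingInv_sub_one (p : FramedData α d) : MatBdd (-1) (p.dressingInv c - 1) := by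
  rw [dressingInv, add_sub_cancel_left]
  exact (((matBdd_rowW c p).mul (matBdd_resY c p)).mul (matBdd_resX c p)).mul (matBdd_colV c p)

theorem matBdd_E (β : Fin d) : MatBdd 0 (PMat.E β : PMat c d) := by
  intro i j n hn
  rw [PMat.E, Matrix.single_apply]
  split_ifs
  · exact bddBy_ofCP 1 n hn
  · rfl

theorem E_commute_scalar (β : Fin d) (u : c.PRing) :
    (PMat.E β : PMat c d) * Matrix.scalar (Fin d) u = Matrix.scalar (Fin d) u * PMat.E β := by
  ext1 i j
  rw [Matrix.scalar_apply, Matrix.mul_diagonal, Matrix.diagonal_mul, PMat.E, Matrix.single_apply]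
  split_ifs <;> simp

theorem conj_mul_conj {R : Type*} [Ring R] {M M' : R} (h : M' * M = 1) (a b : R) :
    M * a * M' * (M * b * M') = M * (a * b) * M' := by
  rw [mul_assoc (M * a), ← mul_assoc M', ← mul_assoc M', h, one_mul]
  simp only [mul_assoc]

/-- The coefficient of `y⁰` in `M y M⁻¹ - y`, for `M` and `M⁻¹` of the form `1 + O(y⁻¹)`. -/
theorem coeff_zero_conj_y {M M' : PMat c d} (h : M * M' = 1) (hM : MatBdd (-1) (M - 1))
    (hM' : MatBdd (-1) (M' - 1)) (a b : Fin d) :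
    ((M * Matrix.scalar (Fin d) c.y * M' - Matrix.scalar (Fin d) c.y) a b).coeff 0 =
      CrossedProduct.thetaInv (((M' - 1) a b).coeff (-1)) - ((M' - 1) a b).coeff (-1) := by
  set N := M - 1
  set N' := M' - 1
  have e1 : M = 1 + N := (add_sub_cancel _ _).symm
  have e2 : M' = 1 + N' := (add_sub_cancel _ _).symm
  set Yd := Matrix.scalar (Fin d) c.y
  have h1 : M * Yd * M' - Yd = Yd * N' + N * Yd + N * Yd * N' := by
    rw [e1, e2]; noncomm_ring
  have h2 : N = -N' - N * N' := by
    rw [e1, e2, add_mul, one_mul, mul_add, mul_one] at h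
    have : 1 + N' + (N + N * N') - 1 = 0 := sub_eq_zero.2 h
    have h3 : N = -N' - N * N' + (1 + N' + (N + N * N') - 1) := by abel
    rwa [this, add_zero] at h3
  have h3 : ((N * Yd * N') a b).coeff 0 = 0 :=
    ((hM.mul matBdd_scalar_y).mul hM') a b 0 (by norm_num)
  have h4 : (N a b).coeff (-1) = -(N' a b).coeff (-1) := by
    have h5 : ((N * N') a b).coeff (-1) = 0 := (hM.mul hM') a b (-1) (by norm_num)
    conv_lhs => rw [h2]
    rw [Matrix.sub_apply, SkewLaurent.coeff_sub, h5, sub_zero, Matrix.neg_apply, SkewLaurent.coeff_neg]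
  have h5 : ((Yd * N') a b).coeff 0 = CrossedProduct.thetaInv ((N' a b).coeff (-1)) := by
    simp only [Yd]
    rw [Matrix.scalar_apply, Matrix.diagonal_mul, CherednikParameters.y, SkewLaurent.coeff_y_mul,
      hM' a b 0 (by norm_num), map_zero, add_zero]
    rfl
  have h6 : ((N * Yd) a b).coeff 0 = (N a b).coeff (-1) := by
    simp only [Yd]
    rw [Matrix.scalar_apply, Matrix.mul_diagonal, CherednikParameters.y, SkewLaurent.coeff_mul_y]
    rfl
  rw [h1, Matrix.add_apply, Matrix.add_apply, SkewLaurent.coeff_add, SkewLaurent.coeff_add, h3, h5, h6,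
    h4, add_zero, sub_eq_add_neg]

theorem isHierarchyPoint_laxPair {p : FramedData α d} (hp : p.IsRep) (hm : p.MomentRelation c) :
    IsHierarchyPoint (p.laxPair c) := by
  have hMM := dressing_mul_dressingInv c hp hm
  have hMM' := dressingInv_mul_dressing c hp hm
  have hM := matBdd_dressing_sub_one c p
  have hM' := matBdd_dressingInv_sub_one c p
  rw [laxPair_eq c hp hm]
  generalize p.dressing c = M at *
  generalize p.dressingInv c = M' at *
  have e1 : M = 1 + (M - 1) := (add_sub_cancel _ _).symm
  have e2 : M' = 1 + (M' - 1) := (add_sub_cancel _ _).symm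
  have hconj : ∀ (U : PMat c d) (l : ℤ), MatBdd l U → MatBdd (l - 1) (M * U * M' - U) := by
    intro U l hU
    have h1 : M * U * M' - U = U * (M' - 1) + (M - 1) * U + (M - 1) * U * (M' - 1) := by noncomm_ring
    rw [h1]
    refine ((hU.mul hM').add ((hM.mul hU).mono (by omega))).add (((hM.mul hU).mul hM').mono (by omega))
  have hY : ∀ (a b : Fin d) (n : ℤ), (Matrix.scalar (Fin d) c.y a b).coeff n =
      if n = 1 ∧ a = b then 1 else 0 := by
    intro a b n
    rw [Matrix.scalar_apply, Matrix.diagonal_apply]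
    by_cases hab : a = b
    · rw [if_pos hab, CherednikParameters.y, SkewLaurent.coeff_monomial]; simp [hab]
    · simp [hab]
  refine ⟨?_, ?_, ?_, ?_, ?_, ?_, ?_⟩
  · intro a b n hn
    have h := hconj _ _ matBdd_scalar_y a b n (by omega)
    rw [Matrix.sub_apply, SkewLaurent.coeff_sub, sub_eq_zero] at h
    rw [← hY]; exact h
  · intro β a b n hn
    have h := hconj _ _ (matBdd_E c β) a b n (by omega)
    rw [Matrix.sub_apply, SkewLaurent.coeff_sub, sub_eq_zero] at h
    refine h.trans ?_
    rw [PMat.E, Matrix.single_apply]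
    by_cases hab : β = a ∧ β = b
    · rw [if_pos hab, SkewLaurent.one_def', SkewLaurent.coeff_monomial]
      simp [← hab.1, ← hab.2]
    · rw [if_neg hab, if_neg fun h' => hab ⟨h'.2.1.symm, h'.2.2.symm⟩]; rfl
  · intro β
    change M * _ * M' * (M * _ * M') = M * _ * M' * (M * _ * M')
    rw [conj_mul_conj hMM', conj_mul_conj hMM', E_commute_scalar]
  · intro β
    change M * _ * M' * (M * _ * M') = M * _ * M'
    rw [conj_mul_conj hMM', PMat.E, Matrix.single_mul_single_same, one_mul]
  · intro β γ h
    change M * _ * M' * (M * _ * M') = 0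
    rw [conj_mul_conj hMM', PMat.E, PMat.E, Matrix.single_mul_single_of_ne _ _ _ _ h, mul_zero, zero_mul]
  · change ∑ β, M * PMat.E β * M' = 1
    have h : ∑ β : Fin d, (PMat.E β : PMat c d) = 1 := Matrix.sum_single_one
    rw [← Finset.sum_mul, ← Finset.mul_sum, h, mul_one, hMM]
  · intro a
    have h := coeff_zero_conj_y c hMM hM hM' a a
    rw [Matrix.sub_apply, SkewLaurent.coeff_sub, hY, if_neg (by simp), sub_zero] at h
    change ((_ : CrossedProduct m)).coeff 1 = 0
    rw [h, SkewMonoidAlgebra.coeff_sub, Finsupp.sub_apply]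
    -- `θ` multiplies the coefficient at `s^r` by `μ^r`, so it fixes the coefficient at the identity
    have h2 : ∀ u : CrossedProduct m, (CrossedProduct.thetaInv u).coeff 1 = u.coeff 1 := by
      intro u
      change (CrossedProduct.theta (-1) u).coeff 1 = _
      rw [CrossedProduct.coeff_theta]; simp
    rw [h2, sub_self]

/-! ### The nonnegative part of `L^k R_β` -/

/-- `∑_{a<k} Y^a v E_β w Y^{k-a-1}`. Up to sign, its component of degree `1` is the velocity of `X` under
the flow of `H_{k,β}`. -/
def flowK (k : ℕ) (β : Fin d) (p : FramedData α d) : Matrix (VIndex α) (VIndex α) ℂ :=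
  ∑ a ∈ Finset.range k,
    p.Y ^ a * (p.v * Matrix.single β β (1 : ℂ) * p.w) * p.Y ^ (k - 1 - a)

/-- `∑_{a<k} Y^a y^{k-1-a}`, the quotient of `Y^k - y^k` by `Y - y`. -/
def geomY (k : ℕ) (p : FramedData α d) : Matrix (VIndex α) (VIndex α) c.PRing :=
  ∑ a ∈ Finset.range k, p.Y.map c.ofC ^ a * Matrix.scalar (VIndex α) c.y ^ (k - 1 - a)

/-- The matrix unit `E_β` over `𝒫`; this is `PMat.E β`. -/
def unitE (β : Fin d) : Matrix (Fin d) (Fin d) c.PRing := Matrix.single β β 1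

theorem commute_Y_y (p : FramedData α d) :
    Commute (p.Y.map c.ofC) (Matrix.scalar (VIndex α) c.y) := (c.scalar_mul_map _ _).symm

theorem resY_mul_y_pow (p : FramedData α d) (k : ℕ) :
    p.resY c * Matrix.scalar (VIndex α) c.y ^ k = p.resY c * p.Y.map c.ofC ^ k - p.geomY c k := by
  have h := (commute_Y_y c p).mul_geom_sum₂ k
  have h2 := congrArg (fun Z => p.resY c * Z) h
  simp only [← Matrix.mul_assoc] at h2
  have h3 : p.resY c * (p.Y.map c.ofC - Matrix.scalar (VIndex α) c.y) = 1 := resY_mul_opY c p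
  rw [h3, Matrix.one_mul, mul_sub] at h2
  rw [geomY, h2]
  abel

theorem y_pow_mul_resY (p : FramedData α d) (k : ℕ) :
    Matrix.scalar (VIndex α) c.y ^ k * p.resY c = p.Y.map c.ofC ^ k * p.resY c - p.geomY c k := by
  have h := (commute_Y_y c p).geom_sum₂_mul k
  have h2 := congrArg (fun Z => Z * p.resY c) h
  simp only [Matrix.mul_assoc] at h2
  have h3 : (p.Y.map c.ofC - Matrix.scalar (VIndex α) c.y) * p.resY c = 1 := opY_mul_resY c p
  rw [h3, Matrix.mul_one, sub_mul] at h2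
  rw [geomY, h2]
  abel

theorem Y_pow_mul_gr {p : FramedData α d} (hp : p.IsRep) (k : ℕ) (r : ZMod m) :
    p.Y.map c.ofC ^ k * gr c α r = gr c α (r + k) * p.Y.map c.ofC ^ k := by
  induction k with
  | zero => simp
  | succ k ih =>
    rw [pow_succ', Matrix.mul_assoc, ih, ← Matrix.mul_assoc, ((isRep_iff p).1 hp).2.map_mul_gr,
      Matrix.mul_assoc]
    congr 2
    push_cast; ring

theorem scalar_pow_mul_map {p q : Type*} [Fintype p] [Fintype q] [DecidableEq p] [DecidableEq q]
    (k : ℕ) (N : Matrix p q ℂ) :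
    Matrix.scalar p c.y ^ k * N.map c.ofC = N.map c.ofC * Matrix.scalar q c.y ^ k := by
  rw [← map_pow, ← map_pow, c.scalar_mul_map]

/-- In `(Y - y)⁻¹ V y^k` one may replace `y^k` by `Y^k` up to a term without negative powers of `y`. The
index `-k` appears because `y^k` shifts the idempotents `ε_i` by `k`. -/
theorem resY_mul_colV_mul_y_pow {p : FramedData α d} (hp : p.IsRep) (k : ℕ) :
    p.resY c * (p.colV c * Matrix.scalar (Fin d) c.y ^ k) =
      p.resY c * (gr c α 0 * (p.Y.map c.ofC ^ k * p.v.map c.ofC)) -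
        p.geomY c k * (gr c α (-k) * p.v.map c.ofC) := by
  have h1 : p.colV c * Matrix.scalar (Fin d) c.y ^ k =
      Matrix.scalar (VIndex α) c.y ^ k * (gr c α (-k) * p.v.map c.ofC) := by
    rw [colV, Matrix.mul_assoc, ← scalar_pow_mul_map, ← Matrix.mul_assoc, ← Matrix.mul_assoc,
      scalar_y_pow_mul_gr, neg_add_cancel]
  have h2 := Y_pow_mul_gr c hp k (-k)
  rw [neg_add_cancel] at h2
  rw [h1, ← Matrix.mul_assoc, resY_mul_y_pow, Matrix.sub_mul, ← Matrix.mul_assoc (gr c α 0), ← h2]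
  simp only [Matrix.mul_assoc]

/-- In `y^k W (Y - y)⁻¹` one may replace `y^k` by `Y^k` up to a term without negative powers of `y`. -/
theorem y_pow_mul_rowW_mul_resY {p : FramedData α d} (hp : p.IsRep) (k : ℕ) :
    Matrix.scalar (Fin d) c.y ^ k * (p.rowW c * p.resY c) =
      p.w.map c.ofC * (p.Y.map c.ofC ^ k * (gr c α 0 * p.resY c)) -
        p.w.map c.ofC * (gr c α k * p.geomY c k) := by
  have h2 := Y_pow_mul_gr c hp k 0
  have h3 := scalar_y_pow_mul_gr c (α := α) 0 k
  rw [zero_add] at h2 h3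
  have h1 : Matrix.scalar (Fin d) c.y ^ k * (p.rowW c * p.resY c) =
      p.w.map c.ofC * (gr c α k * (Matrix.scalar (VIndex α) c.y ^ k * p.resY c)) := by
    rw [rowW, ← Matrix.mul_assoc, ← Matrix.mul_assoc, scalar_pow_mul_map, Matrix.mul_assoc (p.w.map _),
      h3]
    simp only [Matrix.mul_assoc]
  rw [h1, y_pow_mul_resY, ← Matrix.mul_assoc (p.Y.map c.ofC ^ k), h2]
  simp only [Matrix.mul_assoc, mul_sub, Matrix.mul_sub]

theorem unitE_eq_map (β : Fin d) : unitE c β = (Matrix.single β β (1 : ℂ)).map c.ofC := by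
  rw [Matrix.map_single, map_one]; rfl

/-- Cutting with the idempotents from both sides extracts the component of degree `1`. -/
theorem gr_mul_map_mul_gr (N : Matrix (VIndex α) (VIndex α) ℂ) :
    gr c α (-1) * N.map c.ofC * gr c α 0 = gr c α (-1) * (hpart 1 N).map c.ofC := by
  ext1 a b
  rw [gr, gr, Matrix.mul_diagonal, Matrix.diagonal_mul, Matrix.diagonal_mul, Matrix.map_apply,
    Matrix.map_apply, hpart_apply, (c.ofCP_C_commute _ _).eq.symm, mul_assoc, ← map_mul, c.ε_mul_ε]
  by_cases h : a.1 = b.1 + 1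
  · rw [if_pos h, if_pos (by rw [h]; ring), (c.ofCP_C_commute _ _).eq]
  · rw [if_neg h, if_neg (fun h' => h (by rw [add_zero] at h'; rw [← h']; ring)), map_zero, mul_zero,
      map_zero, mul_zero]

/-- The nonnegative remainder in `geomY_mul`. -/
def remY (k : ℕ) (β : Fin d) (p : FramedData α d) : Matrix (VIndex α) (VIndex α) c.PRing :=
  ∑ a ∈ Finset.range k, p.Y.map c.ofC ^ a * (gr c α (-1 - a) * (p.v.map c.ofC * (unitE c β *
    (p.w.map c.ofC * (gr c α ((k - 1 - a : ℕ) : ZMod m) * p.geomY c (k - 1 - a))))))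

/-- In the product of the nonnegative part `∑_a Y^a y^{k-1-a}` with `v E_β w (Y - y)⁻¹`, replacing the
remaining powers of `y` by powers of `Y` produces the velocity of `X` up to sign; the error is a
term without negative powers of `y`. -/
theorem geomY_mul {p : FramedData α d} (hp : p.IsRep) (k : ℕ) (β : Fin d) :
    p.geomY c k * (gr c α (-k) * p.v.map c.ofC) * (unitE c β * (p.rowW c * p.resY c)) =
      gr c α (-1) * (hpart 1 (flowK k β p)).map c.ofC * p.resY c - p.remY c k β := by
  rw [← gr_mul_map_mul_gr, geomY, remY, flowK, Matrix.sum_mul, Matrix.sum_mul]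
  have h0 : (∑ a ∈ Finset.range k, p.Y ^ a * (p.v * Matrix.single β β (1 : ℂ) * p.w) *
      p.Y ^ (k - 1 - a)).map c.ofC = ∑ a ∈ Finset.range k, p.Y.map c.ofC ^ a * (p.v.map c.ofC *
        (unitE c β * (p.w.map c.ofC * p.Y.map c.ofC ^ (k - 1 - a)))) := by
    have h00 : ∀ N : Matrix (VIndex α) (VIndex α) ℂ, N.map c.ofC = c.ofC.mapMatrix N := fun _ => rfl
    rw [h00, map_sum]
    refine Finset.sum_congr rfl fun a _ => ?_
    rw [map_mul, map_mul, map_pow, map_pow, ← h00, ← h00, Matrix.map_mul, Matrix.map_mul, ← unitE_eq_map]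
    simp only [Matrix.mul_assoc]
  rw [h0, Matrix.mul_sum, Matrix.sum_mul, Matrix.sum_mul, ← Finset.sum_sub_distrib]
  refine Finset.sum_congr rfl fun a ha => ?_
  rw [Finset.mem_range] at ha
  set j := k - 1 - a with hj
  have hk : (k : ZMod m) = 1 + a + j := by
    have : k = 1 + a + j := by omega
    conv_lhs => rw [this]
    push_cast; ring
  have h1 : Matrix.scalar (VIndex α) c.y ^ j * gr c α (-k) =
      gr c α (-1 - a) * Matrix.scalar (VIndex α) c.y ^ j := by
    rw [scalar_y_pow_mul_gr, hk]; congr 2; ring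
  have h2 : Matrix.scalar (Fin d) c.y ^ j * unitE c β = unitE c β * Matrix.scalar (Fin d) c.y ^ j := by
    rw [← map_pow]
    exact (E_commute_scalar c β _).symm
  have h3 := y_pow_mul_rowW_mul_resY c hp j
  have h4 : p.Y.map c.ofC ^ a * gr c α (-1 - a) = gr c α (-1) * p.Y.map c.ofC ^ a := by
    rw [Y_pow_mul_gr c hp, sub_add_cancel]
  have h5 : Matrix.scalar (VIndex α) c.y ^ j * (gr c α (-k) * p.v.map c.ofC *
      (unitE c β * (p.rowW c * p.resY c))) = gr c α (-1 - a) * (p.v.map c.ofC * (unitE c β *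
        (p.w.map c.ofC * (p.Y.map c.ofC ^ j * (gr c α 0 * p.resY c)) -
          p.w.map c.ofC * (gr c α j * p.geomY c j)))) := by
    rw [← h3, ← Matrix.mul_assoc (unitE c β) (Matrix.scalar (Fin d) c.y ^ j), ← h2,
      ← Matrix.mul_assoc (Matrix.scalar (VIndex α) c.y ^ j) (gr c α (-k) * p.v.map c.ofC),
      ← Matrix.mul_assoc (Matrix.scalar (VIndex α) c.y ^ j) (gr c α (-k)), h1,
      Matrix.mul_assoc (gr c α (-1 - a)), scalar_pow_mul_map]
    simp only [Matrix.mul_assoc]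
  rw [Matrix.mul_assoc, Matrix.mul_assoc, h5]
  simp only [Matrix.mul_sub]
  congr 1
  rw [← Matrix.mul_assoc, h4]
  simp only [Matrix.mul_assoc]

theorem matNonneg_geomY (k : ℕ) (p : FramedData α d) : MatNonneg (p.geomY c k) :=
  MatNonneg.sum fun _ _ => ((matNonneg_map_ofC _).pow _).mul (matNonneg_scalar_y.pow _)

theorem matNonneg_unitE (β : Fin d) : MatNonneg (unitE c β) := by
  rw [unitE_eq_map]; exact matNonneg_map_ofC _

theorem matNonneg_remY (k : ℕ) (β : Fin d) (p : FramedData α d) : MatNonneg (p.remY c k β) :=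
  MatNonneg.sum fun _ _ => ((matNonneg_map_ofC _).pow _).mul ((matNonneg_gr _ _).mul
    ((matNonneg_map_ofC _).mul ((matNonneg_unitE c β).mul ((matNonneg_map_ofC _).mul
      ((matNonneg_gr _ _).mul (matNonneg_geomY c _ p))))))

/-- The vector field `flowField k β`, in the simpler form that it takes on representations: `Ẋ` is
minus the component of degree `1` of `∑_{a<k} Y^a v E_β w Y^{k-a-1}`, `Ẏ = 0`, `v̇ = -Y^k v E_β` and
`ẇ = E_β w Y^k`. -/
def vel (k : ℕ) (β : Fin d) (p : FramedData α d) : FramedData α d where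
  X := -hpart 1 (flowK k β p)
  Y := 0
  v := -(p.Y ^ k * p.v * Matrix.single β β (1 : ℂ))
  w := Matrix.single β β (1 : ℂ) * p.w * p.Y ^ k

/-- The derivative of the dressing at `p` in the direction of `q`, for a direction with `Ẏ = 0`. -/
def dDressing (p q : FramedData α d) : PMat c d :=
  -(q.rowW c * p.resX c * p.resY c * p.colV c)
    + p.rowW c * p.resX c * q.X.map c.ofC * p.resX c * p.resY c * p.colV c
    - p.rowW c * p.resX c * p.resY c * q.colV c

theorem map_pow_ofC (N : Matrix (VIndex α) (VIndex α) ℂ) (k : ℕ) :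
    (N ^ k).map c.ofC = N.map c.ofC ^ k := map_pow c.ofC.mapMatrix N k

theorem matrix_map_neg {q r : Type*} (N : Matrix q r ℂ) : (-N).map c.ofC = -N.map c.ofC :=
  Matrix.map_neg _ (map_neg c.ofC) N

theorem matBdd_dDressing (p q : FramedData α d) : MatBdd (-1) (dDressing c p q) :=
  (((((matBdd_rowW c q).mul (matBdd_resX c p)).mul (matBdd_resY c p)).mul (matBdd_colV c p)).neg.add
    (((((matBdd_rowW c p).mul (matBdd_resX c p)).mul (matBdd_map_ofC _)).mul
      (matBdd_resX c p)).mul (matBdd_resY c p) |>.mul (matBdd_colV c p))).sub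
    ((((matBdd_rowW c p).mul (matBdd_resX c p)).mul (matBdd_resY c p)).mul (matBdd_colV c q))

theorem matBdd_dressingInv (p : FramedData α d) : MatBdd 0 (p.dressingInv c) := by
  rw [← sub_add_cancel (p.dressingInv c) 1]
  exact ((matBdd_dressingInv_sub_one c p).mono (by norm_num)).add matBdd_one

/-- `A⁻¹ B⁻¹ V M⁻¹ = B⁻¹ A⁻¹ V` for `A = X - x`, `B = Y - y`. -/
theorem resX_resY_colV_mul_dressingInv {p : FramedData α d} (hp : p.IsRep)
    (hm : p.MomentRelation c) :
    p.resX c * p.resY c * p.colV c * p.dressingInv c = p.resY c * p.resX c * p.colV c := by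
  have h := resX_resY_colV_rowW c hp hm
  rw [dressingInv, Matrix.mul_add, Matrix.mul_one]
  simp only [← Matrix.mul_assoc] at h ⊢
  rw [h]
  abel

/-- Adding `Ṁ M⁻¹` to `M y^k E_β M⁻¹` removes exactly its negative part. -/
theorem conj_y_pow_add_dDressing {p : FramedData α d} (hp : p.IsRep) (hm : p.MomentRelation c)
    (k : ℕ) (β : Fin d) :
    MatNonneg (p.dressing c * (Matrix.scalar (Fin d) c.y ^ k * unitE c β) * p.dressingInv c +
      dDressing c p (vel k β p) * p.dressingInv c) := by
  have hU : Matrix.scalar (Fin d) c.y ^ k * unitE c β =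
      unitE c β * Matrix.scalar (Fin d) c.y ^ k := by
    rw [← map_pow]; exact (E_commute_scalar c β _).symm
  have hvq : (vel k β p).colV c =
      -(gr c α 0 * (p.Y.map c.ofC ^ k * p.v.map c.ofC * unitE c β)) := by
    rw [colV, vel, matrix_map_neg, Matrix.map_mul, Matrix.map_mul, map_pow_ofC, ← unitE_eq_map,
      Matrix.mul_neg]
  have hwq : (vel k β p).rowW c =
      unitE c β * (p.w.map c.ofC * (p.Y.map c.ofC ^ k * gr c α 0)) := by
    rw [rowW, vel, Matrix.map_mul, Matrix.map_mul, map_pow_ofC, ← unitE_eq_map]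
    simp only [Matrix.mul_assoc]
  have hXq : (vel k β p).X.map c.ofC = -(hpart 1 (flowK k β p)).map c.ofC := matrix_map_neg c _
  have hV := resX_resY_colV_mul_dressingInv c hp hm
  have hW : p.rowW c * (p.resX c * gr c α (-1)) = p.rowW c * p.resX c := by
    have := gr_mul_resX c hp 0
    rw [zero_sub] at this
    rw [← this, ← Matrix.mul_assoc, rowW_mul_gr]
  -- the three products in which `y^k` meets `(Y - y)⁻¹`
  have f1 : p.resY c * (p.colV c * (Matrix.scalar (Fin d) c.y ^ k * unitE c β)) =
      -(p.resY c * (vel k β p).colV c) -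
        p.geomY c k * (gr c α (-k) * p.v.map c.ofC) * unitE c β := by
    have h := congrArg (fun Z => Z * unitE c β) (resY_mul_colV_mul_y_pow c hp k)
    simp only [Matrix.sub_mul] at h
    rw [hvq, Matrix.mul_neg, neg_neg]
    simp only [Matrix.mul_assoc] at h ⊢
    exact h
  have f2 : Matrix.scalar (Fin d) c.y ^ k * unitE c β * (p.rowW c * p.resY c) =
      (vel k β p).rowW c * p.resY c - unitE c β * (p.w.map c.ofC * (gr c α k * p.geomY c k)) := by
    rw [hU, Matrix.mul_assoc, y_pow_mul_rowW_mul_resY c hp, Matrix.mul_sub, hwq]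
    simp only [Matrix.mul_assoc]
  have f3 : p.resY c * (p.colV c * (Matrix.scalar (Fin d) c.y ^ k * unitE c β)) *
      (p.rowW c * p.resY c) = -(p.resY c * (vel k β p).colV c) * (p.rowW c * p.resY c) +
        gr c α (-1) * (vel k β p).X.map c.ofC * p.resY c + p.remY c k β := by
    have h := geomY_mul c hp k β
    rw [f1, Matrix.sub_mul, Matrix.mul_assoc _ (unitE c β), h, hXq, Matrix.mul_neg, Matrix.neg_mul _ (p.resY c)]
    abel
  -- all the terms with `Ẋ`, `v̇` and `ẇ` cancel, and no factor `(Y - y)⁻¹` is left over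
  have key : p.dressing c * (Matrix.scalar (Fin d) c.y ^ k * unitE c β) * p.dressingInv c +
      dDressing c p (vel k β p) * p.dressingInv c =
      Matrix.scalar (Fin d) c.y ^ k * unitE c β
        + p.rowW c * (p.resX c * (p.geomY c k * (gr c α (-k) * p.v.map c.ofC) * unitE c β))
        - unitE c β * (p.w.map c.ofC * (gr c α k * p.geomY c k)) * (p.resX c * p.colV c)
        - p.rowW c * (p.resX c * (p.remY c k β * (p.resX c * p.colV c))) := by
    have hM : p.dressing c = 1 - p.rowW c * (p.resX c * (p.resY c * p.colV c)) := by
      rw [dressing_eq]; simp only [Matrix.mul_assoc]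
    have hM' : p.dressingInv c = 1 + p.rowW c * p.resY c * (p.resX c * p.colV c) := by
      rw [dressingInv]; simp only [Matrix.mul_assoc]
    have hD : dDressing c p (vel k β p) * p.dressingInv c =
        -((vel k β p).rowW c * p.resY c * (p.resX c * p.colV c))
        + p.rowW c * (p.resX c * ((vel k β p).X.map c.ofC * (p.resY c * (p.resX c * p.colV c))))
        - p.rowW c * (p.resX c * (p.resY c * (vel k β p).colV c))
        - p.rowW c * (p.resX c * (p.resY c * (vel k β p).colV c *
            (p.rowW c * p.resY c * (p.resX c * p.colV c)))) := by
      have h1 : dDressing c p (vel k β p) * p.dressingInv c =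
          -((vel k β p).rowW c * (p.resX c * p.resY c * p.colV c * p.dressingInv c))
          + p.rowW c * (p.resX c * ((vel k β p).X.map c.ofC *
            (p.resX c * p.resY c * p.colV c * p.dressingInv c)))
          - p.rowW c * (p.resX c * (p.resY c * (vel k β p).colV c)) * p.dressingInv c := by
        rw [dDressing, sub_mul, add_mul, neg_mul]
        simp only [Matrix.mul_assoc]
      rw [h1, hV, hM', mul_add, mul_one]
      simp only [Matrix.mul_assoc]
      abel
    set U := Matrix.scalar (Fin d) c.y ^ k * unitE c β with hUdef
    have hS : p.dressing c * U * p.dressingInv c =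
        U - p.rowW c * (p.resX c * (p.resY c * (p.colV c * U)))
          + U * (p.rowW c * p.resY c) * (p.resX c * p.colV c)
          - p.rowW c * (p.resX c * (p.resY c * (p.colV c * U) * (p.rowW c * p.resY c) *
            (p.resX c * p.colV c))) := by
      rw [hM, hM', sub_mul, mul_add, one_mul, mul_one, sub_mul]
      simp only [Matrix.mul_assoc]
      abel
    have hW' : ∀ Z : Matrix (VIndex α) (VIndex α) c.PRing,
        p.rowW c * (p.resX c * (gr c α (-1) * (Z * (p.resY c * (p.resX c * p.colV c))))) =
          p.rowW c * (p.resX c * (Z * (p.resY c * (p.resX c * p.colV c)))) := by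
      intro Z
      rw [← Matrix.mul_assoc (p.resX c) (gr c α (-1)), ← Matrix.mul_assoc (p.rowW c), hW, Matrix.mul_assoc]
    rw [hS, hD, f3, f1, f2]
    simp only [Matrix.mul_sub, Matrix.sub_mul, Matrix.add_mul, Matrix.mul_add, Matrix.mul_neg,
      Matrix.neg_mul, Matrix.mul_assoc, hW']
    abel
  rw [key]
  have nU : MatNonneg (unitE c β) := matNonneg_unitE c β
  have nX : MatNonneg (p.resX c) := matNonneg_map_ofRat _
  have nV : MatNonneg (p.colV c) := (matNonneg_gr _ _).mul (matNonneg_map_ofC _)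
  have nW : MatNonneg (p.rowW c) := (matNonneg_map_ofC _).mul (matNonneg_gr _ _)
  refine MatNonneg.sub (MatNonneg.sub (MatNonneg.add ?_ ?_) ?_) ?_
  · exact (matNonneg_scalar_y.pow k).mul nU
  · exact nW.mul (nX.mul (((matNonneg_geomY c k p).mul ((matNonneg_gr _ _).mul
      (matNonneg_map_ofC _))).mul nU))
  · exact (nU.mul ((matNonneg_map_ofC _).mul ((matNonneg_gr _ _).mul (matNonneg_geomY c k p)))).mul
      (nX.mul nV)
  · exact nW.mul (nX.mul ((matNonneg_remY c k β p).mul (nX.mul nV)))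

theorem lax_pow_mul {p : FramedData α d} (hp : p.IsRep) (hm : p.MomentRelation c) (k : ℕ)
    (β : Fin d) : (p.laxPair c).1 ^ k * (p.laxPair c).2 β =
      p.dressing c * (Matrix.scalar (Fin d) c.y ^ k * unitE c β) * p.dressingInv c := by
  have h1 := dressing_mul_dressingInv c hp hm
  have h2 := dressingInv_mul_dressing c hp hm
  rw [laxPair_eq c hp hm]
  have h3 : ∀ j : ℕ, (p.dressing c * Matrix.scalar (Fin d) c.y * p.dressingInv c) ^ j =
      p.dressing c * Matrix.scalar (Fin d) c.y ^ j * p.dressingInv c := by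
    intro j
    induction j with
    | zero => rw [pow_zero, pow_zero, mul_one, h1]
    | succ j ih => rw [pow_succ, ih, conj_mul_conj h2, pow_succ]
  rw [h3]
  exact conj_mul_conj h2 _ _

/-- `(L^k R_β)₊ = L^k R_β + Ṁ M⁻¹`, that is, `Ṁ = -(M y^k E_β M⁻¹)₋ M`. -/
theorem posPart_lax_pow_mul {p : FramedData α d} (hp : p.IsRep) (hm : p.MomentRelation c) (k : ℕ)
    (β : Fin d) : PMat.posPart ((p.laxPair c).1 ^ k * (p.laxPair c).2 β) =
      (p.laxPair c).1 ^ k * (p.laxPair c).2 β + dDressing c p (vel k β p) * p.dressingInv c := by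
  refine posPart_eq_of_add (N := -(dDressing c p (vel k β p) * p.dressingInv c)) (by abel) ?_
    ((matBdd_dDressing c p _).mul (matBdd_dressingInv c p)).neg
  rw [lax_pow_mul c hp hm]
  exact conj_y_pow_add_dDressing c hp hm k β

end FramedData

/-! ### Differentiation of rational functions with respect to a parameter -/

/-- A family of polynomials of bounded degree whose coefficients are differentiable at `t`. -/
def PolyHasDerivAt (p : ℂ → ℂ[X]) (p' : ℂ[X]) (t : ℂ) : Prop :=
  (∃ N : ℕ, ∀ᶠ s in 𝓝 t, (p s).natDegree ≤ N) ∧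
    ∀ j : ℕ, HasDerivAt (fun s => (p s).coeff j) (p'.coeff j) t

theorem PolyHasDerivAt.add {p q : ℂ → ℂ[X]} {p' q' : ℂ[X]} {t : ℂ} (hp : PolyHasDerivAt p p' t)
    (hq : PolyHasDerivAt q q' t) : PolyHasDerivAt (fun s => p s + q s) (p' + q') t := by
  obtain ⟨⟨N, hN⟩, hp⟩ := hp
  obtain ⟨⟨K, hK⟩, hq⟩ := hq
  refine ⟨⟨max N K, ?_⟩, fun j => ?_⟩
  · filter_upwards [hN, hK] with s h1 h2
    exact (natDegree_add_le _ _).trans (max_le_max h1 h2)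
  · simpa only [coeff_add] using (hp j).fun_add (hq j)

theorem PolyHasDerivAt.neg {p : ℂ → ℂ[X]} {p' : ℂ[X]} {t : ℂ} (hp : PolyHasDerivAt p p' t) :
    PolyHasDerivAt (fun s => -p s) (-p') t := by
  obtain ⟨⟨N, hN⟩, hp⟩ := hp
  refine ⟨⟨N, ?_⟩, fun j => ?_⟩
  · filter_upwards [hN] with s h1
    rwa [natDegree_neg]
  · simpa only [coeff_neg] using (hp j).fun_neg

theorem PolyHasDerivAt.mul {p q : ℂ → ℂ[X]} {p' q' : ℂ[X]} {t : ℂ} (hp : PolyHasDerivAt p p' t)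
    (hq : PolyHasDerivAt q q' t) :
    PolyHasDerivAt (fun s => p s * q s) (p' * q t + p t * q') t := by
  obtain ⟨⟨N, hN⟩, hp⟩ := hp
  obtain ⟨⟨K, hK⟩, hq⟩ := hq
  refine ⟨⟨N + K, ?_⟩, fun j => ?_⟩
  · filter_upwards [hN, hK] with s h1 h2
    exact natDegree_mul_le.trans (add_le_add h1 h2)
  · simp only [coeff_add, coeff_mul, ← Finset.sum_add_distrib]
    exact HasDerivAt.fun_sum fun x _ => (hp x.1).fun_mul (hq x.2)

theorem polyHasDerivAt_C {g : ℂ → ℂ} {g' t : ℂ} (hg : HasDerivAt g g' t) :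
    PolyHasDerivAt (fun s => C (g s)) (C g') t := by
  refine ⟨⟨0, Eventually.of_forall fun s => (natDegree_C _).le⟩, fun j => ?_⟩
  simp only [coeff_C]
  split_ifs
  · exact hg
  · exact hasDerivAt_const t _

theorem polyHasDerivAt_const (p : ℂ[X]) (t : ℂ) : PolyHasDerivAt (fun _ => p) 0 t :=
  ⟨⟨p.natDegree, Eventually.of_forall fun _ => le_rfl⟩, fun j => by
    simpa using hasDerivAt_const t (p.coeff j)⟩

theorem PolyHasDerivAt.derivative {p : ℂ → ℂ[X]} {p' : ℂ[X]} {t : ℂ} (hp : PolyHasDerivAt p p' t) :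
    PolyHasDerivAt (fun s => derivative (p s)) (derivative p') t := by
  obtain ⟨⟨N, hN⟩, hp⟩ := hp
  refine ⟨⟨N, ?_⟩, fun j => ?_⟩
  · filter_upwards [hN] with s h1
    exact (natDegree_derivative_le _).trans ((Nat.sub_le _ _).trans h1)
  · simp only [coeff_derivative]
    exact (hp (j + 1)).mul_const _

theorem PolyHasDerivAt.scale {p : ℂ → ℂ[X]} {p' : ℂ[X]} {t : ℂ} (hp : PolyHasDerivAt p p' t)
    (a : ℂ) : PolyHasDerivAt (fun s => (p s).comp (C a * X)) (p'.comp (C a * X)) t := by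
  obtain ⟨⟨N, hN⟩, hp⟩ := hp
  refine ⟨⟨N, ?_⟩, fun j => ?_⟩
  · filter_upwards [hN] with s h1
    refine natDegree_comp_le.trans ?_
    calc (p s).natDegree * (C a * X).natDegree ≤ (p s).natDegree * 1 :=
          Nat.mul_le_mul_left _ ((natDegree_C_mul_le a X).trans natDegree_X_le)
      _ ≤ N := by rwa [mul_one]
  · simp only [comp_C_mul_X_coeff]
    exact (hp j).mul_const _

theorem PolyHasDerivAt.eventually_ne {p : ℂ → ℂ[X]} {p' : ℂ[X]} {t : ℂ} (hp : PolyHasDerivAt p p' t)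
    (h : p t ≠ 0) : ∀ᶠ s in 𝓝 t, p s ≠ 0 := by
  obtain ⟨j, hj⟩ : ∃ j, (p t).coeff j ≠ 0 := by
    by_contra! hc
    exact h (Polynomial.ext fun n => by rw [hc n, coeff_zero])
  filter_upwards [(hp.2 j).continuousAt.eventually_ne hj] with s hs h0
  exact hs (by rw [h0, coeff_zero])

theorem PolyHasDerivAt.unique {p q : ℂ → ℂ[X]} {p' q' : ℂ[X]} {t : ℂ} (hp : PolyHasDerivAt p p' t)
    (hq : PolyHasDerivAt q q' t) (h : ∀ᶠ s in 𝓝 t, p s = q s) : p' = q' := by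
  ext j
  refine (hp.2 j).unique ((hq.2 j).congr_of_eventuallyEq ?_)
  filter_upwards [h] with s hs
  rw [hs]

theorem ratHasDerivAt_iff {f : ℂ → RatFunc ℂ} {f' : RatFunc ℂ} {t : ℂ} : RatHasDerivAt f f' t ↔
    ∃ (p q : ℂ → ℂ[X]) (p' q' : ℂ[X]), q t ≠ 0 ∧ PolyHasDerivAt p p' t ∧ PolyHasDerivAt q q' t ∧
      (∀ᶠ s in 𝓝 t, f s = algebraMap ℂ[X] (RatFunc ℂ) (p s) / algebraMap ℂ[X] (RatFunc ℂ) (q s)) ∧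
      f' = algebraMap ℂ[X] (RatFunc ℂ) (p' * q t - p t * q') /
        algebraMap ℂ[X] (RatFunc ℂ) (q t ^ 2) := by
  constructor
  · rintro ⟨N, p, q, p', q', h0, h1, h2, h3⟩
    exact ⟨p, q, p', q', h0, ⟨⟨N, h1.mono fun s h => h.1⟩, fun j => (h2 j).1⟩,
      ⟨⟨N, h1.mono fun s h => h.2.1⟩, fun j => (h2 j).2⟩, h1.mono fun s h => h.2.2, h3⟩
  · rintro ⟨p, q, p', q', h0, ⟨⟨N, hN⟩, hp⟩, ⟨⟨K, hK⟩, hq⟩, h1, h2⟩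
    refine ⟨max N K, p, q, p', q', h0, ?_, fun j => ⟨hp j, hq j⟩, h2⟩
    filter_upwards [hN, hK, h1] with s a b e
    exact ⟨a.trans (le_max_left _ _), b.trans (le_max_right _ _), e⟩

theorem ratHasDerivAt_const (f : RatFunc ℂ) (t : ℂ) : RatHasDerivAt (fun _ => f) 0 t := by
  rw [ratHasDerivAt_iff]
  refine ⟨fun _ => f.num, fun _ => f.denom, 0, 0, f.denom_ne_zero, polyHasDerivAt_const _ _,
    polyHasDerivAt_const _ _, Eventually.of_forall fun _ => f.num_div_denom.symm, ?_⟩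
  simp

theorem ratHasDerivAt_C {g : ℂ → ℂ} {g' t : ℂ} (hg : HasDerivAt g g' t) :
    RatHasDerivAt (fun s => RatFunc.C (g s)) (RatFunc.C g') t := by
  rw [ratHasDerivAt_iff]
  refine ⟨fun s => C (g s), fun _ => 1, C g', 0, one_ne_zero, polyHasDerivAt_C hg,
    polyHasDerivAt_const _ _, Eventually.of_forall fun s => ?_, ?_⟩ <;> simp

theorem RatHasDerivAt.congr {f g : ℂ → RatFunc ℂ} {f' : RatFunc ℂ} {t : ℂ} (hf : RatHasDerivAt f f' t)
    (h : ∀ᶠ s in 𝓝 t, g s = f s) : RatHasDerivAt g f' t := by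
  rw [ratHasDerivAt_iff] at hf ⊢
  obtain ⟨p, q, p', q', h0, hp, hq, h1, h2⟩ := hf
  refine ⟨p, q, p', q', h0, hp, hq, ?_, h2⟩
  filter_upwards [h, h1] with s a b
  rw [a, b]

theorem RatHasDerivAt.add {f g : ℂ → RatFunc ℂ} {f' g' : RatFunc ℂ} {t : ℂ}
    (hf : RatHasDerivAt f f' t) (hg : RatHasDerivAt g g' t) :
    RatHasDerivAt (fun s => f s + g s) (f' + g') t := by
  rw [ratHasDerivAt_iff] at hf hg ⊢
  obtain ⟨p, q, p', q', h0, hp, hq, h1, rfl⟩ := hf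
  obtain ⟨r, u, r', u', k0, hr, hu, k1, rfl⟩ := hg
  refine ⟨fun s => p s * u s + q s * r s, fun s => q s * u s, _, _, mul_ne_zero h0 k0,
    (hp.mul hu).add (hq.mul hr), hq.mul hu, ?_, ?_⟩
  · filter_upwards [h1, k1, hq.eventually_ne h0, hu.eventually_ne k0] with s a b e e'
    rw [a, b, div_add_div _ _ (RatFunc.algebraMap_ne_zero e) (RatFunc.algebraMap_ne_zero e')]
    simp only [map_add, map_mul]
  · have e := RatFunc.algebraMap_ne_zero h0
    have e' := RatFunc.algebraMap_ne_zero k0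
    simp only [map_add, map_sub, map_mul, map_pow]
    field_simp
    ring

theorem RatHasDerivAt.mul {f g : ℂ → RatFunc ℂ} {f' g' : RatFunc ℂ} {t : ℂ}
    (hf : RatHasDerivAt f f' t) (hg : RatHasDerivAt g g' t) :
    RatHasDerivAt (fun s => f s * g s) (f' * g t + f t * g') t := by
  rw [ratHasDerivAt_iff] at hf hg ⊢
  obtain ⟨p, q, p', q', h0, hp, hq, h1, rfl⟩ := hf
  obtain ⟨r, u, r', u', k0, hr, hu, k1, rfl⟩ := hg
  refine ⟨fun s => p s * r s, fun s => q s * u s, _, _, mul_ne_zero h0 k0,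
    hp.mul hr, hq.mul hu, ?_, ?_⟩
  · filter_upwards [h1, k1] with s a b
    rw [a, b, div_mul_div_comm, ← map_mul, ← map_mul]
  · have e := RatFunc.algebraMap_ne_zero h0
    have e' := RatFunc.algebraMap_ne_zero k0
    rw [h1.self_of_nhds, k1.self_of_nhds]
    simp only [map_add, map_sub, map_mul, map_pow]
    field_simp
    ring

theorem RatHasDerivAt.neg {f : ℂ → RatFunc ℂ} {f' : RatFunc ℂ} {t : ℂ}
    (hf : RatHasDerivAt f f' t) : RatHasDerivAt (fun s => -f s) (-f') t := by
  have := (ratHasDerivAt_const (-1) t).mul hf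
  simpa using this

theorem RatHasDerivAt.sum {ι : Type*} {A : Finset ι} {f : ι → ℂ → RatFunc ℂ} {f' : ι → RatFunc ℂ}
    {t : ℂ} (h : ∀ i ∈ A, RatHasDerivAt (f i) (f' i) t) :
    RatHasDerivAt (fun s => ∑ i ∈ A, f i s) (∑ i ∈ A, f' i) t := by
  classical
  induction A using Finset.induction_on with
  | empty => simpa using ratHasDerivAt_const 0 t
  | insert i A hi ih =>
    simp only [Finset.sum_insert hi]
    exact (h i (Finset.mem_insert_self _ _)).add (ih fun j hj => h j (Finset.mem_insert_of_mem hj))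

theorem RatHasDerivAt.exists_prod {ι : Type*} {A : Finset ι} {f : ι → ℂ → RatFunc ℂ} {t : ℂ}
    (h : ∀ i ∈ A, ∃ f', RatHasDerivAt (f i) f' t) :
    ∃ f', RatHasDerivAt (fun s => ∏ i ∈ A, f i s) f' t := by
  classical
  induction A using Finset.induction_on with
  | empty => exact ⟨0, by simpa using ratHasDerivAt_const 1 t⟩
  | insert i A hi ih =>
    simp only [Finset.prod_insert hi]
    obtain ⟨a, ha⟩ := h i (Finset.mem_insert_self _ _)
    obtain ⟨b, hb⟩ := ih fun j hj => h j (Finset.mem_insert_of_mem hj)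
    exact ⟨_, ha.mul hb⟩

/-- The value of the derivative is not recorded: it is determined by the product rule and
`RatHasDerivAt.unique`. -/
theorem RatHasDerivAt.exists_inv {f : ℂ → RatFunc ℂ} {f' : RatFunc ℂ} {t : ℂ}
    (hf : RatHasDerivAt f f' t) (h : f t ≠ 0) : ∃ g', RatHasDerivAt (fun s => (f s)⁻¹) g' t := by
  rw [ratHasDerivAt_iff] at hf
  obtain ⟨p, q, p', q', h0, hp, hq, h1, -⟩ := hf
  refine ⟨_, ratHasDerivAt_iff.2 ⟨q, p, q', p', fun h2 => h ?_, hq, hp, ?_, rfl⟩⟩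
  · rw [h1.self_of_nhds, h2, map_zero, zero_div]
  · filter_upwards [h1] with s hs
    rw [hs, inv_div]

theorem RatHasDerivAt.scale {f : ℂ → RatFunc ℂ} {f' : RatFunc ℂ} {t : ℂ}
    (hf : RatHasDerivAt f f' t) (a : ℂˣ) :
    RatHasDerivAt (fun s => ratScale a (f s)) (ratScale a f') t := by
  rw [ratHasDerivAt_iff] at hf ⊢
  obtain ⟨p, q, p', q', h0, hp, hq, h1, rfl⟩ := hf
  refine ⟨_, _, _, _, fun h => h0 ((Polynomial.comp_C_mul_X_eq_zero_iff
      (mem_nonZeroDivisors_of_ne_zero a.ne_zero)).1 h), hp.scale a, hq.scale a, ?_, ?_⟩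
  · filter_upwards [h1] with s hs
    rw [hs, ratScale_div]
  · rw [ratScale_div]
    simp only [sub_comp, mul_comp, pow_comp]

theorem RatHasDerivAt.ratDeriv {f : ℂ → RatFunc ℂ} {f' : RatFunc ℂ} {t : ℂ}
    (hf : RatHasDerivAt f f' t) :
    RatHasDerivAt (fun s => ratDeriv (f s)) (ratDeriv f') t := by
  rw [ratHasDerivAt_iff] at hf ⊢
  obtain ⟨p, q, p', q', h0, hp, hq, h1, rfl⟩ := hf
  refine ⟨fun s => derivative (p s) * q s + -(p s * derivative (q s)), fun s => q s * q s, _, _,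
    mul_ne_zero h0 h0, (hp.derivative.mul hq).add (hp.mul hq.derivative).neg, hq.mul hq, ?_, ?_⟩
  · filter_upwards [h1, hq.eventually_ne h0] with s hs e
    rw [hs, ← pow_two, ← sub_eq_add_neg]
    exact ratDerivFun_div _ e
  · have e := RatFunc.algebraMap_ne_zero h0
    refine (ratDerivFun_div _ (pow_ne_zero 2 h0)).trans ?_
    simp only [map_add, map_sub, map_mul, derivative_mul, map_neg, pow_two]
    field_simp
    ring

/-- The derivative does not depend on the representation of the curve as a quotient of polynomials. -/
theorem RatHasDerivAt.unique {f : ℂ → RatFunc ℂ} {f' g' : RatFunc ℂ} {t : ℂ}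
    (hf : RatHasDerivAt f f' t) (hg : RatHasDerivAt f g' t) : f' = g' := by
  rw [ratHasDerivAt_iff] at hf hg
  obtain ⟨p, q, p', q', h0, hp, hq, h1, rfl⟩ := hf
  obtain ⟨r, u, r', u', k0, hr, hu, k1, rfl⟩ := hg
  have h2 : ∀ᶠ s in 𝓝 t, p s * u s = r s * q s := by
    filter_upwards [h1, k1, hq.eventually_ne h0, hu.eventually_ne k0] with s a b e e'
    rw [a, div_eq_div_iff (RatFunc.algebraMap_ne_zero e) (RatFunc.algebraMap_ne_zero e'), ← map_mul,
      ← map_mul] at b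
    exact RatFunc.algebraMap_injective ℂ b
  have h3 := (hp.mul hu).unique (hr.mul hq) h2
  have h4 := h2.self_of_nhds
  rw [div_eq_div_iff (RatFunc.algebraMap_ne_zero (pow_ne_zero 2 h0))
    (RatFunc.algebraMap_ne_zero (pow_ne_zero 2 k0)), ← map_mul, ← map_mul]
  congr 1
  linear_combination (u t * q t) * h3 - (u t * q' + u' * q t) * h4

/-! ### Differentiation in the crossed product and in `𝒫` -/

/-- Coefficientwise differentiation of a curve in `ℂ(x) * Γ`. -/
def CPHasDerivAt {m : ℕ} (f : ℂ → CrossedProduct m) (f' : CrossedProduct m) (t : ℂ) : Prop :=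
  ∀ γ, RatHasDerivAt (fun s => (f s).coeff γ) (f'.coeff γ) t

instance {m : ℕ} [NeZero m] : Fintype (CyclicGroup m) :=
  @Fintype.ofFinite _ (inferInstanceAs (Finite (rootsOfUnity m ℂ)))

namespace CPHasDerivAt
variable {m : ℕ} [NeZero m] {t : ℂ}
open CrossedProduct

theorem const (f : CrossedProduct m) : CPHasDerivAt (fun _ => f) 0 t :=
  fun γ => ratHasDerivAt_const (f.coeff γ) t

theorem add {f g : ℂ → CrossedProduct m} {f' g' : CrossedProduct m} (hf : CPHasDerivAt f f' t)
    (hg : CPHasDerivAt g g' t) : CPHasDerivAt (fun s => f s + g s) (f' + g') t := fun γ => by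
  simpa only [SkewMonoidAlgebra.coeff_add, Finsupp.add_apply] using (hf γ).add (hg γ)

theorem neg {f : ℂ → CrossedProduct m} {f' : CrossedProduct m} (hf : CPHasDerivAt f f' t) :
    CPHasDerivAt (fun s => -f s) (-f') t := fun γ => by
  simpa only [SkewMonoidAlgebra.coeff_neg, Finsupp.neg_apply] using (hf γ).neg

theorem sub {f g : ℂ → CrossedProduct m} {f' g' : CrossedProduct m} (hf : CPHasDerivAt f f' t)
    (hg : CPHasDerivAt g g' t) : CPHasDerivAt (fun s => f s - g s) (f' - g') t := by
  simpa only [sub_eq_add_neg] using hf.add hg.neg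

theorem sum {ι : Type*} {A : Finset ι} {f : ι → ℂ → CrossedProduct m} {f' : ι → CrossedProduct m}
    (h : ∀ i ∈ A, CPHasDerivAt (f i) (f' i) t) :
    CPHasDerivAt (fun s => ∑ i ∈ A, f i s) (∑ i ∈ A, f' i) t := by
  classical
  induction A using Finset.induction_on with
  | empty => exact const 0
  | insert i A hi ih =>
    simp only [Finset.sum_insert hi]
    exact (h i (Finset.mem_insert_self _ _)).add (ih fun j hj => h j (Finset.mem_insert_of_mem hj))

theorem _root_.CrossedProduct.coeff_mul (u w : CrossedProduct m) (g : CyclicGroup m) :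
    (u * w).coeff g = ∑ h : CyclicGroup m, u.coeff h * h • w.coeff (h⁻¹ * g) := by
  classical
  induction u using SkewMonoidAlgebra.induction_on with
  | zero => simp
  | add u₁ u₂ h₁ h₂ =>
    simp only [add_mul, SkewMonoidAlgebra.coeff_add, Finsupp.add_apply, h₁, h₂, Finset.sum_add_distrib]
  | single a f =>
    rw [Finset.sum_eq_single a]
    · rw [SkewMonoidAlgebra.coeff_single_apply, if_pos rfl]
      refine SkewMonoidAlgebra.coeff_single_mul_aux w fun z => ?_
      rw [eq_inv_mul_iff_mul_eq]
    · intro h _ hh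
      rw [SkewMonoidAlgebra.coeff_single_apply, if_neg hh.symm, zero_mul]
    · intro h; exact absurd (Finset.mem_univ _) h

theorem mul {f g : ℂ → CrossedProduct m} {f' g' : CrossedProduct m} (hf : CPHasDerivAt f f' t)
    (hg : CPHasDerivAt g g' t) : CPHasDerivAt (fun s => f s * g s) (f' * g t + f t * g') t := by
  intro γ
  simp only [SkewMonoidAlgebra.coeff_add, Finsupp.add_apply, CrossedProduct.coeff_mul,
    ← Finset.sum_add_distrib]
  exact RatHasDerivAt.sum fun h _ => (hf h).mul ((hg (h⁻¹ * γ)).scale _)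

theorem theta {f : ℂ → CrossedProduct m} {f' : CrossedProduct m} (hf : CPHasDerivAt f f' t) (n : ℤ) :
    CPHasDerivAt (fun s => theta n (f s)) (CrossedProduct.theta n f') t := by
  intro γ
  simp only [CrossedProduct.coeff_theta]
  have := (ratHasDerivAt_const (RatFunc.C (((CyclicGroup.toCUnits γ) ^ n : ℂˣ) : ℂ)) t).mul (hf γ)
  simpa only [zero_mul, zero_add] using this

theorem partialX {f : ℂ → CrossedProduct m} {f' : CrossedProduct m} (hf : CPHasDerivAt f f' t) :
    CPHasDerivAt (fun s => partialX (f s)) (CrossedProduct.partialX f') t :=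
  fun γ => (hf γ).ratDeriv

theorem dunklD {f : ℂ → CrossedProduct m} {f' : CrossedProduct m} (hf : CPHasDerivAt f f' t)
    (c : CherednikParameters m) : CPHasDerivAt (fun s => c.dunklD (f s)) (c.dunklD f') t := by
  have h : ∀ (a : CrossedProduct m) {g : ℂ → CrossedProduct m} {g' : CrossedProduct m},
      CPHasDerivAt g g' t → CPHasDerivAt (fun s => a * g s) (a * g') t := by
    intro a g g' hg
    simpa only [zero_mul, zero_add] using (const a).mul hg
  have h' : CPHasDerivAt (fun s => f s * c.dunklTail) (f' * c.dunklTail) t := by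
    simpa only [mul_zero, add_zero] using hf.mul (const c.dunklTail)
  exact (h _ hf.partialX).sub (h _ ((h _ hf).sub h'))

theorem congr {f g : ℂ → CrossedProduct m} {f' : CrossedProduct m} (hf : CPHasDerivAt f f' t)
    (h : ∀ᶠ s in 𝓝 t, g s = f s) : CPHasDerivAt g f' t := fun γ =>
  (hf γ).congr (h.mono fun s hs => by rw [hs])

theorem unique {f : ℂ → CrossedProduct m} {f' g' : CrossedProduct m} (hf : CPHasDerivAt f f' t)
    (hg : CPHasDerivAt f g' t) : f' = g' :=
  SkewMonoidAlgebra.ext fun γ => (hf γ).unique (hg γ)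

end CPHasDerivAt

/-- Coefficientwise differentiation of a curve in `𝒫` of bounded order. -/
def PHasDerivAt {m : ℕ} [NeZero m] {c : CherednikParameters m} (u : ℂ → c.PRing) (u' : c.PRing)
    (t : ℂ) : Prop :=
  (∃ N : ℤ, (∀ᶠ s in 𝓝 t, (u s).BddBy N) ∧ u'.BddBy N) ∧
    ∀ n : ℤ, CPHasDerivAt (fun s => (u s).coeff n) (u'.coeff n) t

namespace PHasDerivAt
variable {m : ℕ} [NeZero m] {c : CherednikParameters m} {t : ℂ}
open SkewLaurent

theorem const (u : c.PRing) : PHasDerivAt (fun _ => u) 0 t := by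
  obtain ⟨N, hN⟩ := u.bdd
  exact ⟨⟨N, Eventually.of_forall fun _ => hN, fun _ _ => rfl⟩, fun n => CPHasDerivAt.const _⟩

theorem add {u w : ℂ → c.PRing} {u' w' : c.PRing} (hu : PHasDerivAt u u' t)
    (hw : PHasDerivAt w w' t) : PHasDerivAt (fun s => u s + w s) (u' + w') t := by
  obtain ⟨⟨N, hN, hN'⟩, hu⟩ := hu
  obtain ⟨⟨K, hK, hK'⟩, hw⟩ := hw
  refine ⟨⟨max N K, ?_, (hN'.mono (le_max_left _ _)).add (hK'.mono (le_max_right _ _))⟩,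
    fun n => (hu n).add (hw n)⟩
  filter_upwards [hN, hK] with s h1 h2
  exact (h1.mono (le_max_left _ _)).add (h2.mono (le_max_right _ _))

theorem sum {ι : Type*} {A : Finset ι} {f : ι → ℂ → c.PRing} {f' : ι → c.PRing}
    (h : ∀ i ∈ A, PHasDerivAt (f i) (f' i) t) :
    PHasDerivAt (fun s => ∑ i ∈ A, f i s) (∑ i ∈ A, f' i) t := by
  classical
  induction A using Finset.induction_on with
  | empty => exact const 0
  | insert i A hi ih =>
    simp only [Finset.sum_insert hi]
    exact (h i (Finset.mem_insert_self _ _)).add (ih fun j hj => h j (Finset.mem_insert_of_mem hj))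

theorem lmulY {u : ℂ → c.PRing} {u' : c.PRing} (hu : PHasDerivAt u u' t) :
    PHasDerivAt (fun s => lmulY (u s)) (SkewLaurent.lmulY u') t := by
  obtain ⟨⟨N, hN, hN'⟩, hu⟩ := hu
  refine ⟨⟨N + 1, hN.mono fun s hs => hs.lmulY, hN'.lmulY⟩, fun n => ?_⟩
  exact ((hu (n - 1)).theta (-1)).add ((hu n).dunklD c)

theorem invTerm {f : ℂ → CrossedProduct m} {f' : CrossedProduct m} (hf : CPHasDerivAt f f' t) (p : ℕ) :
    CPHasDerivAt (fun s => invTerm c.skew p (f s)) (SkewLaurent.invTerm c.skew p f') t := by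
  induction p with
  | zero => exact hf.theta 1
  | succ p ih => exact ((ih.dunklD c).theta 1).neg

theorem lmulYInv {u : ℂ → c.PRing} {u' : c.PRing} (hu : PHasDerivAt u u' t) :
    PHasDerivAt (fun s => lmulYInv (u s)) (SkewLaurent.lmulYInv u') t := by
  obtain ⟨⟨N, hN, hN'⟩, hu⟩ := hu
  refine ⟨⟨N - 1, hN.mono fun s hs => hs.lmulYInv, hN'.lmulYInv⟩, fun n => ?_⟩
  -- a common bound `N` for the orders makes the coefficient a sum over a range independent of `s`
  rw [coeff_lmulYInv_eq hN' n le_rfl]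
  refine CPHasDerivAt.congr (CPHasDerivAt.sum fun p _ => invTerm (c := c) (hu (n + 1 + p)) p) ?_
  filter_upwards [hN] with s hs
  exact coeff_lmulYInv_eq hs n le_rfl

theorem lmulYPow {u : ℂ → c.PRing} {u' : c.PRing} (hu : PHasDerivAt u u' t) (j : ℤ) :
    PHasDerivAt (fun s => lmulYPow j (u s)) (SkewLaurent.lmulYPow j u') t := by
  induction j using Int.induction_on with
  | zero => simp only [lmulYPow_zero]; exact hu
  | succ i ih => simp only [lmulYPow_add_one]; exact ih.lmulY
  | pred i ih => simp only [lmulYPow_sub_one]; exact ih.lmulYInv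

theorem mul {u w : ℂ → c.PRing} {u' w' : c.PRing} (hu : PHasDerivAt u u' t)
    (hw : PHasDerivAt w w' t) : PHasDerivAt (fun s => u s * w s) (u' * w t + u t * w') t := by
  have hpow := fun j n => (hw.lmulYPow j).2 n
  obtain ⟨⟨N, hN, hN'⟩, hu⟩ := hu
  obtain ⟨⟨K, hK, hK'⟩, hw⟩ := hw
  have hNt := hN.self_of_nhds
  have hKt := hK.self_of_nhds
  refine ⟨⟨N + K, ?_, (hN'.mul hKt).add (hNt.mul hK')⟩, fun n => ?_⟩
  · filter_upwards [hN, hK] with s h1 h2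
    exact h1.mul h2
  · rw [SkewLaurent.coeff_add, coeff_mul_eq hN' hKt n le_rfl le_rfl, coeff_mul_eq hNt hK' n le_rfl le_rfl,
      ← Finset.sum_add_distrib]
    have key : ∀ j : ℤ, CPHasDerivAt
        (fun s => (u s).coeff j * (SkewLaurent.lmulYPow j (w s)).coeff n)
        (u'.coeff j * (SkewLaurent.lmulYPow j (w t)).coeff n +
          (u t).coeff j * (SkewLaurent.lmulYPow j w').coeff n) t := fun j => (hu j).mul (hpow j n)
    refine CPHasDerivAt.congr
      (CPHasDerivAt.sum (A := Finset.Icc (n - K) N) fun j _ => key j) ?_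
    filter_upwards [hN, hK] with s h1 h2
    exact coeff_mul_eq h1 h2 n le_rfl le_rfl

theorem unique {u : ℂ → c.PRing} {u' w' : c.PRing} (hu : PHasDerivAt u u' t)
    (hw : PHasDerivAt u w' t) : u' = w' :=
  SkewLaurent.ext fun n => (hu.2 n).unique (hw.2 n)

theorem congr {u w : ℂ → c.PRing} {u' : c.PRing} (hu : PHasDerivAt u u' t)
    (h : ∀ᶠ s in 𝓝 t, w s = u s) : PHasDerivAt w u' t := by
  obtain ⟨⟨N, hN, hN'⟩, hu⟩ := hu
  refine ⟨⟨N, ?_, hN'⟩, fun n => (hu n).congr (h.mono fun s hs => by rw [hs])⟩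
  filter_upwards [hN, h] with s h1 h2
  rwa [h2]

theorem ofRat {f : ℂ → RatFunc ℂ} {f' : RatFunc ℂ} (hf : RatHasDerivAt f f' t) :
    PHasDerivAt (fun s => c.ofRat (f s)) (c.ofRat f') t := by
  classical
  refine ⟨⟨0, Eventually.of_forall fun s => bddBy_ofCP _, bddBy_ofCP _⟩, fun n γ => ?_⟩
  have h : ∀ g : RatFunc ℂ, ((c.ofRat g).coeff n).coeff γ = if n = 0 ∧ 1 = γ then g else 0 := by
    intro g
    have h1 : (c.ofRat g).coeff n = if n = 0 then SkewMonoidAlgebra.single 1 g else 0 :=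
      SkewLaurent.coeff_monomial _ 0 n
    rw [h1]
    by_cases hn : n = 0
    · rw [if_pos hn, SkewMonoidAlgebra.coeff_single_apply]; simp [hn]
    · simp [hn]
  simp only [h]
  split_ifs
  · exact hf
  · exact ratHasDerivAt_const 0 t

theorem ofC {g : ℂ → ℂ} {g' : ℂ} (hg : HasDerivAt g g' t) :
    PHasDerivAt (fun s => c.ofC (g s)) (c.ofC g') t := ofRat (ratHasDerivAt_C hg)

end PHasDerivAt

/-- Entrywise differentiation of a curve of matrices over `𝒫`, each entry being of bounded order. -/
def MatHasDerivAt {m : ℕ} [NeZero m] {c : CherednikParameters m} {p q : Type*}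
    (N : ℂ → Matrix p q c.PRing) (N' : Matrix p q c.PRing) (t : ℂ) : Prop :=
  ∀ i j, PHasDerivAt (fun s => N s i j) (N' i j) t

namespace MatHasDerivAt
variable {m : ℕ} [NeZero m] {c : CherednikParameters m} {t : ℂ} {p q r : Type*}

theorem const (N : Matrix p q c.PRing) : MatHasDerivAt (fun _ => N) 0 t := fun _ _ =>
  PHasDerivAt.const _

theorem add {N P : ℂ → Matrix p q c.PRing} {N' P' : Matrix p q c.PRing} (hN : MatHasDerivAt N N' t)
    (hP : MatHasDerivAt P P' t) : MatHasDerivAt (fun s => N s + P s) (N' + P') t :=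
  fun i j => (hN i j).add (hP i j)

theorem mul [Fintype q] {N : ℂ → Matrix p q c.PRing} {P : ℂ → Matrix q r c.PRing}
    {N' : Matrix p q c.PRing} {P' : Matrix q r c.PRing} (hN : MatHasDerivAt N N' t)
    (hP : MatHasDerivAt P P' t) :
    MatHasDerivAt (fun s => N s * P s) (N' * P t + N t * P') t := by
  intro i j
  simp only [Matrix.mul_apply, Matrix.add_apply, ← Finset.sum_add_distrib]
  exact PHasDerivAt.sum fun x _ => (hN i x).mul (hP x j)

theorem mul_const [Fintype q] {N : ℂ → Matrix p q c.PRing} {N' : Matrix p q c.PRing}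
    (hN : MatHasDerivAt N N' t) (P : Matrix q r c.PRing) :
    MatHasDerivAt (fun s => N s * P) (N' * P) t := by
  simpa only [Matrix.mul_zero, add_zero] using hN.mul (const (t := t) P)

theorem const_mul [Fintype q] {N : ℂ → Matrix q r c.PRing} {N' : Matrix q r c.PRing}
    (hN : MatHasDerivAt N N' t) (P : Matrix p q c.PRing) :
    MatHasDerivAt (fun s => P * N s) (P * N') t := by
  simpa only [Matrix.zero_mul, zero_add] using (const (t := t) P).mul hN

theorem neg {N : ℂ → Matrix p q c.PRing} {N' : Matrix p q c.PRing}
    (hN : MatHasDerivAt N N' t) : MatHasDerivAt (fun s => -N s) (-N') t := by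
  intro i j
  have h := (PHasDerivAt.const (t := t) (-1 : c.PRing)).mul (hN i j)
  simpa using h

theorem sub {N P : ℂ → Matrix p q c.PRing} {N' P' : Matrix p q c.PRing} (hN : MatHasDerivAt N N' t)
    (hP : MatHasDerivAt P P' t) : MatHasDerivAt (fun s => N s - P s) (N' - P') t := by
  simpa only [sub_eq_add_neg] using hN.add hP.neg

theorem unique {N : ℂ → Matrix p q c.PRing} {N' P' : Matrix p q c.PRing}
    (hN : MatHasDerivAt N N' t) (hP : MatHasDerivAt N P' t) : N' = P' :=
  Matrix.ext fun i j => (hN i j).unique (hP i j)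

theorem congr {N P : ℂ → Matrix p q c.PRing} {N' : Matrix p q c.PRing} (hN : MatHasDerivAt N N' t)
    (h : ∀ᶠ s in 𝓝 t, P s = N s) : MatHasDerivAt P N' t := fun i j =>
  (hN i j).congr (h.mono fun s hs => by rw [hs])

theorem map_ofC {N : ℂ → Matrix p q ℂ} {N' : Matrix p q ℂ}
    (h : ∀ i j, HasDerivAt (fun s => N s i j) (N' i j) t) :
    MatHasDerivAt (fun s => (N s).map c.ofC) (N'.map c.ofC) t := fun i j => PHasDerivAt.ofC (h i j)

theorem toPMat {d : ℕ} {N : ℂ → PMat c d} {N' : PMat c d} (h : MatHasDerivAt N N' t) :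
    PMatHasDerivAt N N' t := fun a b n γ => (h a b).2 n γ

/-- The derivative of the inverse of a differentiable curve, once the inverse is known to be
differentiable. -/
theorem inv_eq [Fintype p] [DecidableEq p] {N P : ℂ → Matrix p p c.PRing} {N' P' : Matrix p p c.PRing}
    (hN : MatHasDerivAt N N' t) (hP : MatHasDerivAt P P' t) (h : ∀ᶠ s in 𝓝 t, N s * P s = 1)
    (h' : P t * N t = 1) : P' = -(P t * N' * P t) := by
  have h1 : N' * P t + N t * P' = 0 :=
    ((hN.mul hP).congr (P := fun _ => 1) (h.mono fun s hs => hs.symm)).unique (const 1)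
  have h2 := congrArg (fun Z => P t * Z) h1
  simp only [mul_add, ← mul_assoc, h', one_mul, mul_zero] at h2
  exact eq_neg_of_add_eq_zero_right h2

end MatHasDerivAt

/-! ### The derivative of the dressing along a flow -/

/-- The entries of `(N - x)⁻¹` depend differentiably on `N`, by Cramer's rule. -/
theorem exists_ratHasDerivAt_resolvent {n : Type*} [Fintype n] [DecidableEq n] {N : ℂ → Matrix n n ℂ}
    {N' : Matrix n n ℂ} {t : ℂ} (h : ∀ i j, HasDerivAt (fun s => N s i j) (N' i j) t) (i j : n) :
    ∃ f', RatHasDerivAt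
      (fun s => ((N s).map RatFunc.C - Matrix.scalar n RatFunc.X : Matrix n n (RatFunc ℂ))⁻¹ i j) f' t := by
  have hent : ∀ a b, ∃ f', RatHasDerivAt
      (fun s => ((N s).map RatFunc.C - Matrix.scalar n RatFunc.X : Matrix n n (RatFunc ℂ)) a b) f' t := by
    intro a b
    refine ⟨_, ((ratHasDerivAt_C (h a b)).add
      (ratHasDerivAt_const (-(Matrix.scalar n RatFunc.X a b)) t)).congr (Eventually.of_forall fun s => ?_)⟩
    rw [Matrix.sub_apply, Matrix.map_apply, sub_eq_add_neg]
  have hdet : ∀ A : ℂ → Matrix n n (RatFunc ℂ),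
      (∀ a b, ∃ f', RatHasDerivAt (fun s => A s a b) f' t) →
        ∃ f', RatHasDerivAt (fun s => (A s).det) f' t := by
    intro A hA
    have h1 : ∀ σ : Equiv.Perm n, ∃ f', RatHasDerivAt (fun s => ∏ a, A s (σ a) a) f' t :=
      fun σ => RatHasDerivAt.exists_prod fun a _ => hA (σ a) a
    choose g hg using h1
    simp only [Matrix.det_apply']
    exact ⟨_, RatHasDerivAt.sum fun σ _ => (ratHasDerivAt_const _ t).mul (hg σ)⟩
  obtain ⟨f, hf⟩ := hdet _ hent
  obtain ⟨g, hg⟩ := hf.exists_inv (FramedData.isUnit_det_sub_scalar_X (N t)).ne_zero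
  obtain ⟨k, hk⟩ := hdet
    (fun s => ((N s).map RatFunc.C - Matrix.scalar n RatFunc.X).updateRow j (Pi.single i 1)) (by
      intro a b
      by_cases ha : a = j
      · subst ha
        simp only [Matrix.updateRow_self]
        exact ⟨0, ratHasDerivAt_const _ t⟩
      · simp only [Matrix.updateRow_ne ha]
        exact hent a b)
  refine ⟨_, (hg.mul hk).congr (Eventually.of_forall fun s => ?_)⟩
  rw [Matrix.inv_def, Ring.inverse_eq_inv', Matrix.smul_apply, Matrix.adjugate_apply, smul_eq_mul]

namespace FramedData
variable {m : ℕ} [NeZero m] {α : ZMod m → ℕ} {d : ℕ} (c : CherednikParameters m)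
  {p : ℂ → FramedData α d} {q : FramedData α d} {t : ℂ}

theorem HasVelocityAt.opX (h : HasVelocityAt p q t) :
    MatHasDerivAt (fun s => (p s).opX c) (q.X.map c.ofC) t := by
  have h1 := (MatHasDerivAt.map_ofC (c := c) h.1).sub
    (MatHasDerivAt.const (Matrix.scalar (VIndex α) (c.ofRat RatFunc.X)))
  rw [sub_zero] at h1
  exact h1

theorem HasVelocityAt.resX (h : HasVelocityAt p q t) :
    MatHasDerivAt (fun s => (p s).resX c) (-((p t).resX c * q.X.map c.ofC * (p t).resX c)) t := by
  choose f hf using exists_ratHasDerivAt_resolvent h.1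
  have h1 : MatHasDerivAt (fun s => (p s).resX c) ((Matrix.of f).map c.ofRat) t :=
    fun i j => PHasDerivAt.ofRat (hf i j)
  rwa [(h.opX c).inv_eq h1 (Eventually.of_forall fun s => opX_mul_resX c (p s))
    (resX_mul_opX c (p t))] at h1

theorem HasVelocityAt.resY (h : HasVelocityAt p q t) (hq : q.Y = 0) :
    MatHasDerivAt (fun s => (p s).resY c) 0 t := by
  have hpow : ∀ (k : ℕ) (i j : VIndex α), HasDerivAt (fun s => ((p s).Y ^ k) i j) 0 t := by
    intro k
    induction k with
    | zero => intro i j; simpa using hasDerivAt_const t _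
    | succ k ih =>
      intro i j
      simp only [pow_succ, Matrix.mul_apply]
      have := HasDerivAt.fun_sum (u := Finset.univ) fun x _ => (ih i x).fun_mul (h.2.1 x j)
      simpa [hq] using this
  intro i j
  refine ⟨⟨-1, Eventually.of_forall fun s => matBdd_resY c (p s) i j, fun _ _ => rfl⟩, fun n γ => ?_⟩
  have h2 : ∀ s, ((p s).resY c i j).coeff n = if n < 0 then
      (SkewMonoidAlgebra.single 1 (RatFunc.C (-((p s).Y ^ (-n - 1).toNat) i j)) : CrossedProduct m)
        else 0 := fun s => coeff_resY c (p s) i j n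
  simp only [h2]
  split_ifs
  · classical
    simp only [SkewMonoidAlgebra.coeff_single_apply]
    split_ifs
    · have := ratHasDerivAt_C (hpow (-n - 1).toNat i j).fun_neg
      simpa using this
    · exact ratHasDerivAt_const 0 t
  · exact ratHasDerivAt_const 0 t

theorem HasVelocityAt.rowW (h : HasVelocityAt p q t) :
    MatHasDerivAt (fun s => (p s).rowW c) (q.rowW c) t :=
  (MatHasDerivAt.map_ofC h.2.2.2).mul_const _

theorem HasVelocityAt.colV (h : HasVelocityAt p q t) :
    MatHasDerivAt (fun s => (p s).colV c) (q.colV c) t :=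
  (MatHasDerivAt.map_ofC h.2.2.1).const_mul _

theorem HasVelocityAt.dressing (h : HasVelocityAt p q t) (hq : q.Y = 0) :
    MatHasDerivAt (fun s => (p s).dressing c) (dDressing c (p t) q) t := by
  have h1 := (MatHasDerivAt.const (t := t) (1 : PMat c d)).sub
    ((((h.rowW c).mul (h.resX c)).mul (h.resY c hq)).mul (h.colV c))
  have h2 : dDressing c (p t) q = 0 - (((q.rowW c * (p t).resX c +
      (p t).rowW c * -((p t).resX c * q.X.map c.ofC * (p t).resX c)) * (p t).resY c +
        (p t).rowW c * (p t).resX c * (0 : Matrix (VIndex α) (VIndex α) c.PRing)) * (p t).colV c +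
          (p t).rowW c * (p t).resX c * (p t).resY c * q.colV c) := by
    rw [dDressing]
    simp only [Matrix.mul_zero, add_zero, Matrix.add_mul, Matrix.mul_neg, Matrix.neg_mul, Matrix.mul_assoc]
    abel
  rw [h2]
  exact h1.congr (Eventually.of_forall fun s => dressing_eq c (p s))

theorem HasVelocityAt.exists_dressingInv (h : HasVelocityAt p q t) (hq : q.Y = 0) :
    ∃ N', MatHasDerivAt (fun s => (p s).dressingInv c) N' t :=
  ⟨_, (MatHasDerivAt.const (t := t) (1 : PMat c d)).add
    ((((h.rowW c).mul (h.resY c hq)).mul (h.resX c)).mul (h.colV c))⟩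

/-- Along an integral curve of the simplified vector field the Lax pair satisfies the hierarchy. -/
theorem hierarchyEquationsAt_laxPair {k : ℕ} {β : Fin d}
    (hp : ∀ s, (p s).IsRep ∧ (p s).MomentRelation c) (h : HasVelocityAt p (vel k β (p t)) t) :
    HierarchyEquationsAt k β (fun s => (p s).laxPair c) t := by
  have hY : (vel k β (p t)).Y = 0 := rfl
  have hM := h.dressing c hY
  obtain ⟨N', hN⟩ := h.exists_dressingInv c hY
  have h1 := dressing_mul_dressingInv c (hp t).1 (hp t).2
  have h2 := dressingInv_mul_dressing c (hp t).1 (hp t).2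
  have hN' := hM.inv_eq hN (Eventually.of_forall fun s => dressing_mul_dressingInv c (hp s).1 (hp s).2) h2
  -- conjugates of constants move by the commutator with `Ṁ M⁻¹`
  have key : ∀ U : PMat c d, MatHasDerivAt (fun s => (p s).dressing c * U * (p s).dressingInv c)
      (dDressing c (p t) (vel k β (p t)) * (p t).dressingInv c *
        ((p t).dressing c * U * (p t).dressingInv c) - (p t).dressing c * U * (p t).dressingInv c *
          (dDressing c (p t) (vel k β (p t)) * (p t).dressingInv c)) t := by
    intro U
    have h3 := (hM.mul_const U).mul hN
    rw [hN'] at h3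
    convert h3 using 1
    generalize dDressing c (p t) (vel k β (p t)) = Dd
    generalize (p t).dressing c = M at *
    generalize (p t).dressingInv c = M' at *
    have h4 : Dd * M' * (M * U * M') = Dd * U * M' := by
      rw [mul_assoc M, mul_assoc Dd, ← mul_assoc M', h2, one_mul, mul_assoc]
    rw [h4]
    noncomm_ring
  have hpos := posPart_lax_pow_mul c (hp t).1 (hp t).2 k β
  have hpt := isHierarchyPoint_laxPair c (hp t).1 (hp t).2
  have hcL : ((p t).laxPair c).1 ^ k * ((p t).laxPair c).2 β * ((p t).laxPair c).1 =
      ((p t).laxPair c).1 * (((p t).laxPair c).1 ^ k * ((p t).laxPair c).2 β) := by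
    rw [mul_assoc, ← hpt.comm, ← mul_assoc, ← mul_assoc, ← pow_succ, ← pow_succ']
  have hRR : ∀ γ, ((p t).laxPair c).2 β * ((p t).laxPair c).2 γ =
      ((p t).laxPair c).2 γ * ((p t).laxPair c).2 β := by
    intro γ
    by_cases hγ : β = γ
    · rw [hγ]
    · rw [hpt.mul_of_ne β γ hγ, hpt.mul_of_ne γ β (Ne.symm hγ)]
  have hcR : ∀ γ, ((p t).laxPair c).1 ^ k * ((p t).laxPair c).2 β * ((p t).laxPair c).2 γ =
      ((p t).laxPair c).2 γ * (((p t).laxPair c).1 ^ k * ((p t).laxPair c).2 β) := by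
    intro γ
    have h3 : Commute (((p t).laxPair c).1 ^ k) (((p t).laxPair c).2 γ) :=
      Commute.pow_left (hpt.comm γ) k
    rw [mul_assoc, hRR, ← mul_assoc, h3.eq, mul_assoc]
  have hL : ∀ s, ((p s).laxPair c).1 = (p s).dressing c * Matrix.scalar (Fin d) c.y * (p s).dressingInv c :=
    fun s => by rw [laxPair_eq c (hp s).1 (hp s).2]
  have hR : ∀ s γ, ((p s).laxPair c).2 γ = (p s).dressing c * PMat.E γ * (p s).dressingInv c :=
    fun s γ => by rw [laxPair_eq c (hp s).1 (hp s).2]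
  refine ⟨?_, fun γ => ?_⟩
  · have h3 := (key (Matrix.scalar (Fin d) c.y)).congr (Eventually.of_forall hL)
    rw [hpos, add_mul, mul_add, hcL, add_sub_add_left_eq_sub]
    rw [← hL] at h3
    exact h3.toPMat
  · have h3 := (key (PMat.E γ)).congr (Eventually.of_forall fun s => hR s γ)
    rw [hpos, add_mul, mul_add, hcR, add_sub_add_left_eq_sub]
    rw [← hR] at h3
    exact h3.toPMat

end FramedData

/-! ### Entrywise derivatives of complex matrices -/

/-- Entrywise differentiation of a curve of complex matrices. -/
def EntryHasDerivAt {p q : Type*} (N : ℂ → Matrix p q ℂ) (N' : Matrix p q ℂ) (t : ℂ) : Prop :=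
  ∀ i j, HasDerivAt (fun s => N s i j) (N' i j) t

namespace EntryHasDerivAt
variable {p q r : Type*} {t : ℂ}

theorem const (N : Matrix p q ℂ) : EntryHasDerivAt (fun _ => N) 0 t := fun _ _ => hasDerivAt_const _ _

theorem mul [Fintype q] {N : ℂ → Matrix p q ℂ} {P : ℂ → Matrix q r ℂ} {N' : Matrix p q ℂ}
    {P' : Matrix q r ℂ} (hN : EntryHasDerivAt N N' t) (hP : EntryHasDerivAt P P' t) :
    EntryHasDerivAt (fun s => N s * P s) (N' * P t + N t * P') t := fun i j => by
  simp only [Matrix.mul_apply, Matrix.add_apply, ← Finset.sum_add_distrib]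
  exact HasDerivAt.fun_sum fun x _ => (hN i x).fun_mul (hP x j)

theorem mul_const [Fintype q] {N : ℂ → Matrix p q ℂ} {N' : Matrix p q ℂ} (hN : EntryHasDerivAt N N' t)
    (P : Matrix q r ℂ) : EntryHasDerivAt (fun s => N s * P) (N' * P) t := by
  simpa only [Matrix.mul_zero, add_zero] using hN.mul (const (t := t) P)

theorem const_mul [Fintype q] {N : ℂ → Matrix q r ℂ} {N' : Matrix q r ℂ} (hN : EntryHasDerivAt N N' t)
    (P : Matrix p q ℂ) : EntryHasDerivAt (fun s => P * N s) (P * N') t := by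
  simpa only [Matrix.zero_mul, zero_add] using (const (t := t) P).mul hN

theorem pow [Fintype p] [DecidableEq p] {N : ℂ → Matrix p p ℂ} {N' : Matrix p p ℂ}
    (hN : EntryHasDerivAt N N' t) (k : ℕ) : EntryHasDerivAt (fun s => N s ^ k)
      (∑ l ∈ Finset.range k, N t ^ l * N' * N t ^ (k - 1 - l)) t := by
  induction k with
  | zero => simpa using const (t := t) (1 : Matrix p p ℂ)
  | succ k ih =>
    simp only [pow_succ]
    convert ih.mul hN using 1
    rw [Finset.sum_range_succ, Finset.sum_mul]
    congr 1
    · refine Finset.sum_congr rfl fun l hl => ?_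
      rw [Finset.mem_range] at hl
      have : k + 1 - 1 - l = k - 1 - l + 1 := by omega
      rw [this, pow_succ]
      simp only [mul_assoc]
    · simp

theorem line (N S : Matrix p q ℂ) : EntryHasDerivAt (fun s : ℂ => N + s • S) S 0 := fun i j => by
  simpa using ((hasDerivAt_id (0 : ℂ)).mul_const (S i j)).const_add (N i j)

end EntryHasDerivAt

/-! ### The Hamiltonian vector fields -/

namespace FramedData
variable {m : ℕ} [NeZero m] {α : ZMod m → ℕ} {d : ℕ}

/-- On representations the sum over the vertices collapses: `H_{k,β} = -(w Y^k v)_{ββ}`. -/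
theorem ham_eq {p : FramedData α d} (hp : IsHomog (-1) p.Y) (k : ℕ) (β : Fin d) :
    ham k β p = -(p.w * p.Y ^ k * p.v) β β := by
  have h : ∀ i : ZMod m, p.Y ^ k * e α (i + k) = e α i * p.Y ^ k := by
    intro i
    ext a b
    rw [e_mul_apply, mul_e_apply]
    by_cases hab : a.1 = b.1 + (k : ZMod m) * -1
    · have : (b.1 = i + k) = (a.1 = i) := propext
        ⟨fun h' => by rw [hab, h']; ring, fun h' => by rw [← h', hab]; ring⟩
      simp only [this]
    · rw [hp.pow k a b hab, ite_self, ite_self]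
  have he : ∑ i : ZMod m, e α i = 1 := by
    have := sum_smul_e (α := α) fun _ => (1 : ℂ)
    simpa using this
  have he2 : ∀ i : ZMod m, e α i * e α i = e α i := by
    intro i
    rw [e, Matrix.diagonal_mul_diagonal]
    congr 1; funext a; split_ifs <;> simp
  have h2 : ∀ i : ZMod m, Matrix.single β β (1 : ℂ) * p.wAt i * p.Y ^ k * p.vAt (i + k) =
      Matrix.single β β (1 : ℂ) * p.w * e α i * (p.Y ^ k * p.v) := by
    intro i
    rw [wAt, vAt, Matrix.mul_assoc _ (p.Y ^ k), ← Matrix.mul_assoc (p.Y ^ k), h]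
    simp only [← Matrix.mul_assoc]
    rw [Matrix.mul_assoc (_ * p.w) (e α i), he2]
  rw [ham, ← Matrix.trace_sum]
  simp only [h2]
  rw [← Matrix.sum_mul, ← Matrix.mul_sum, he, Matrix.mul_one, Matrix.mul_assoc, Matrix.trace_single_mul,
    one_smul, Matrix.mul_assoc]

theorem dX_ham (k : ℕ) (β : Fin d) (p : FramedData α d) (a b : VIndex α) : dX a b (ham k β) p = 0 :=
  deriv_const (0 : ℂ) (ham k β p)

theorem dv_ham {p : FramedData α d} (hp : IsHomog (-1) p.Y) (k : ℕ) (β γ : Fin d) (a : VIndex α) :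
    dv a γ (ham k β) p = if γ = β then -(p.w * p.Y ^ k) β a else 0 := by
  have h := ((EntryHasDerivAt.line p.v (Matrix.single a γ 1)).const_mul (p.w * p.Y ^ k) β β).fun_neg.deriv
  rw [dv]
  refine Eq.trans ?_ (h.trans ?_)
  · congr 1; funext s; exact ham_eq (p := { p with v := p.v + s • Matrix.single a γ 1 }) hp k β
  · split_ifs with hγ
    · subst hγ; rw [Matrix.mul_single_apply_same, mul_one]
    · rw [Matrix.mul_single_apply_of_ne _ _ _ _ _ (Ne.symm hγ), neg_zero]

theorem dw_ham {p : FramedData α d} (hp : IsHomog (-1) p.Y) (k : ℕ) (β γ : Fin d) (a : VIndex α) :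
    dw γ a (ham k β) p = if γ = β then -(p.Y ^ k * p.v) a β else 0 := by
  have h := ((EntryHasDerivAt.line p.w (Matrix.single γ a 1)).mul_const (p.Y ^ k * p.v) β β).fun_neg.deriv
  rw [dw]
  refine Eq.trans ?_ (h.trans ?_)
  · congr 1; funext s
    refine (ham_eq (p := { p with w := p.w + s • Matrix.single γ a 1 }) hp k β).trans ?_
    rw [Matrix.mul_assoc]
  · split_ifs with hγ
    · subst hγ; rw [Matrix.single_mul_apply_same, one_mul]
    · rw [Matrix.single_mul_apply_of_ne _ _ _ _ _ (Ne.symm hγ), neg_zero]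

theorem flowK_apply (k : ℕ) (β : Fin d) (p : FramedData α d) (a b : VIndex α) :
    flowK k β p a b =
      ∑ l ∈ Finset.range k, (p.Y ^ l * p.v) a β * (p.w * p.Y ^ (k - 1 - l)) β b := by
  rw [flowK, Matrix.sum_apply]
  refine Finset.sum_congr rfl fun l _ => ?_
  have h : p.Y ^ l * (p.v * Matrix.single β β (1 : ℂ) * p.w) * p.Y ^ (k - 1 - l) =
      p.Y ^ l * p.v * (Matrix.single β β (1 : ℂ) * (p.w * p.Y ^ (k - 1 - l))) := by
    simp only [Matrix.mul_assoc]
  rw [h, Matrix.mul_apply, Finset.sum_eq_single β]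
  · rw [Matrix.single_mul_apply_same, one_mul]
  · intro γ _ hγ
    rw [Matrix.single_mul_apply_of_ne _ _ _ _ _ hγ, mul_zero]
  · intro h; exact absurd (Finset.mem_univ _) h

theorem dY_ham {p : FramedData α d} (hp : IsHomog (-1) p.Y) (k : ℕ) (β : Fin d) {a b : VIndex α}
    (hab : a.1 = b.1 + 1) : dY b a (ham k β) p = -flowK k β p a b := by
  have h := ((((EntryHasDerivAt.line p.Y (Matrix.single b a 1)).pow k).const_mul p.w).mul_const
    p.v β β).fun_neg.deriv
  have hs : ∀ s : ℂ, IsHomog (-1) (p.Y + s • Matrix.single b a (1 : ℂ)) := by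
    intro s
    refine hp.add fun a' b' h' => ?_
    rw [Matrix.smul_apply, Matrix.single_apply, if_neg, smul_zero]
    rintro ⟨rfl, rfl⟩
    exact h' (by rw [hab]; ring)
  rw [dY]
  refine Eq.trans ?_ (h.trans ?_)
  · congr 1; funext s; exact ham_eq (p := { p with Y := p.Y + s • Matrix.single b a 1 }) (hs s) k β
  · rw [flowK_apply, zero_smul, add_zero, ← Finset.sum_range_reflect, Matrix.mul_sum, Matrix.sum_mul,
      Matrix.sum_apply]
    congr 1
    refine Finset.sum_congr rfl fun l hl => ?_
    rw [Finset.mem_range] at hl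
    have h1 : k - 1 - (k - 1 - l) = l := by omega
    have h2 : p.w * (p.Y ^ (k - 1 - l) * Matrix.single b a (1 : ℂ) * p.Y ^ l) * p.v =
        p.w * p.Y ^ (k - 1 - l) * (Matrix.single b a (1 : ℂ) * (p.Y ^ l * p.v)) := by
      simp only [Matrix.mul_assoc]
    rw [h1, h2, Matrix.mul_apply, Finset.sum_eq_single b]
    · rw [Matrix.single_mul_apply_same, one_mul, mul_comm]
    · intro x _ hx
      rw [Matrix.single_mul_apply_of_ne _ _ _ _ _ hx, mul_zero]
    · intro h; exact absurd (Finset.mem_univ _) h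

theorem hamVec_ham {p : FramedData α d} (hp : p.IsRep) (k : ℕ) (β : Fin d) :
    hamVec (ham k β) p = vel k β p := by
  classical
  have hY := ((isRep_iff p).1 hp).2
  have hline : ∀ {x y : Type} [DecidableEq x] [DecidableEq y] (N : Matrix x y ℂ) (i i' : x) (j j' : y),
      deriv (fun s : ℂ => (N + s • Matrix.single i j 1 : Matrix x y ℂ) i' j') 0 = if i = i' ∧ j = j' then 1 else 0 := by
    intro x y _ _ N i i' j j'
    rw [(EntryHasDerivAt.line N (Matrix.single i j 1) i' j').deriv, Matrix.single_apply]
  have hc : ∀ z : ℂ, deriv (fun _ : ℂ => z) 0 = 0 := fun z => deriv_const (0 : ℂ) z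
  ext1
  · ext a b
    have h1 : ∀ a' b', dX a' b' (fun q : FramedData α d => q.X a b) p =
        if a' = a ∧ b' = b then 1 else 0 := fun a' b' => hline p.X a' a b' b
    have h2 : ∀ a' b', dY a' b' (fun q : FramedData α d => q.X a b) p = 0 := fun _ _ => hc _
    have h3 : ∀ a' γ, dv a' γ (fun q : FramedData α d => q.X a b) p = 0 := fun _ _ => hc _
    have h4 : ∀ γ a', dw γ a' (fun q : FramedData α d => q.X a b) p = 0 := fun _ _ => hc _
    simp only [hamVec, Matrix.of_apply, poisson, h1, h2, h3, h4, zero_mul, sub_zero,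
      Finset.sum_const_zero, add_zero, ite_mul, one_mul, vel, Matrix.neg_apply, hpart_apply]
    rw [Finset.sum_eq_single a, Finset.sum_eq_single b]
    · simp only [and_self, if_true]
      split_ifs with h
      · exact dY_ham hY k β h
      · exact neg_zero.symm
    · intro b' _ hb'; simp [hb']
    · intro h; exact absurd (Finset.mem_univ _) h
    · intro a' _ ha'; simp [ha']
    · intro h; exact absurd (Finset.mem_univ _) h
  · ext a b
    have h1 : ∀ a' b', dX a' b' (fun q : FramedData α d => q.Y a b) p = 0 := fun _ _ => hc _
    have h3 : ∀ a' γ, dv a' γ (fun q : FramedData α d => q.Y a b) p = 0 := fun _ _ => hc _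
    have h4 : ∀ γ a', dw γ a' (fun q : FramedData α d => q.Y a b) p = 0 := fun _ _ => hc _
    simp [hamVec, poisson, h1, h3, h4, dX_ham, vel]
  · ext a γ
    have h1 : ∀ a' b', dX a' b' (fun q : FramedData α d => q.v a γ) p = 0 := fun _ _ => hc _
    have h2 : ∀ a' b', dY a' b' (fun q : FramedData α d => q.v a γ) p = 0 := fun _ _ => hc _
    have h3 : ∀ a' γ', dv a' γ' (fun q : FramedData α d => q.v a γ) p =
        if a' = a ∧ γ' = γ then 1 else 0 := fun a' γ' => hline p.v a' a γ' γ
    have h4 : ∀ γ' a', dw γ' a' (fun q : FramedData α d => q.v a γ) p = 0 := fun _ _ => hc _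
    simp only [hamVec, Matrix.of_apply, poisson, h1, h2, h3, h4, zero_mul, sub_zero, ite_self,
      Finset.sum_const_zero, zero_add, ite_mul, one_mul, vel, Matrix.neg_apply]
    rw [Finset.sum_eq_single a, Finset.sum_eq_single γ]
    · rw [if_pos ⟨rfl, rfl⟩, dw_ham hY]
      split_ifs with h
      · subst h; rw [Matrix.mul_single_apply_same, mul_one]
      · rw [Matrix.mul_single_apply_of_ne _ _ _ _ _ h, neg_zero]
    · intro b' _ hb'; simp [hb']
    · intro h; exact absurd (Finset.mem_univ _) h
    · intro a' _ ha'; simp [ha']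
    · intro h; exact absurd (Finset.mem_univ _) h
  · ext γ a
    have h1 : ∀ a' b', dX a' b' (fun q : FramedData α d => q.w γ a) p = 0 := fun _ _ => hc _
    have h2 : ∀ a' b', dY a' b' (fun q : FramedData α d => q.w γ a) p = 0 := fun _ _ => hc _
    have h3 : ∀ a' γ', dv a' γ' (fun q : FramedData α d => q.w γ a) p = 0 := fun _ _ => hc _
    have h4 : ∀ γ' a', dw γ' a' (fun q : FramedData α d => q.w γ a) p =
        if γ' = γ ∧ a' = a then 1 else 0 := fun γ' a' => hline p.w γ' γ a' a
    simp only [hamVec, Matrix.of_apply, poisson, h1, h2, h3, h4, zero_mul, sub_zero, ite_self,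
      Finset.sum_const_zero, zero_add, zero_sub, ite_mul, one_mul, vel]
    rw [Finset.sum_eq_single a, Finset.sum_eq_single γ]
    · rw [if_pos ⟨rfl, rfl⟩, dv_ham hY, Matrix.mul_assoc]
      split_ifs with h
      · subst h; rw [Matrix.single_mul_apply_same, one_mul, neg_neg]
      · rw [Matrix.single_mul_apply_of_ne _ _ _ _ _ h, neg_zero]
    · intro b' _ hb'; simp [hb']
    · intro h; exact absurd (Finset.mem_univ _) h
    · intro a' _ ha'; simp [ha']
    · intro h; exact absurd (Finset.mem_univ _) h

theorem sum_vAt (p : FramedData α d) (f : ZMod m ≃ ZMod m) : ∑ i, p.vAt (f i) = p.v := by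
  have he := sum_smul_e (α := α) fun _ => (1 : ℂ)
  simp only [one_smul, Matrix.diagonal_one] at he
  rw [Equiv.sum_comp f p.vAt]
  simp only [vAt]
  rw [← Matrix.sum_mul, he, Matrix.one_mul]

theorem sum_wAt (p : FramedData α d) (f : ZMod m ≃ ZMod m) : ∑ i, p.wAt (f i) = p.w := by
  have he := sum_smul_e (α := α) fun _ => (1 : ℂ)
  simp only [one_smul, Matrix.diagonal_one] at he
  rw [Equiv.sum_comp f p.wAt]
  simp only [wAt]
  rw [← Matrix.mul_sum, he, Matrix.mul_one]

theorem flowField_eq {p : FramedData α d} (hp : p.IsRep) (k : ℕ) (β : Fin d) :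
    flowField k β p = vel k β p := by
  have hY := ((isRep_iff p).1 hp).2
  ext1
  · rw [flowField, vel, neg_inj, Finset.sum_comm, flowK, map_sum]
    refine Finset.sum_congr rfl fun l hl => ?_
    rw [Finset.mem_range] at hl
    set j := k - 1 - l with hj
    have hk : (k : ZMod m) = 1 + l + j := by
      have : k = 1 + l + j := by omega
      conv_lhs => rw [this]
      push_cast; ring
    have hj' : k - l - 1 = j := by omega
    -- `e_i u e_{i-k}` has only the block of degree `k`, which `Y^l` and `Y^j` shift to degree `1`
    have h1 : ∑ i : ZMod m, p.vAt i * Matrix.single β β (1 : ℂ) * p.wAt (i - k) =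
        hpart (k : ZMod m) (p.v * Matrix.single β β (1 : ℂ) * p.w) := by
      ext a b
      rw [Matrix.sum_apply, hpart_apply]
      have : ∀ i, (p.vAt i * Matrix.single β β (1 : ℂ) * p.wAt (i - k)) a b =
          if a.1 = i then (if b.1 = i - k then (p.v * Matrix.single β β (1 : ℂ) * p.w) a b else 0)
            else 0 := by
        intro i
        rw [vAt, wAt, Matrix.mul_assoc, Matrix.mul_assoc, e_mul_apply, ← Matrix.mul_assoc,
          ← Matrix.mul_assoc, mul_e_apply]
      simp only [this, Finset.sum_ite_eq, Finset.mem_univ, if_true, eq_sub_iff_add_eq]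
      simp only [eq_comm]
    have h2 : ∑ i : ZMod m, p.Y ^ l * p.vAt i * Matrix.single β β (1 : ℂ) * p.wAt (i - k) *
        p.Y ^ (k - l - 1) = p.Y ^ l * hpart (k : ZMod m) (p.v * Matrix.single β β (1 : ℂ) * p.w) *
          p.Y ^ j := by
      rw [← h1, hj', Matrix.mul_sum, Matrix.sum_mul]
      refine Finset.sum_congr rfl fun i _ => ?_
      simp only [Matrix.mul_assoc]
    rw [h2, (hY.pow l).mul_hpart, (hY.pow j).hpart_mul]
    have h3 : (l : ZMod m) * -1 + k + j * -1 = 1 := by rw [hk]; ring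
    rw [h3]
  · rfl
  · rw [flowField, vel, Finset.sum_neg_distrib, ← Matrix.sum_mul, ← Matrix.mul_sum]
    have := sum_vAt p (Equiv.addRight (k : ZMod m))
    simp only [Equiv.coe_addRight] at this
    rw [this]
  · rw [flowField, vel, ← Matrix.sum_mul, ← Matrix.mul_sum]
    have := sum_wAt p (Equiv.subRight (k : ZMod m))
    simp only [Equiv.subRight_apply] at this
    rw [this]

theorem poisson_ham_ham {p : FramedData α d} (hp : p.IsRep) (k l : ℕ) (β γ : Fin d) :
    poisson (ham k β) (ham l γ) p = 0 := by
  have hY := ((isRep_iff p).1 hp).2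
  -- the Hamiltonians do not involve `X`, so only the brackets of `v` with `w` contribute
  simp only [poisson, dX_ham, dv_ham hY, dw_ham hY, zero_mul, mul_zero, sub_zero, ite_self,
    Finset.sum_const_zero, zero_add]
  by_cases h : β = γ
  · subst h
    have h1 : (p.w * p.Y ^ k * (p.Y ^ l * p.v)) β β = (p.w * p.Y ^ l * (p.Y ^ k * p.v)) β β := by
      simp only [Matrix.mul_assoc, ← Matrix.mul_assoc (p.Y ^ _) (p.Y ^ _), ← pow_add, add_comm]
    rw [Matrix.mul_apply, Matrix.mul_apply] at h1
    rw [← sub_eq_zero, ← Finset.sum_sub_distrib] at h1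
    rw [← h1]
    refine Finset.sum_congr rfl fun a _ => ?_
    rw [Finset.sum_eq_single β]
    · simp only [if_true]; ring
    · intro δ _ hδ; simp [hδ]
    · intro h; exact absurd (Finset.mem_univ _) h
  · refine Finset.sum_eq_zero fun a _ => Finset.sum_eq_zero fun δ _ => ?_
    by_cases h1 : δ = β
    · have h2 : ¬ δ = γ := fun h2 => h (h1.symm.trans h2)
      simp [h1, h]
    · simp [h1]

/-! ### Invariance under `GL(α)` -/

theorem isHomog_block (g : ∀ i : ZMod m, GL (Fin (α i)) ℂ) : IsHomog 0 (block g) := by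
  intro a b h
  rw [add_zero] at h
  obtain ⟨i, a⟩ := a
  obtain ⟨j, b⟩ := b
  exact Matrix.blockDiagonal'_apply_ne _ _ _ h

theorem block_mul_block_inv (g : ∀ i : ZMod m, GL (Fin (α i)) ℂ) : block g * block g⁻¹ = 1 := by
  rw [← block_mul, mul_inv_cancel, block_one]

theorem block_inv_mul_block (g : ∀ i : ZMod m, GL (Fin (α i)) ℂ) : block g⁻¹ * block g = 1 := by
  rw [← block_mul, inv_mul_cancel, block_one]

theorem IsHomog.e_mul {N : Matrix (VIndex α) (VIndex α) ℂ} (hN : IsHomog 0 N) (i : ZMod m) :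
    e α i * N = N * e α i := by
  ext a b
  rw [e_mul_apply, mul_e_apply]
  by_cases h : a.1 = b.1
  · rw [h]
  · rw [hN a b (by rwa [add_zero]), ite_self, ite_self]

theorem conj_block_pow (g : ∀ i : ZMod m, GL (Fin (α i)) ℂ) (N : Matrix (VIndex α) (VIndex α) ℂ)
    (k : ℕ) : (block g * N * block g⁻¹) ^ k = block g * N ^ k * block g⁻¹ := by
  induction k with
  | zero => rw [pow_zero, pow_zero, mul_one, block_mul_block_inv]
  | succ k ih => rw [pow_succ, ih, conj_mul_conj (block_inv_mul_block g), pow_succ]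

theorem ham_smul (k : ℕ) (β : Fin d) (g : ∀ i : ZMod m, GL (Fin (α i)) ℂ) (p : FramedData α d) :
    ham k β (g • p) = ham k β p := by
  refine congrArg Neg.neg (Finset.sum_congr rfl fun i _ => congrArg Matrix.trace ?_)
  change _ * (p.w * block g⁻¹ * e α i) * (block g * p.Y * block g⁻¹) ^ k *
    (e α (i + k) * (block g * p.v)) = _
  rw [conj_block_pow, ← Matrix.mul_assoc (e α _), (isHomog_block g).e_mul, Matrix.mul_assoc p.w,
    ← (isHomog_block g⁻¹).e_mul, wAt, vAt]
  simp only [Matrix.mul_assoc]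
  rw [← Matrix.mul_assoc (block g⁻¹) (block g), block_inv_mul_block, Matrix.one_mul,
    ← Matrix.mul_assoc (block g⁻¹) (block g), block_inv_mul_block, Matrix.one_mul]

variable (c : CherednikParameters m)

/-- Both resolvents are conjugated by `g`, which preserves the grading and so commutes with the idempotent
in `V` and `W`. -/
theorem dressing_smul (g : ∀ i : ZMod m, GL (Fin (α i)) ℂ) (p : FramedData α d) :
    (g • p).dressing c = p.dressing c := by
  set G := (block g).map c.ofC with hG
  set G' := (block g⁻¹).map c.ofC with hG'
  have h1 : G' * G = 1 := by
    rw [hG, hG', ← Matrix.map_mul, block_inv_mul_block, Matrix.map_one _ (map_zero _) (map_one _)]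
  have h2 : G * G' = 1 := by
    rw [hG, hG', ← Matrix.map_mul, block_mul_block_inv, Matrix.map_one _ (map_zero _) (map_one _)]
  have hs : ∀ u : c.PRing, G * Matrix.scalar (VIndex α) u * G' = Matrix.scalar (VIndex α) u := by
    intro u
    rw [hG, ← c.scalar_mul_map, Matrix.mul_assoc, ← hG, h2, Matrix.mul_one]
  have hX : (g • p).opX c = G * p.opX c * G' := by
    change (block g * p.X * block g⁻¹).map c.ofC - _ = G * (p.X.map c.ofC - _) * G'
    rw [Matrix.map_mul, Matrix.map_mul, mul_sub, sub_mul, hs]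
  have hY : (g • p).opY c = G * p.opY c * G' := by
    change (block g * p.Y * block g⁻¹).map c.ofC - _ = G * (p.Y.map c.ofC - _) * G'
    rw [Matrix.map_mul, Matrix.map_mul, mul_sub, sub_mul, hs]
  have hinv : ∀ {A A' B B' : Matrix (VIndex α) (VIndex α) c.PRing}, A * A' = 1 → B' * B = 1 →
      B = G * A * G' → B' = G * A' * G' := by
    intro A A' B B' hA hB hBA
    have h3 : B * (G * A' * G') = 1 := by rw [hBA, conj_mul_conj h1, hA, mul_one, h2]
    rw [← one_mul (G * A' * G'), ← hB, mul_assoc, h3, mul_one]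
  have hX' : (g • p).resX c = G * p.resX c * G' := hinv (opX_mul_resX c p) (resX_mul_opX c _) hX
  have hY' : (g • p).resY c = G * p.resY c * G' := hinv (opY_mul_resY c p) (resY_mul_opY c _) hY
  have hW : (g • p).rowW c = p.rowW c * G' := by
    change (p.w * block g⁻¹).map c.ofC * _ = p.w.map c.ofC * _ * G'
    rw [Matrix.map_mul, Matrix.mul_assoc, (isHomog_block g⁻¹).map_mul_gr, sub_zero, Matrix.mul_assoc]
  have hV : (g • p).colV c = G * p.colV c := by
    change _ * (block g * p.v).map c.ofC = G * (_ * p.v.map c.ofC)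
    rw [Matrix.map_mul, ← Matrix.mul_assoc, ← Matrix.mul_assoc, hG, (isHomog_block g).map_mul_gr, sub_zero]
  rw [dressing_eq, dressing_eq, hX', hY', hW, hV]
  have hc : ∀ {q : Type} (Z : Matrix (VIndex α) q c.PRing), G' * (G * Z) = Z := by
    intro q Z
    rw [← Matrix.mul_assoc, h1, Matrix.one_mul]
  simp only [Matrix.mul_assoc, hc]

theorem laxPair_smul (g : ∀ i : ZMod m, GL (Fin (α i)) ℂ) (p : FramedData α d) :
    (g • p).laxPair c = p.laxPair c := by
  rw [laxPair, laxPair, dressing_smul]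

end FramedData

/-! ### Exponentials of matrices -/

section Exponential
variable {n : Type*} [Fintype n] [DecidableEq n]

/-- The exponential depends only on the topology of the algebra of matrices, so that any
submultiplicative norm may be used to study it. -/
theorem Matrix.semiconjBy_exp {a N N' : Matrix n n ℂ} (h : SemiconjBy a N N') :
    SemiconjBy a (NormedSpace.exp N) (NormedSpace.exp N') := by
  let : NormedRing (Matrix n n ℂ) := Matrix.linftyOpNormedRing
  let : NormedAlgebra ℂ (Matrix n n ℂ) := Matrix.linftyOpNormedAlgebra
  have : CompleteSpace (Matrix n n ℂ) := FiniteDimensional.complete ℂ _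
  let : NormedAlgebra ℚ (Matrix n n ℂ) := NormedAlgebra.restrictScalars ℚ ℂ _
  exact h.exp_right

theorem Matrix.map_exp_of_continuous {l : Type*} [Fintype l] [DecidableEq l]
    (f : Matrix n n ℂ →ₐ[ℂ] Matrix l l ℂ) (hf : Continuous f) (N : Matrix n n ℂ) :
    f (NormedSpace.exp N) = NormedSpace.exp (f N) := by
  let : NormedRing (Matrix n n ℂ) := Matrix.linftyOpNormedRing
  let : NormedAlgebra ℂ (Matrix n n ℂ) := Matrix.linftyOpNormedAlgebra
  have : CompleteSpace (Matrix n n ℂ) := FiniteDimensional.complete ℂ _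
  let : NormedAlgebra ℚ (Matrix n n ℂ) := NormedAlgebra.restrictScalars ℚ ℂ _
  let : NormedRing (Matrix l l ℂ) := Matrix.linftyOpNormedRing
  exact NormedSpace.map_exp f hf N

theorem Matrix.hasDerivAt_exp_smul (N : Matrix n n ℂ) (t : ℂ) :
    EntryHasDerivAt (fun s : ℂ => NormedSpace.exp (s • N)) (N * NormedSpace.exp (t • N)) t := by
  let : NormedRing (Matrix n n ℂ) := Matrix.linftyOpNormedRing
  let : NormedAlgebra ℂ (Matrix n n ℂ) := Matrix.linftyOpNormedAlgebra
  have : CompleteSpace (Matrix n n ℂ) := FiniteDimensional.complete ℂ _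
  intro i j
  exact (LinearMap.toContinuousLinearMap
    (Matrix.entryLinearMap ℂ ℂ i j : Matrix n n ℂ →ₗ[ℂ] ℂ)).hasFDerivAt.comp_hasDerivAt t
    (hasDerivAt_exp_smul_const' N t)

/-! ### The commuting one-parameter groups generated by the powers of a matrix -/

variable {d : ℕ}

/-- `∑_k t_{kβ} Y^k`. -/
def timePoly (Y : Matrix n n ℂ) (β : Fin d) : Times d →ₗ[ℂ] Matrix n n ℂ :=
  Finsupp.linearCombination ℂ fun kγ => if kγ.2 = β then Y ^ kγ.1 else 0

/-- `exp (∑_k t_{kβ} Y^k)`. -/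
def timeExp (Y : Matrix n n ℂ) (β : Fin d) (t : Times d) : Matrix n n ℂ :=
  NormedSpace.exp (timePoly Y β t)

theorem timePoly_single (Y : Matrix n n ℂ) (β γ : Fin d) (k : ℕ) (s : ℂ) :
    timePoly Y β (Finsupp.single (k, γ) s) = s • if γ = β then Y ^ k else 0 := by
  rw [timePoly, Finsupp.linearCombination_single]

theorem semiconjBy_timePoly {a Y Y' : Matrix n n ℂ} (h : SemiconjBy a Y Y') (β : Fin d)
    (t : Times d) : SemiconjBy a (timePoly Y β t) (timePoly Y' β t) := by
  induction t using Finsupp.induction_linear with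
  | zero => simp only [map_zero]; exact SemiconjBy.zero_right a
  | add s t hs ht => simp only [map_add]; exact hs.add_right ht
  | single kγ s =>
    obtain ⟨k, γ⟩ := kγ
    rw [timePoly_single, timePoly_single]
    refine SemiconjBy.smul_right ?_ s
    split_ifs
    · exact h.pow_right k
    · exact SemiconjBy.zero_right a

theorem semiconjBy_timeExp {a Y Y' : Matrix n n ℂ} (h : SemiconjBy a Y Y') (β : Fin d)
    (t : Times d) : SemiconjBy a (timeExp Y β t) (timeExp Y' β t) :=
  Matrix.semiconjBy_exp (semiconjBy_timePoly h β t)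

theorem commute_timePoly (Y : Matrix n n ℂ) (β γ : Fin d) (s t : Times d) :
    Commute (timePoly Y β s) (timePoly Y γ t) :=
  semiconjBy_timePoly ((semiconjBy_timePoly (Commute.refl Y) β s : Commute Y _).symm) γ t

theorem timeExp_zero (Y : Matrix n n ℂ) (β : Fin d) : timeExp Y β 0 = 1 := by
  rw [timeExp, map_zero, NormedSpace.exp_zero]

theorem timeExp_add (Y : Matrix n n ℂ) (β : Fin d) (s t : Times d) :
    timeExp Y β (s + t) = timeExp Y β s * timeExp Y β t := by
  rw [timeExp, map_add, Matrix.exp_add_of_commute _ _ (commute_timePoly Y β β s t)]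
  rfl

theorem timeExp_mul_neg (Y : Matrix n n ℂ) (β : Fin d) (t : Times d) :
    timeExp Y β t * timeExp Y β (-t) = 1 := by
  rw [← timeExp_add, add_neg_cancel, timeExp_zero]

theorem timeExp_neg_mul (Y : Matrix n n ℂ) (β : Fin d) (t : Times d) :
    timeExp Y β (-t) * timeExp Y β t = 1 := by
  rw [← timeExp_add, neg_add_cancel, timeExp_zero]

theorem hasDerivAt_timeExp (Y : Matrix n n ℂ) (β γ : Fin d) (k : ℕ) (t : Times d) (s₀ : ℂ) :
    EntryHasDerivAt (fun s => timeExp Y β (t + Finsupp.single (k, γ) s))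
      ((if γ = β then Y ^ k else 0) * timeExp Y β (t + Finsupp.single (k, γ) s₀)) s₀ := by
  have h : ∀ s : ℂ, timeExp Y β (t + Finsupp.single (k, γ) s) =
      NormedSpace.exp (s • if γ = β then Y ^ k else 0) * timeExp Y β t := by
    intro s
    rw [add_comm, timeExp_add, timeExp, timePoly_single]
  simp only [h, ← mul_assoc]
  exact (Matrix.hasDerivAt_exp_smul _ s₀).mul_const _

theorem hasDerivAt_timeExp_neg (Y : Matrix n n ℂ) (β γ : Fin d) (k : ℕ) (t : Times d) (s₀ : ℂ) :
    EntryHasDerivAt (fun s => timeExp Y β (-(t + Finsupp.single (k, γ) s)))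
      (-((if γ = β then Y ^ k else 0) * timeExp Y β (-(t + Finsupp.single (k, γ) s₀)))) s₀ := by
  have h := hasDerivAt_timeExp Y β γ k (-t) (-s₀)
  intro i j
  have := (h i j).scomp s₀ (hasDerivAt_neg s₀)
  simpa [Function.comp_def, Finsupp.single_neg, neg_add, add_comm] using this

/-- The matrix `(Y u; 0 Y)`. -/
def jet (Y u : Matrix n n ℂ) : Matrix (n ⊕ n) (n ⊕ n) ℂ := Matrix.fromBlocks Y u 0 Y

/-- The derivative of `exp (∑_k t_{kβ} Y^k)` in the direction `u`, as a function of `Y`: the upper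
right block of the same exponential for the matrix `(Y u; 0 Y)`. -/
def timeExpDeriv (Y u : Matrix n n ℂ) (β : Fin d) (t : Times d) : Matrix n n ℂ :=
  (timeExp (jet Y u) β t).toBlocks₁₂

theorem jet_pow (Y u : Matrix n n ℂ) (k : ℕ) : jet Y u ^ k =
    jet (Y ^ k) (∑ l ∈ Finset.range k, Y ^ l * u * Y ^ (k - 1 - l)) := by
  induction k with
  | zero => simp [jet, Matrix.fromBlocks_one]
  | succ k ih =>
    rw [pow_succ, ih, jet, jet, jet, Matrix.fromBlocks_multiply, pow_succ]
    simp only [Matrix.mul_zero, Matrix.zero_mul, add_zero, zero_add]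
    rw [Finset.sum_range_succ, Finset.sum_mul, add_comm]
    congr 2
    · refine Finset.sum_congr rfl fun l hl => ?_
      rw [Finset.mem_range] at hl
      have : k + 1 - 1 - l = k - 1 - l + 1 := by omega
      rw [this, pow_succ]
      simp only [mul_assoc]
    · simp

/-- `Y ↦ (Y 0; 0 Y)` as a homomorphism of algebras. -/
def jetConst : Matrix n n ℂ →ₐ[ℂ] Matrix (n ⊕ n) (n ⊕ n) ℂ :=
  AlgHom.ofLinearMap
    { toFun := fun Y => jet Y 0
      map_add' := fun Y Z => by simp [jet, Matrix.fromBlocks_add]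
      map_smul' := fun r Y => by simp [jet, Matrix.fromBlocks_smul] }
    Matrix.fromBlocks_one
    fun Y Z => by simp [jet, Matrix.fromBlocks_multiply]

theorem timeExp_jet_zero (Y : Matrix n n ℂ) (β : Fin d) (t : Times d) :
    timeExp (jet Y 0) β t = jet (timeExp Y β t) 0 := by
  have h : timePoly (jet Y 0) β t = jetConst (timePoly Y β t) := by
    simp only [timePoly, Finsupp.linearCombination_apply, Finsupp.sum, _root_.map_sum, map_smul]
    refine Finset.sum_congr rfl fun kγ _ => ?_
    split_ifs
    · rw [map_pow]; rfl
    · rw [map_zero]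
  rw [timeExp, h, ← Matrix.map_exp_of_continuous jetConst]
  · rfl
  · exact Continuous.matrix_fromBlocks continuous_id continuous_const continuous_const continuous_id

/-- The upper triangular form of the exponential of `(Y u; 0 Y)`. -/
theorem timeExp_jet (Y u : Matrix n n ℂ) (β : Fin d) (t : Times d) :
    timeExp (jet Y u) β t = jet (timeExp Y β t) (timeExpDeriv Y u β t) := by
  -- `(Y u; 0 Y)` acts by `Y` on the first summand and on the quotient by it
  have h1 : SemiconjBy (Matrix.fromBlocks 1 0 0 0) (jet Y 0) (jet Y u) := by
    simp [SemiconjBy, jet, Matrix.fromBlocks_multiply]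
  have h2 : SemiconjBy (Matrix.fromBlocks 0 0 0 1) (jet Y u) (jet Y 0) := by
    simp [SemiconjBy, jet, Matrix.fromBlocks_multiply]
  have h1 := (semiconjBy_timeExp h1 β t).eq
  have h2 := (semiconjBy_timeExp h2 β t).eq
  rw [timeExp_jet_zero, ← Matrix.fromBlocks_toBlocks (timeExp (jet Y u) β t),
    jet.eq_1 (timeExp Y β t), Matrix.fromBlocks_multiply, Matrix.fromBlocks_multiply,
    Matrix.fromBlocks_inj] at h1 h2
  simp only [Matrix.mul_zero, Matrix.zero_mul, add_zero, zero_add, Matrix.one_mul,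
    Matrix.mul_one] at h1 h2
  rw [← Matrix.fromBlocks_toBlocks (timeExp (jet Y u) β t), ← h1.1, ← h1.2.2.1, h2.2.2.2]
  rfl

theorem timeExpDeriv_zero (Y u : Matrix n n ℂ) (β : Fin d) : timeExpDeriv Y u β 0 = 0 := by
  rw [timeExpDeriv, timeExp_zero, ← Matrix.fromBlocks_one, Matrix.toBlocks_fromBlocks₁₂]

theorem timeExpDeriv_add (Y u : Matrix n n ℂ) (β : Fin d) (s t : Times d) :
    timeExpDeriv Y u β (s + t) =
      timeExp Y β s * timeExpDeriv Y u β t + timeExpDeriv Y u β s * timeExp Y β t := by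
  rw [timeExpDeriv, timeExp_add, timeExp_jet, timeExp_jet, jet, jet, Matrix.fromBlocks_multiply,
    Matrix.toBlocks_fromBlocks₁₂]

/-- `Y D + u E = E u + D Y` for `E = exp (∑_k t_{kβ} Y^k)` and `D` its derivative in the direction
`u`: the derivative of the relation `Y E = E Y`. -/
theorem mul_timeExpDeriv (Y u : Matrix n n ℂ) (β : Fin d) (t : Times d) :
    Y * timeExpDeriv Y u β t + u * timeExp Y β t =
      timeExp Y β t * u + timeExpDeriv Y u β t * Y := by
  have h := (semiconjBy_timeExp (Commute.refl (jet Y u)) β t).eq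
  rw [timeExp_jet, jet, jet, Matrix.fromBlocks_multiply, Matrix.fromBlocks_multiply,
    Matrix.fromBlocks_inj] at h
  exact h.2.1

/-- Conjugation by the block diagonal matrix `(a 0; 0 b)`. -/
theorem timeExpDeriv_semiconj {a b Y Y' u u' : Matrix n n ℂ} (ha : SemiconjBy a Y Y')
    (hb : SemiconjBy b Y Y') (hu : a * u = u' * b) (β : Fin d) (t : Times d) :
    a * timeExpDeriv Y u β t = timeExpDeriv Y' u' β t * b := by
  have h : SemiconjBy (Matrix.fromBlocks a 0 0 b) (jet Y u) (jet Y' u') := by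
    simp [SemiconjBy, jet, Matrix.fromBlocks_multiply, ha.eq, hb.eq, hu]
  have h := (semiconjBy_timeExp h β t).eq
  rw [timeExp_jet, timeExp_jet, jet, jet, Matrix.fromBlocks_multiply, Matrix.fromBlocks_multiply,
    Matrix.fromBlocks_inj] at h
  simpa only [Matrix.mul_zero, Matrix.zero_mul, add_zero, zero_add] using h.2.1

theorem hasDerivAt_timeExpDeriv (Y u : Matrix n n ℂ) (β γ : Fin d) (k : ℕ) (t : Times d) (s₀ : ℂ) :
    EntryHasDerivAt (fun s => timeExpDeriv Y u β (t + Finsupp.single (k, γ) s))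
      (if γ = β then Y ^ k * timeExpDeriv Y u β (t + Finsupp.single (k, γ) s₀) +
        (∑ l ∈ Finset.range k, Y ^ l * u * Y ^ (k - 1 - l)) *
          timeExp Y β (t + Finsupp.single (k, γ) s₀) else 0) s₀ := by
  intro i j
  have h := hasDerivAt_timeExp (jet Y u) β γ k t s₀ (Sum.inl i) (Sum.inr j)
  refine h.congr_deriv ?_
  split_ifs
  · rw [jet_pow, timeExp_jet, jet, jet, Matrix.fromBlocks_multiply, Matrix.fromBlocks_apply₁₂]
  · rw [Matrix.zero_mul]; rfl

theorem commute_timeExp (Y : Matrix n n ℂ) (β γ : Fin d) (s t : Times d) :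
    Commute (timeExp Y β s) (timeExp Y γ t) :=
  semiconjBy_timeExp ((semiconjBy_timeExp (Commute.refl Y) β s : Commute Y _).symm) γ t

theorem commute_pow_timeExp (Y : Matrix n n ℂ) (k : ℕ) (γ : Fin d) (t : Times d) :
    Commute (Y ^ k) (timeExp Y γ t) :=
  semiconjBy_timeExp ((Commute.refl Y).pow_left k) γ t

end Exponential

/-! ### The Hamiltonian flow -/

namespace EntryHasDerivAt
variable {p q : Type*} {t : ℂ}

theorem sum {ι : Type*} (s : Finset ι) {N : ι → ℂ → Matrix p q ℂ} {N' : ι → Matrix p q ℂ}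
    (h : ∀ i ∈ s, EntryHasDerivAt (N i) (N' i) t) :
    EntryHasDerivAt (fun x => ∑ i ∈ s, N i x) (∑ i ∈ s, N' i) t := fun a b => by
  simp only [Matrix.sum_apply]
  exact HasDerivAt.fun_sum fun i hi => h i hi a b

theorem hpart {m : ℕ} {α : ZMod m → ℕ} [NeZero m]
    {N : ℂ → Matrix (VIndex α) (VIndex α) ℂ} {N' : Matrix (VIndex α) (VIndex α) ℂ}
    (h : EntryHasDerivAt N N' t) (r : ZMod m) :
    EntryHasDerivAt (fun s => FramedData.hpart r (N s)) (FramedData.hpart r N') t := fun a b => by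
  simp only [FramedData.hpart_apply]
  split_ifs
  · exact h a b
  · exact hasDerivAt_const _ _

end EntryHasDerivAt

namespace FramedData
variable {m : ℕ} [NeZero m] {α : ZMod m → ℕ} {d : ℕ}

/-- The rank one matrix `v E_β w`. -/
def vw (p : FramedData α d) (β : Fin d) : Matrix (VIndex α) (VIndex α) ℂ :=
  p.v * Matrix.single β β (1 : ℂ) * p.w

/-- The displacement of `X` in time `t`, up to sign and up to taking the component of degree `1`:
`∑_β E_β(t)⁻¹ D_β(t)`, where `E_β(t) = exp (∑_k t_{kβ} Y^k)` and `D_β(t)` is its derivative as a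
function of `Y` in the direction `v E_β w`. -/
def drift (t : Times d) (p : FramedData α d) : Matrix (VIndex α) (VIndex α) ℂ :=
  ∑ β : Fin d, timeExp p.Y β (-t) * timeExpDeriv p.Y (p.vw β) β t

/-- The joint flow of the Hamiltonians `H_{k,β}` on representations, in closed form. -/
def flowData (t : Times d) (p : FramedData α d) : FramedData α d where
  X := p.X - hpart 1 (drift t p)
  Y := p.Y
  v := ∑ β : Fin d, timeExp p.Y β (-t) * p.v * Matrix.single β β (1 : ℂ)
  w := ∑ β : Fin d, Matrix.single β β (1 : ℂ) * p.w * timeExp p.Y β t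

theorem flowData_v_mul_single (t : Times d) (p : FramedData α d) (β : Fin d) :
    (flowData t p).v * Matrix.single β β (1 : ℂ) =
      timeExp p.Y β (-t) * p.v * Matrix.single β β (1 : ℂ) := by
  rw [flowData, Matrix.sum_mul, Finset.sum_eq_single β]
  · rw [Matrix.mul_assoc, Matrix.single_mul_single_same, mul_one]
  · intro γ _ hγ
    rw [Matrix.mul_assoc, Matrix.single_mul_single_of_ne _ _ _ _ hγ, Matrix.mul_zero]
  · intro h; exact absurd (Finset.mem_univ _) h

theorem single_mul_flowData_w (t : Times d) (p : FramedData α d) (β : Fin d) :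
    Matrix.single β β (1 : ℂ) * (flowData t p).w =
      Matrix.single β β (1 : ℂ) * p.w * timeExp p.Y β t := by
  rw [flowData, Matrix.mul_sum, Finset.sum_eq_single β]
  · rw [← Matrix.mul_assoc, ← Matrix.mul_assoc, Matrix.single_mul_single_same, mul_one]
  · intro γ _ hγ
    rw [← Matrix.mul_assoc, ← Matrix.mul_assoc, Matrix.single_mul_single_of_ne _ _ _ _ hγ.symm,
      Matrix.zero_mul, Matrix.zero_mul]
  · intro h; exact absurd (Finset.mem_univ _) h

theorem vw_flowData (t : Times d) (p : FramedData α d) (β : Fin d) :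
    (flowData t p).vw β = timeExp p.Y β (-t) * p.vw β * timeExp p.Y β t := by
  have h : (Matrix.single β β (1 : ℂ) : Matrix (Fin d) (Fin d) ℂ) =
      Matrix.single β β (1 : ℂ) * Matrix.single β β (1 : ℂ) := by
    rw [Matrix.single_mul_single_same, mul_one]
  rw [vw, h, ← Matrix.mul_assoc, flowData_v_mul_single, Matrix.mul_assoc _ (Matrix.single β β (1 : ℂ)),
    single_mul_flowData_w, vw]
  conv_rhs => rw [h]
  simp only [Matrix.mul_assoc]

theorem sum_vw (p : FramedData α d) : ∑ β : Fin d, p.vw β = p.v * p.w := by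
  simp only [vw]
  rw [← Matrix.sum_mul, ← Matrix.mul_sum, Matrix.sum_single_one, Matrix.mul_one]

theorem flowData_zero (p : FramedData α d) : flowData 0 p = p := by
  ext1
  · change p.X - hpart 1 (drift 0 p) = p.X
    simp only [drift, timeExpDeriv_zero, mul_zero, Finset.sum_const_zero, map_zero, sub_zero]
  · rfl
  · change ∑ β : Fin d, timeExp p.Y β (-0) * p.v * Matrix.single β β (1 : ℂ) = p.v
    simp only [neg_zero, timeExp_zero, Matrix.one_mul]
    rw [← Matrix.mul_sum, Matrix.sum_single_one, Matrix.mul_one]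
  · change ∑ β : Fin d, Matrix.single β β (1 : ℂ) * p.w * timeExp p.Y β 0 = p.w
    simp only [timeExp_zero, Matrix.mul_one]
    rw [← Matrix.sum_mul, Matrix.sum_single_one, Matrix.one_mul]

/-- The cocycle property of the displacement of `X`, from the product rule for `E_β(s + t) = E_β(s) E_β(t)`. -/
theorem drift_add (s t : Times d) (p : FramedData α d) :
    drift (s + t) p = drift t p + drift s (flowData t p) := by
  rw [drift, drift, drift, ← Finset.sum_add_distrib]
  refine Finset.sum_congr rfl fun β _ => ?_
  have h : timeExp p.Y β (-t) * timeExpDeriv p.Y (p.vw β) β s =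
      timeExpDeriv p.Y ((flowData t p).vw β) β s * timeExp p.Y β (-t) := by
    have hc : SemiconjBy (timeExp p.Y β (-t)) p.Y p.Y :=
      (semiconjBy_timeExp (Commute.refl p.Y) β (-t) : Commute p.Y _).symm
    refine timeExpDeriv_semiconj hc hc ?_ β s
    rw [vw_flowData, mul_assoc, timeExp_mul_neg, mul_one]
  have h' : timeExpDeriv p.Y ((flowData t p).vw β) β s =
      timeExp p.Y β (-t) * timeExpDeriv p.Y (p.vw β) β s * timeExp p.Y β t := by
    rw [h, mul_assoc, timeExp_neg_mul, mul_one]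
  change _ = _ + timeExp p.Y β (-s) * timeExpDeriv p.Y ((flowData t p).vw β) β s
  rw [h', timeExpDeriv_add, neg_add, timeExp_add, mul_add]
  congr 1
  · rw [(commute_timeExp p.Y β β (-s) (-t)).eq, mul_assoc, ← mul_assoc (timeExp p.Y β (-s)),
      timeExp_neg_mul, one_mul]
  · simp only [mul_assoc]

theorem flowData_add (s t : Times d) (p : FramedData α d) :
    flowData (s + t) p = flowData s (flowData t p) := by
  ext1
  · change p.X - hpart 1 (drift (s + t) p) =
      p.X - hpart 1 (drift t p) - hpart 1 (drift s (flowData t p))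
    rw [drift_add, map_add, sub_add_eq_sub_sub]
  · rfl
  · change ∑ β : Fin d, timeExp p.Y β (-(s + t)) * p.v * Matrix.single β β (1 : ℂ) =
      ∑ β : Fin d, timeExp p.Y β (-s) * (flowData t p).v * Matrix.single β β (1 : ℂ)
    refine Finset.sum_congr rfl fun β _ => ?_
    rw [Matrix.mul_assoc _ (flowData t p).v, flowData_v_mul_single, neg_add, timeExp_add]
    simp only [Matrix.mul_assoc]
  · change ∑ β : Fin d, Matrix.single β β (1 : ℂ) * p.w * timeExp p.Y β (s + t) =
      ∑ β : Fin d, Matrix.single β β (1 : ℂ) * (flowData t p).w * timeExp p.Y β s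
    refine Finset.sum_congr rfl fun β _ => ?_
    rw [single_mul_flowData_w, add_comm, timeExp_add]
    simp only [Matrix.mul_assoc]

/-- The displacement of `X` compensates the change of `v w` in the moment relation. -/
theorem drift_commutator (t : Times d) (p : FramedData α d) :
    p.Y * drift t p - drift t p * p.Y = p.v * p.w - (flowData t p).v * (flowData t p).w := by
  rw [← sum_vw, ← sum_vw, drift, Matrix.mul_sum, Matrix.sum_mul, ← Finset.sum_sub_distrib,
    ← Finset.sum_sub_distrib]
  refine Finset.sum_congr rfl fun β _ => ?_
  have h := mul_timeExpDeriv p.Y (p.vw β) β t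
  have hc : p.Y * timeExp p.Y β (-t) = timeExp p.Y β (-t) * p.Y :=
    semiconjBy_timeExp (Commute.refl p.Y) β (-t)
  rw [vw_flowData, ← mul_assoc, hc, mul_assoc, eq_sub_of_add_eq h, mul_sub, mul_add, ← mul_assoc,
    timeExp_neg_mul, one_mul]
  simp only [mul_assoc]
  abel

theorem isRep_flowData {p : FramedData α d} (hp : p.IsRep) (t : Times d) : (flowData t p).IsRep := by
  rw [isRep_iff] at hp ⊢
  exact ⟨hp.1.sub (isHomog_hpart _ _), hp.2⟩

theorem momentRelation_flowData (c : CherednikParameters m) {p : FramedData α d} (hp : p.IsRep)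
    (hm : p.MomentRelation c) (t : Times d) : (flowData t p).MomentRelation c := by
  rw [momentRelation_iff] at hm ⊢
  have hY := ((isRep_iff p).1 hp).2
  rw [← hm]
  change p.Y * (p.X - hpart 1 (drift t p)) - (p.X - hpart 1 (drift t p)) * p.Y - _ = _
  have h1 := hY.mul_hpart 1 (drift t p)
  have h2 := hY.hpart_mul 1 (drift t p)
  rw [neg_add_cancel] at h1
  rw [add_neg_cancel] at h2
  have h3 := congrArg (hpart 0) (drift_commutator t p)
  rw [map_sub, map_sub, ← h1, ← h2] at h3
  rw [mul_sub, sub_mul, ← sub_eq_zero]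
  rw [← sub_eq_zero] at h3
  rw [← neg_eq_zero, ← h3]
  abel

theorem drift_smul (t : Times d) (g : ∀ i : ZMod m, GL (Fin (α i)) ℂ) (p : FramedData α d) :
    drift t (g • p) = block g * drift t p * block g⁻¹ := by
  rw [drift, drift, Matrix.mul_sum, Matrix.sum_mul]
  refine Finset.sum_congr rfl fun β _ => ?_
  have hg : SemiconjBy (block g) p.Y (g • p).Y := by
    change _ = block g * p.Y * block g⁻¹ * block g
    rw [mul_assoc, block_inv_mul_block, mul_one]
  have hu : block g * p.vw β = (g • p).vw β * block g := by
    change _ = block g * p.v * Matrix.single β β (1 : ℂ) * (p.w * block g⁻¹) * block g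
    rw [Matrix.mul_assoc _ (p.w * _), Matrix.mul_assoc p.w, block_inv_mul_block, Matrix.mul_one, vw]
    simp only [Matrix.mul_assoc]
  rw [← mul_assoc, (semiconjBy_timeExp hg β (-t)).eq, mul_assoc (timeExp _ _ _),
    timeExpDeriv_semiconj hg hg hu, mul_assoc, mul_assoc, block_mul_block_inv, mul_one]

theorem flowData_smul (t : Times d) (g : ∀ i : ZMod m, GL (Fin (α i)) ℂ) (p : FramedData α d) :
    flowData t (g • p) = g • flowData t p := by
  have hg : SemiconjBy (block g) p.Y (g • p).Y := by
    change _ = block g * p.Y * block g⁻¹ * block g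
    rw [mul_assoc, block_inv_mul_block, mul_one]
  ext1
  · change block g * p.X * block g⁻¹ - hpart 1 (drift t (g • p)) =
      block g * (p.X - hpart 1 (drift t p)) * block g⁻¹
    have h : ∀ N : Matrix (VIndex α) (VIndex α) ℂ,
        hpart 1 (block g * N * block g⁻¹) = block g * hpart 1 N * block g⁻¹ := by
      intro N
      rw [(isHomog_block g).mul_hpart, (isHomog_block g⁻¹).hpart_mul, zero_add, add_zero]
    rw [drift_smul, h, mul_sub, sub_mul]
  · rfl
  · change ∑ β : Fin d, timeExp (g • p).Y β (-t) * (block g * p.v) * Matrix.single β β (1 : ℂ) =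
      block g * ∑ β : Fin d, timeExp p.Y β (-t) * p.v * Matrix.single β β (1 : ℂ)
    rw [Matrix.mul_sum]
    refine Finset.sum_congr rfl fun β _ => ?_
    rw [← Matrix.mul_assoc, ← (semiconjBy_timeExp hg β (-t)).eq]
    simp only [Matrix.mul_assoc]
  · change ∑ β : Fin d, Matrix.single β β (1 : ℂ) * (p.w * block g⁻¹) * timeExp (g • p).Y β t =
      (∑ β : Fin d, Matrix.single β β (1 : ℂ) * p.w * timeExp p.Y β t) * block g⁻¹
    rw [Matrix.sum_mul]
    refine Finset.sum_congr rfl fun β _ => ?_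
    have h : block g⁻¹ * timeExp (g • p).Y β t = timeExp p.Y β t * block g⁻¹ := by
      have := congrArg (fun N => block g⁻¹ * N * block g⁻¹) (semiconjBy_timeExp hg β t).eq
      simp only [mul_assoc, block_mul_block_inv, mul_one] at this
      rw [← this, ← mul_assoc, block_inv_mul_block, one_mul]
    simp only [Matrix.mul_assoc, h]

theorem hasDerivAt_drift (t : Times d) (p : FramedData α d) (k : ℕ) (β : Fin d) (s₀ : ℂ) :
    EntryHasDerivAt (fun s => drift (t + Finsupp.single (k, β) s) p)
      (flowK k β (flowData (t + Finsupp.single (k, β) s₀) p)) s₀ := by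
  set T := t + Finsupp.single (k, β) s₀ with hT
  have h := EntryHasDerivAt.sum Finset.univ fun γ (_ : γ ∈ (Finset.univ : Finset (Fin d))) =>
    (hasDerivAt_timeExp_neg p.Y γ β k t s₀).mul (hasDerivAt_timeExpDeriv p.Y (p.vw γ) γ β k t s₀)
  refine fun i j => (h i j).congr_deriv (congrFun (congrFun (?_ : (_ : Matrix _ _ ℂ) = _) i) j)
  rw [← hT, Finset.sum_eq_single β]
  · rw [if_pos rfl, if_pos rfl, mul_add, ← mul_assoc (timeExp p.Y β (-T)),
      ← (commute_pow_timeExp p.Y k β (-T)).eq, neg_mul, neg_add_cancel_left, flowK, Finset.sum_mul,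
      Finset.mul_sum]
    refine Finset.sum_congr rfl fun l _ => ?_
    change _ = p.Y ^ l * (flowData T p).vw β * p.Y ^ (k - 1 - l)
    have h1 := (commute_pow_timeExp p.Y l β (-T)).eq
    have h2 := (commute_pow_timeExp p.Y (k - 1 - l) β T).eq
    rw [vw_flowData, mul_assoc, h2, ← mul_assoc, ← mul_assoc, ← mul_assoc, ← h1]
    simp only [mul_assoc]
  · intro γ _ hγ
    rw [if_neg hγ.symm, if_neg hγ.symm, zero_mul, neg_zero, zero_mul, mul_zero, add_zero]
  · intro h; exact absurd (Finset.mem_univ _) h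

/-- Each coordinate direction of the flow is an integral curve of the corresponding Hamiltonian vector
field. -/
theorem hasVelocityAt_flowData (t : Times d) (p : FramedData α d) (k : ℕ) (β : Fin d) (s₀ : ℂ) :
    HasVelocityAt (fun s => flowData (t + Finsupp.single (k, β) s) p)
      (vel k β (flowData (t + Finsupp.single (k, β) s₀) p)) s₀ := by
  refine ⟨fun a b => ?_, fun a b => hasDerivAt_const _ _, fun a γ => ?_, fun γ a => ?_⟩
  · exact ((hasDerivAt_drift t p k β s₀).hpart 1 a b).const_sub (p.X a b)
  · have h := EntryHasDerivAt.sum Finset.univ fun γ (_ : γ ∈ (Finset.univ : Finset (Fin d))) =>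
      ((hasDerivAt_timeExp_neg p.Y γ β k t s₀).mul_const p.v).mul_const (Matrix.single γ γ (1 : ℂ))
    refine (h a γ).congr_deriv (congrFun (congrFun (?_ : (_ : Matrix _ _ ℂ) = _) a) γ)
    change _ = -(p.Y ^ k * (flowData _ p).v * Matrix.single β β (1 : ℂ))
    rw [Finset.sum_eq_single β, if_pos rfl, Matrix.mul_assoc (p.Y ^ k), flowData_v_mul_single]
    · simp only [Matrix.neg_mul, Matrix.mul_assoc]
    · intro γ _ hγ
      rw [if_neg hγ.symm, Matrix.zero_mul, neg_zero, Matrix.zero_mul, Matrix.zero_mul]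
    · intro h; exact absurd (Finset.mem_univ _) h
  · have h := EntryHasDerivAt.sum Finset.univ fun γ (_ : γ ∈ (Finset.univ : Finset (Fin d))) =>
      (hasDerivAt_timeExp p.Y γ β k t s₀).const_mul (Matrix.single γ γ (1 : ℂ) * p.w)
    refine (h γ a).congr_deriv (congrFun (congrFun (?_ : (_ : Matrix _ _ ℂ) = _) γ) a)
    change _ = Matrix.single β β (1 : ℂ) * (flowData _ p).w * p.Y ^ k
    rw [Finset.sum_eq_single β, if_pos rfl, single_mul_flowData_w,
      (commute_pow_timeExp p.Y k β _).eq]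
    · simp only [Matrix.mul_assoc]
    · intro γ _ hγ
      rw [if_neg hγ.symm, Matrix.zero_mul, Matrix.mul_zero]
    · intro h; exact absurd (Finset.mem_univ _) h

end FramedData

/-! ### The Calogero--Moser spaces and the hierarchy -/

namespace CMSpace
variable {m d : ℕ} [NeZero m] {c : CherednikParameters m} {α : ZMod m → ℕ}

/-- The map `Φ` from the Calogero--Moser space to the phase space of the hierarchy. -/
def toPair : CMSpace c α d → PMat c d × (Fin d → PMat c d) :=
  Quotient.lift (fun p : CMRep c α d => p.1.laxPair c) (by
    rintro p q ⟨g, hg⟩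
    change g • q.1 = p.1 at hg
    rw [← hg, FramedData.laxPair_smul])

/-- The flow on the Calogero--Moser space induced by `FramedData.flowData`. -/
def flow (t : Times d) : CMSpace c α d → CMSpace c α d :=
  Quotient.map (fun p : CMRep c α d => ⟨FramedData.flowData t p.1,
    FramedData.isRep_flowData p.2.1 t, FramedData.momentRelation_flowData c p.2.1 p.2.2 t⟩) (by
    rintro p q ⟨g, hg⟩
    refine ⟨g, ?_⟩
    change g • q.1 = p.1 at hg
    change g • FramedData.flowData t q.1 = FramedData.flowData t p.1
    rw [← hg, FramedData.flowData_smul])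

theorem hierarchyEquationsAt_toPair {k : ℕ} {β : Fin d} {z : ℂ → CMSpace c α d} {t₀ : ℂ}
    (h : IsHamiltonianFlowAt (FramedData.ham k β) z t₀) :
    HierarchyEquationsAt k β (fun t => toPair (z t)) t₀ := by
  obtain ⟨p, hp⟩ := h
  have h0 := hp.self_of_nhds
  have hv := h0.2
  rw [FramedData.hamVec_ham (p t₀).2.1] at hv
  have hH := FramedData.hierarchyEquationsAt_laxPair c (p := fun s => (p s).1) (fun s => (p s).2) hv
  have he : ∀ᶠ s in 𝓝 t₀, (p s).1.laxPair c = toPair (z s) := hp.mono fun s hs => by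
    rw [← hs.1]; rfl
  rw [HierarchyEquationsAt, ← he.self_of_nhds]
  refine ⟨?_, fun γ => ?_⟩
  · intro i j n x
    exact (hH.1 i j n x).congr (he.mono fun s hs => by simp only [hs])
  · intro i j n x
    exact (hH.2 γ i j n x).congr (he.mono fun s hs => by simp only [hs])

theorem isHamiltonianFlowAt_flow (z : CMSpace c α d) (t : Times d) (k : ℕ) (β : Fin d) (s₀ : ℂ) :
    IsHamiltonianFlowAt (FramedData.ham k β)
      (fun s => flow (t + Finsupp.single (k, β) s) z) s₀ := by
  induction z using Quotient.inductionOn with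
  | h p =>
    refine ⟨fun s => ⟨FramedData.flowData (t + Finsupp.single (k, β) s) p.1,
      FramedData.isRep_flowData p.2.1 _, FramedData.momentRelation_flowData c p.2.1 p.2.2 _⟩,
      Eventually.of_forall fun s => ⟨rfl, ?_⟩⟩
    rw [FramedData.hamVec_ham (FramedData.isRep_flowData p.2.1 _)]
    exact FramedData.hasVelocityAt_flowData t p.1 k β s

end CMSpace

end

theorem mainTheorem2 (m d : ℕ) [NeZero m] (c : CherednikParameters m) (α : ZMod m → ℕ) :
    (∀ (k : ℕ) (β : Fin d) (p : FramedData α d), p.IsRep →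
      FramedData.hamVec (FramedData.ham k β) p = FramedData.flowField k β p) ∧
    (∀ (k l : ℕ) (β γ : Fin d) (p : FramedData α d), p.IsRep →
      FramedData.poisson (FramedData.ham k β) (FramedData.ham l γ) p = 0) ∧
    (∀ (k : ℕ) (β : Fin d) (g : ∀ i : ZMod m, GL (Fin (α i)) ℂ) (p : FramedData α d),
      FramedData.ham k β (g • p) = FramedData.ham k β p) ∧
    ∃ Φ : CMSpace c α d → PMat c d × (Fin d → PMat c d),
      (∀ p : CMRep c α d, IsUnit (p.1.dressing c) ∧ Φ (CMSpace.of p) = p.1.laxPair c) ∧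
      (∀ z : CMSpace c α d, IsHierarchyPoint (Φ z)) ∧
      (∀ (k : ℕ) (β : Fin d) (z : ℂ → CMSpace c α d) (t₀ : ℂ),
        IsHamiltonianFlowAt (FramedData.ham k β) z t₀ →
          HierarchyEquationsAt k β (fun t => Φ (z t)) t₀) ∧
      ∃ flow : Times d → CMSpace c α d → CMSpace c α d,
        (∀ z, flow 0 z = z) ∧
        (∀ (s t : Times d) (z : CMSpace c α d), flow (s + t) z = flow s (flow t z)) ∧
        (∀ (z : CMSpace c α d) (t : Times d) (k : ℕ) (β : Fin d) (s₀ : ℂ),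
          IsHamiltonianFlowAt (FramedData.ham k β)
            (fun s => flow (t + Finsupp.single (k, β) s) z) s₀) ∧
        ∀ z : CMSpace c α d, IsHierarchySolution (fun t => Φ (flow t z)) := by
  have hpoint : ∀ z : CMSpace c α d, IsHierarchyPoint (CMSpace.toPair z) := fun z =>
    Quotient.inductionOn z fun p => FramedData.isHierarchyPoint_laxPair c p.2.1 p.2.2
  refine ⟨fun k β p hp => ?_, fun k l β γ p hp => FramedData.poisson_ham_ham hp k l β γ,
    FramedData.ham_smul, CMSpace.toPair,
    fun p => ⟨FramedData.isUnit_dressing c p.2.1 p.2.2, rfl⟩, hpoint,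
    fun k β z t₀ => CMSpace.hierarchyEquationsAt_toPair, CMSpace.flow, fun z => ?_, fun s t z => ?_,
    CMSpace.isHamiltonianFlowAt_flow, fun z => ⟨fun t => hpoint _, fun t k β =>
      CMSpace.hierarchyEquationsAt_toPair (CMSpace.isHamiltonianFlowAt_flow z t k β 0)⟩⟩
  · rw [FramedData.hamVec_ham hp, FramedData.flowField_eq hp]
  · induction z using Quotient.inductionOn with
    | h p => exact congrArg (Quotient.mk _) (Subtype.ext (FramedData.flowData_zero p.1))
  · induction z using Quotient.inductionOn with
    | h p => exact congrArg (Quotient.mk _) (Subtype.ext (FramedData.flowData_add s t p.1))
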